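/- **Setting.** A quadrilateral creased paper with $m$ rows and $n$ columns of inner vertices is given by points $V_{j,i}\in\mathbb{R}^2$ ($0\le j\le m+1$, $0\le i\le n+1$) such that the panels with corners $V_{j,i},V_{j,i+1},V_{j+1,i+1},V_{j+1,i}$ are strictly convex quadrilaterals, and two panels meet only in their common corners and the crease between them. The inner vertices are those with $1\le j\le m$, $1\le i\le n$. The paper is of the (developable) *parallel repeating type* with input sector angles $\alpha_{4i-3},\alpha_{4i-2},\alpha_{4i-1},\alpha_{4i}$ in column $i$ if these sum to $2\pi$, do not form a cross (not both $\alpha_{4i-3}=\alpha_{4i-1}$ and $\alpha_{4i-2}=\alpha_{4i}$), and the sector angles at $V_{j,i}$ (upper right, upper left, lower left, lower right) are $\alpha_{4i-3},\alpha_{4i-2},\alpha_{4i-1},\alpha_{4i}$ for odd $j$ and $\pi-\alpha_{4i},\pi-\alpha_{4i-1},\pi-\alpha_{4i-2},\pi-\alpha_{4i-3}$ for even $j$. A *rigidly folded state* assigns to the vertices positions in $\mathbb{R}^3$ such that each panel is moved by an isometry; folding angles (here: their magnitudes in $[0,\pi]$) are $\pi$ minus the dihedral angles. Two panels that meet in a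 crease *clash* if the folding angle on it is $\pi$. A *rigid folding motion to the final state* is a path of rigidly folded states over $[0,1]$, continuous in each vertex, which starts at the planar state, has no clash at times $t<1$, and has a clash at $t=1$. For a polygonal line $A_0,\dots,A_{n+1}$ in $\mathbb{R}^3$ let $\beta_i=\angle A_{i-1}A_iA_{i+1}$, and let $\theta_i\in[0,2\pi)$ be the angle of the rotation about $\overrightarrow{A_iA_{i+1}}$ from the half-plane of $A_{i-1}$ to that of $A_{i+2}$. **Proposition.** Let $\Gamma:[a,b]\to\mathbb{R}^3$, $a<b$, be Darboux-integrable (in each coordinate). For all $\varepsilon>0$, $\rho_4\in(0,\pi)$ and $m\ge1$ there are $n\ge1$, a creased paper of the parallel repeating type with $m$ rows and $n$ columns of inner vertices, and a rigid folding motion of it to a final state, such that the first row $A_0,\dots,A_{n+1}$ of the final state (inner vertices $A_1,\dots,A_n$) approximates $\Gamma$: 1. the Hausdorff distance between $\{A_1,\dots,A_n\}$ and $\Gamma([a,b])$ is at most $\varepsilon$; moreover there are $a=u_0\le u_1\le\dots\le u_{n+1}=b$ with $u_{i+1}-u_i\le\varepsilon$ and $\|A_i-\Gamma(u_i)\|\le\varepsilon$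 for all $i$; 2. in the final state the panels clash at the left of the first column (the folding angle on the crease to the left of the first inner vertex of each row is $\pi$), and the folding angles on all other creases of the rows are $\rho_4$; 3. the first column is of the straight-line kind, $\alpha_1+\alpha_4=\alpha_2+\alpha_3=\pi$; all others are flat-foldable, $\alpha_{4i-3}+\alpha_{4i-1}=\alpha_{4i-2}+\alpha_{4i}=\pi$ ($2\le i\le n$); 4. $0<\beta_i<\pi$ for $1\le i\le n$, and the sector angles are related to the polygonal line by $$\pi=2\arccos\frac{\cos\alpha_2\cos\beta_1-\cos\alpha_1}{\sin\alpha_2\sin\beta_1},\qquad \rho_4=2\arccos\frac{\cos\alpha_1\cos\beta_1-\cos\alpha_2}{\sin\alpha_1\sin\beta_1},$$ and, for $1\le i\le n-1$, modulo $2\pi$ and with suitable signs (independent of each other, and depending on $i$), $$\arccos\frac{\cos\alpha_{4i-3}\cos\beta_i-\cos\alpha_{4i-2}}{\sin\alpha_{4i-3}\sin\beta_i}\pm\arccos\frac{\cos\alpha_{4i-1}-\cos\alpha_{4i}\cos\beta_i}{\sin\alpha_{4i}\sin\beta_i}\equiv\pm\Bigl(\arccos\frac{\cos\alpha_{4i+2}\cos\beta_{i+1}-\cos\alpha_{4i+1}}{\sin\alpha_{4i+2}\sin\beta_{i+1}}\pm\arccos\frac{\cos\alpha_{4i+4}-\cos\alpha_{4i+3}\cos\beta_{i+1}}{\sin\alpha_{4i+3}\sin\beta_{i+1}}\Bigr),$$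 $$\theta_i\equiv\pm\arccos\frac{\cos\alpha_{4i-2}-\cos\alpha_{4i-3}\cos\beta_i}{\sin\alpha_{4i-3}\sin\beta_i}\pm\arccos\frac{\cos\alpha_{4i+1}-\cos\alpha_{4i+2}\cos\beta_{i+1}}{\sin\alpha_{4i+2}\sin\beta_{i+1}}.$$ -/

import Mathlib

open scoped Real

/-- The Euclidean plane, in which the unfolded paper lies. -/
abbrev E2 : Type := EuclideanSpace ℝ (Fin 2)

/-- Euclidean three-space, in which the paper is folded. -/
abbrev E3 : Type := EuclideanSpace ℝ (Fin 3)

noncomputable section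

/-! ### Darboux integrability -/

/-- `g` is Darboux-integrable on `[a, b]`: it is bounded there, and the difference of its upper and
lower Darboux sums can be made arbitrarily small. -/
def DarbouxIntegrable (g : ℝ → ℝ) (a b : ℝ) : Prop :=
  BddAbove (g '' Set.Icc a b) ∧ BddBelow (g '' Set.Icc a b) ∧
  ∀ η : ℝ, 0 < η → ∃ (N : ℕ) (p : ℕ → ℝ), Monotone p ∧ p 0 = a ∧ p N = b ∧
    ∑ k ∈ Finset.range N,
      (sSup (g '' Set.Icc (p k) (p (k + 1))) - sInf (g '' Set.Icc (p k) (p (k + 1))))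
        * (p (k + 1) - p k) < η

/-- A space curve is Darboux-integrable when its three coordinates are. -/
def DarbouxIntegrableCurve (Γ : ℝ → E3) (a b : ℝ) : Prop :=
  ∀ k : Fin 3, DarbouxIntegrable (fun u => Γ u k) a b

/-! ### Quadrilateral creased papers

The vertices of a quadrilateral creased paper with `m` rows and `n` columns of inner vertices are
labelled by pairs `(j, i)`, `0 ≤ j ≤ m + 1` (rows, from top to bottom), `0 ≤ i ≤ n + 1` (columns,
from left to right); the inner vertices are those with `1 ≤ j ≤ m` and `1 ≤ i ≤ n`.  The panels are
labelled by their upper left corners `(j, i)`, `0 ≤ j ≤ m`, `0 ≤ i ≤ n`. -/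

/-- The labels of the four corners of the panel `(j, i)`. -/
def corners (j i : ℕ) : Set (ℕ × ℕ) := {(j, i), (j, i + 1), (j + 1, i), (j + 1, i + 1)}

/-- The panel `(j, i)` in the plane. -/
def panel (V : ℕ × ℕ → E2) (j i : ℕ) : Set E2 := convexHull ℝ (V '' corners j i)

/-- The planar cross product. -/
def cross2 (x y : E2) : ℝ := x 0 * y 1 - x 1 * y 0

/-- `P, Q, R, S` are, in counterclockwise order, the corners of a strictly convex quadrilateral. -/
def ConvexQuad (P Q R S : E2) : Prop :=
  0 < cross2 (Q - P) (R - Q) ∧ 0 < cross2 (R - Q) (S - R) ∧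
  0 < cross2 (S - R) (P - S) ∧ 0 < cross2 (P - S) (Q - P)

/-- The points `V (j, i)` are the vertices of a planar quadrilateral creased paper with `m` rows
and `n` columns of inner vertices: every panel is a strictly convex quadrilateral, and two panels
have nothing in common but their common corners and the crease between these. -/
structure IsCreasedPaper (m n : ℕ) (V : ℕ × ℕ → E2) : Prop where
  convex : ∀ j ≤ m, ∀ i ≤ n,
    ConvexQuad (V (j, i)) (V (j + 1, i)) (V (j + 1, i + 1)) (V (j, i + 1))
  inter : ∀ j ≤ m, ∀ i ≤ n, ∀ j' ≤ m, ∀ i' ≤ n,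
    panel V j i ∩ panel V j' i' = convexHull ℝ (V '' (corners j i ∩ corners j' i'))

/-- The four sector angles at the inner vertex `(j, i)`, in the cyclic order
upper right, upper left, lower left, lower right. -/
def sector (V : ℕ × ℕ → E2) (j i : ℕ) : Fin 4 → ℝ :=
  ![EuclideanGeometry.angle (V (j - 1, i)) (V (j, i)) (V (j, i + 1)),
    EuclideanGeometry.angle (V (j - 1, i)) (V (j, i)) (V (j, i - 1)),
    EuclideanGeometry.angle (V (j + 1, i)) (V (j, i)) (V (j, i - 1)),
    EuclideanGeometry.angle (V (j + 1, i)) (V (j, i)) (V (j, i + 1))]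

/-- A (developable) creased paper of the parallel repeating type with input sector angles
`α i 0, α i 1, α i 2, α i 3` (upper right, upper left, lower left, lower right) in column `i`.
These sum to `2π` and do not form a cross.  They are the sector angles in the odd rows; in the even
rows the supplements occur, in the order which makes the inner creases
`(j, i) - (j, i + 1)`, `j = 1, …, m`, parallel to each other. -/
structure IsParallelRepeating (m n : ℕ) (V : ℕ × ℕ → E2) (α : ℕ → Fin 4 → ℝ) : Prop where
  paper : IsCreasedPaper m n V
  sum_eq : ∀ i, 1 ≤ i → i ≤ n → ∑ k, α i k = 2 * π
  not_cross : ∀ i, 1 ≤ i → i ≤ n → ¬ (α i 0 = α i 2 ∧ α i 1 = α i 3)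
  odd_row : ∀ j i, 1 ≤ j → j ≤ m → 1 ≤ i → i ≤ n → Odd j → ∀ k, sector V j i k = α i k
  even_row : ∀ j i, 1 ≤ j → j ≤ m → 1 ≤ i → i ≤ n → Even j →
    ∀ k, sector V j i k = π - α i k.rev

/-- Sector angles of the "straight-line" kind: the two creases of the column are collinear in the
plane. -/
def StraightLine (a : Fin 4 → ℝ) : Prop := a 0 + a 3 = π ∧ a 1 + a 2 = π

/-- Sector angles of the flat-foldable kind: opposite angles are supplementary. -/
def FlatFoldable (a : Fin 4 → ℝ) : Prop := a 0 + a 2 = π ∧ a 1 + a 3 = π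

/-! ### Rigid folding -/

/-- `W` gives the positions of the vertices in a rigidly folded state: every panel has been moved
as a rigid body. -/
def IsFoldedState (m n : ℕ) (V : ℕ × ℕ → E2) (W : ℕ × ℕ → E3) : Prop :=
  ∀ j ≤ m, ∀ i ≤ n, ∃ T : E2 →ᵃⁱ[ℝ] E3, ∀ c ∈ corners j i, W c = T (V c)

/-- The planar (unfolded) state, placed anywhere in space. -/
def IsPlanarState (m n : ℕ) (V : ℕ × ℕ → E2) (W : ℕ × ℕ → E3) : Prop :=
  ∃ T : E2 →ᵃⁱ[ℝ] E3, ∀ j ≤ m + 1, ∀ i ≤ n + 1, W (j, i) = T (V (j, i))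

/-- The component of `x` orthogonal to `d`. -/
def perp (d x : E3) : E3 := x - (inner ℝ d x / inner ℝ d d) • d

/-- The magnitude, in `[0, π]`, of the folding angle on the crease `AB` between a panel that
contains `X` and a panel that contains `Y`: it is `π` minus the dihedral angle. -/
def foldAngle (A B X Y : E3) : ℝ :=
  π - InnerProductGeometry.angle (perp (B - A) (X - A)) (perp (B - A) (Y - A))

/-- Folding angle on the crease from `(j, i)` to `(j, i + 1)`, for `1 ≤ j ≤ m`, `0 ≤ i ≤ n`. -/
def rowFold (W : ℕ × ℕ → E3) (j i : ℕ) : ℝ :=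
  foldAngle (W (j, i)) (W (j, i + 1)) (W (j - 1, i)) (W (j + 1, i))

/-- Folding angle on the crease from `(j, i)` to `(j + 1, i)`, for `0 ≤ j ≤ m`, `1 ≤ i ≤ n`. -/
def colFold (W : ℕ × ℕ → E3) (j i : ℕ) : ℝ :=
  foldAngle (W (j, i)) (W (j + 1, i)) (W (j, i - 1)) (W (j, i + 1))

/-- No two panels that meet in a crease clash, i.e. are folded onto each other. -/
def ClashFree (m n : ℕ) (W : ℕ × ℕ → E3) : Prop :=
  (∀ j i, 1 ≤ j → j ≤ m → i ≤ n → rowFold W j i < π) ∧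
  (∀ j i, j ≤ m → 1 ≤ i → i ≤ n → colFold W j i < π)

/-- A rigid folding motion, over the time interval `[0, 1]`, from the planar state to a final
rigidly folded state: there is no clash before the time `1`, at which the motion halts because
panels clash. -/
structure IsFoldingMotion (m n : ℕ) (V : ℕ × ℕ → E2) (W : ℝ → ℕ × ℕ → E3) : Prop where
  continuous : ∀ j ≤ m + 1, ∀ i ≤ n + 1, ContinuousOn (fun t => W t (j, i)) (Set.Icc 0 1)
  folded : ∀ t ∈ Set.Icc (0 : ℝ) 1, IsFoldedState m n V (W t)
  planar : IsPlanarState m n V (W 0)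
  clashFree : ∀ t ∈ Set.Ico (0 : ℝ) 1, ClashFree m n (W t)
  clash : ¬ ClashFree m n (W 1)

/-! ### Polygonal lines and spherical trigonometry -/

/-- The angle `A_{i-1} A_i A_{i+1}` of a polygonal line in space. -/
def turnAngle (A : ℕ → E3) (i : ℕ) : ℝ :=
  EuclideanGeometry.angle (A (i - 1)) (A i) (A (i + 1))

/-- The torsion angle, in `[0, 2π)`, on the edge `A_i A_{i+1}`: the angle of the rotation about the
vector `A_i A_{i+1}` which takes the half-plane of `A_{i-1}` to that of `A_{i+2}`. -/
def torsionAngle (A : ℕ → E3) (i : ℕ) : ℝ :=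
  let d := A (i + 1) - A i
  let x := perp d (A (i - 1) - A i)
  let y := perp d (A (i + 2) - A (i + 1))
  toIcoMod Real.two_pi_pos 0
    (Complex.arg ⟨‖d‖ * inner ℝ x y, Matrix.det (Matrix.of fun r c => (![d, x, y] r) c)⟩)

/-- In a spherical triangle with sides `b`, `c` and `a`: the angle between the sides `b` and `c`,
opposite to `a`. -/
def sphAngle (a b c : ℝ) : ℝ :=
  Real.arccos ((Real.cos a - Real.cos b * Real.cos c) / (Real.sin b * Real.sin c))

/-- Its supplement, the angle of which the cosine is `(cos b cos c - cos a) / (sin b sin c)`. -/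
def sphExtAngle (a b c : ℝ) : ℝ :=
  Real.arccos ((Real.cos b * Real.cos c - Real.cos a) / (Real.sin b * Real.sin c))

/-- The equations between the sector angles `a` and the angle `β` of the polygonal line at the
first vertex, for the folding angles `ρ₂` and `ρ₄` on the creases to the left and to the right. -/
def FirstEquations (a : Fin 4 → ℝ) (β ρ₂ ρ₄ : ℝ) : Prop :=
  ρ₂ = 2 * sphExtAngle (a 0) (a 1) β ∧ ρ₄ = 2 * sphExtAngle (a 1) (a 0) β

/-- The equations between the sector angles `a`, `a'` and the angles `β`, `β'` of the polygonal
line at two consecutive vertices, and the torsion angle `θ` between them, for a suitable choice of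
the signs, which depends on the folding motion.  Equations between angles hold modulo `2π`. -/
def GeneralEquations (a a' : Fin 4 → ℝ) (β β' θ : ℝ) : Prop :=
  (∃ s s' s'' : ℤˣ,
    ((sphExtAngle (a 1) (a 0) β + (s : ℤ) * sphAngle (a 2) (a 3) β : ℝ) : Real.Angle) =
      (((s'' : ℤ) * (sphExtAngle (a' 0) (a' 1) β' + (s' : ℤ) * sphAngle (a' 3) (a' 2) β') : ℝ) :
        Real.Angle)) ∧
  (∃ s s' : ℤˣ,
    (θ : Real.Angle) =
      (((s : ℤ) * sphAngle (a 1) (a 0) β + (s' : ℤ) * sphAngle (a' 0) (a' 1) β' : ℝ) : Real.Angle))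

end

/-! The final state is designed first, and the paper is read off from it.

One row generates the whole paper. If the crease vectors `U` and `D` above and below a polygonal
line change along each edge by a multiple of that edge, translating the line alternately along them
gives a `grid` whose rows have parallel edges. This works in the plane and in space alike, so a
spatial row with the same inner products folds all panels at once (`IsPlanarRow.isFoldedState`). In
the plane the panels do not overlap if all edges point to the right and the strips are thin
(`IsPlanarRow.isCreasedPaper`).

A flat-foldable vertex is described by the frames of its two edges that bisect the panels above and
below. If half the folding angle has cosine `c` and signed sine `σ`, these frames differ by the
rotation of the quaternion `1 + q σ j + p c k`, where `p` and `q` stay constant during the motion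
and `σ` only changes sign across the vertex (`rot_upper`, `rot_lower`). Hence any chain of such
vertices moves with a single parameter, half the folding angle `x`. A straight-line vertex in front
of the chain stops the motion: it can be folded as long as `x ≤ τ`, and its left panels close at `x
= τ = ρ₄ / 2`.

In the final state `c` and `s` are fixed positive numbers. A vertex may rotate the frame by `rot P
Q` whenever `|P| / c < |Q| / s`, and it turns the planar row by `2 arctan (P / c)`. With `P = 0`
this gives rotations about the second axis at no planar cost. A vertex with `P ≠ 0`, corrected by
such rotations, gives a rotation about the third axis but also turns the planar row. The opposite
vertex turns the planar row back, and conjugation by a half-turn makes the two spatial rotations add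
up instead of cancelling (`exists_canTurn_rotZ`). So every spatial direction is reached with
arbitrarily short edges, while the planar row ends in its original direction. The line turns near
one target point and then runs along one long edge to the next (`exists_reach`). The targets are
values of the bounded curve on a finite net of its graph, in the order of the parameter
(`exists_partition`).

For the equations, the creases `u`, `d` and the neighbouring edges are projected along an edge to
four complex numbers. The spherical law of cosines expresses the angles between these by sector
angles and turning angles, and the equations compare arguments (`generalEquations_of_edges`). -/

noncomputable section

/-! ### Separation of convex hulls -/

/-- A point of a convex hull at which a linear functional attains its maximum over the generating
set is in the convex hull of the generating points at which this maximum is attained. -/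
theorem mem_convexHull_face {M : Type*} [AddCommGroup M] [Module ℝ M] {s : Set M}
    (f : M →ₗ[ℝ] ℝ) (c : ℝ) (hs : ∀ x ∈ s, f x ≤ c) {x : M} (hx : x ∈ convexHull ℝ s) :
    f x ≤ c ∧ (f x = c → x ∈ convexHull ℝ {y ∈ s | f y = c}) := by
  have hle : ∀ y ∈ convexHull ℝ {y ∈ s | f y = c}, f y = c := by
    intro y hy
    have hconv : Convex ℝ {z | f z = c} := convex_hyperplane f.isLinear c
    exact convexHull_min (fun z hz => hz.2) hconv hy
  have hC : Convex ℝ {y | f y < c ∨ y ∈ convexHull ℝ {y ∈ s | f y = c}} := by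
    intro y hy z hz a b ha hb hab
    have key : ∀ w, (f w < c ∨ w ∈ convexHull ℝ {y ∈ s | f y = c}) → f w ≤ c := by
      rintro w (hw | hw)
      · exact hw.le
      · exact (hle w hw).le
    by_cases h0 : a = 0
    · subst h0; simp at hab; subst hab; simpa using hz
    by_cases h1 : b = 0
    · subst h1; simp at hab; subst hab; simpa using hy
    have ha' : 0 < a := lt_of_le_of_ne ha (Ne.symm h0)
    have hb' : 0 < b := lt_of_le_of_ne hb (Ne.symm h1)
    have hy1 := key y hy
    have hz1 := key z hz
    by_cases hyz : f y < c ∨ f z < c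
    · left
      simp only [map_add, map_smul, smul_eq_mul]
      have : c = a * c + b * c := by rw [← add_mul, hab, one_mul]
      rcases hyz with h | h
      · nlinarith [mul_lt_mul_of_pos_left h ha', mul_le_mul_of_nonneg_left hz1 hb]
      · nlinarith [mul_lt_mul_of_pos_left h hb', mul_le_mul_of_nonneg_left hy1 ha]
    · push Not at hyz
      right
      exact convex_convexHull ℝ _ (hy.resolve_left (not_lt.2 hyz.1))
        (hz.resolve_left (not_lt.2 hyz.2)) ha hb hab
  have hx' := convexHull_min (t := {y | f y < c ∨ y ∈ convexHull ℝ {y ∈ s | f y = c}})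
    (fun y hy => by
      rcases (hs y hy).lt_or_eq with h | h
      · exact Or.inl h
      · exact Or.inr (subset_convexHull ℝ _ ⟨hy, h⟩)) hC hx
  rcases hx' with h | h
  · exact ⟨h.le, fun h' => absurd h' h.ne⟩
  · exact ⟨(hle x h).le, fun _ => h⟩

/-- Two convex hulls that are weakly separated by a level set of a linear functional meet in the
faces that lie in this level set. -/
theorem convexHull_inter_subset {ι M : Type*} [AddCommGroup M] [Module ℝ M] (V : ι → M)
    {s t : Set ι} (f : M →ₗ[ℝ] ℝ) (c : ℝ) (hs : ∀ x ∈ s, f (V x) ≤ c)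
    (ht : ∀ x ∈ t, c ≤ f (V x)) :
    convexHull ℝ (V '' s) ∩ convexHull ℝ (V '' t) ⊆
      convexHull ℝ (V '' {x ∈ s | f (V x) = c}) ∩ convexHull ℝ (V '' {x ∈ t | f (V x) = c}) := by
  rintro x ⟨hxs, hxt⟩
  have h1 := mem_convexHull_face f c (by rintro _ ⟨y, hy, rfl⟩; exact hs y hy) hxs
  have h2 := mem_convexHull_face (-f) (-c)
    (by rintro _ ⟨y, hy, rfl⟩; simpa using ht y hy) hxt
  have hx : f x = c := le_antisymm h1.1 (by simpa using h2.1)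
  refine ⟨convexHull_mono ?_ (h1.2 hx), convexHull_mono ?_ (h2.2 (by simp [hx]))⟩
  · rintro _ ⟨⟨y, hy, rfl⟩, h⟩
    exact ⟨y, ⟨hy, h⟩, rfl⟩
  · rintro _ ⟨⟨y, hy, rfl⟩, h⟩
    exact ⟨y, ⟨hy, by simpa using h⟩, rfl⟩

/-- If the level set of the separating functional meets one of the two generating sets in common
points only, then the convex hulls meet in the convex hull of the common points. -/
theorem convexHull_inter_subset_left {ι M : Type*} [AddCommGroup M] [Module ℝ M] (V : ι → M)
    {s t r : Set ι} (f : M →ₗ[ℝ] ℝ) (c : ℝ) (hs : ∀ x ∈ s, f (V x) ≤ c)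
    (ht : ∀ x ∈ t, c ≤ f (V x)) (hr : ∀ x ∈ s, f (V x) = c → x ∈ r) :
    convexHull ℝ (V '' s) ∩ convexHull ℝ (V '' t) ⊆ convexHull ℝ (V '' r) := fun _ hx =>
  convexHull_mono (Set.image_mono fun y (hy : _ ∧ _) => hr y hy.1 hy.2)
    (convexHull_inter_subset V f c hs ht hx).1

/-- Separation in two stages: by a functional `f`, and within its level set by a functional `g`. -/
theorem convexHull_inter_subset_of_two {ι M : Type*} [AddCommGroup M] [Module ℝ M] (V : ι → M)
    {s t r : Set ι} (f g : M →ₗ[ℝ] ℝ) (c d : ℝ) (hs : ∀ x ∈ s, f (V x) ≤ c)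
    (ht : ∀ x ∈ t, c ≤ f (V x)) (hs' : ∀ x ∈ s, f (V x) = c → g (V x) ≤ d)
    (ht' : ∀ x ∈ t, f (V x) = c → d ≤ g (V x))
    (hr : ∀ x ∈ s, f (V x) = c → g (V x) = d → x ∈ r) :
    convexHull ℝ (V '' s) ∩ convexHull ℝ (V '' t) ⊆ convexHull ℝ (V '' r) := fun _ hx =>
  convexHull_inter_subset_left V g d (fun y (hy : _ ∧ _) => hs' y hy.1 hy.2)
    (fun y (hy : _ ∧ _) => ht' y hy.1 hy.2) (fun y (hy : _ ∧ _) => hr y hy.1 hy.2)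
    (convexHull_inter_subset V f c hs ht hx)

/-! ### The planar cross product -/

theorem cross2_add_left (x y z : E2) : cross2 (x + y) z = cross2 x z + cross2 y z := by
  simp [cross2]; ring
theorem cross2_add_right (x y z : E2) : cross2 x (y + z) = cross2 x y + cross2 x z := by
  simp [cross2]; ring
theorem cross2_smul_left (r : ℝ) (x z : E2) : cross2 (r • x) z = r * cross2 x z := by
  simp [cross2]; ring
theorem cross2_smul_right (r : ℝ) (x z : E2) : cross2 x (r • z) = r * cross2 x z := by
  simp [cross2]; ring
theorem cross2_neg_left (x z : E2) : cross2 (-x) z = -cross2 x z := by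
  simp [cross2]; ring
theorem cross2_neg_right (x z : E2) : cross2 x (-z) = -cross2 x z := by
  simp [cross2]; ring
theorem cross2_self (x : E2) : cross2 x x = 0 := by
  simp [cross2]; ring
theorem cross2_swap (x y : E2) : cross2 x y = -cross2 y x := by
  simp [cross2]; ring

/-- The cross product with a fixed vector on the left. -/
def crossLeft (x : E2) : E2 →ₗ[ℝ] ℝ where
  toFun := cross2 x
  map_add' := cross2_add_right x
  map_smul' r y := cross2_smul_right r x y

theorem crossLeft_apply (x y : E2) : crossLeft x y = cross2 x y := rfl

/-- The first coordinate. -/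
def coordX : E2 →ₗ[ℝ] ℝ where
  toFun x := x 0
  map_add' _ _ := rfl
  map_smul' _ _ := rfl

/-! ### Grids of vertices generated by a row -/

/-- The number of lower creases between the row `1` and the row `j`. -/
def lowerCount (j : ℕ) : ℝ := ((j / 2 : ℕ) : ℝ)

/-- The number of upper creases between the row `1` and the row `j`. -/
def upperCount (j : ℕ) : ℝ := (((j + 1) / 2 : ℕ) : ℝ) - 1

theorem lowerCount_succ_even {j : ℕ} (h : Even j) : lowerCount (j + 1) = lowerCount j := by
  obtain ⟨k, rfl⟩ := h
  unfold lowerCount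
  congr 1; omega

theorem lowerCount_succ_odd {j : ℕ} (h : Odd j) : lowerCount (j + 1) = lowerCount j + 1 := by
  obtain ⟨k, rfl⟩ := h
  unfold lowerCount
  rw [← Nat.cast_add_one]
  congr 1; omega

theorem upperCount_succ_even {j : ℕ} (h : Even j) : upperCount (j + 1) = upperCount j + 1 := by
  obtain ⟨k, rfl⟩ := h
  unfold upperCount
  have : (k + k + 1 + 1) / 2 = (k + k + 1) / 2 + 1 := by omega
  rw [this]; push_cast; ring

theorem upperCount_succ_odd {j : ℕ} (h : Odd j) : upperCount (j + 1) = upperCount j := by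
  obtain ⟨k, rfl⟩ := h
  unfold upperCount
  have : (2 * k + 1 + 1 + 1) / 2 = (2 * k + 1 + 1) / 2 := by omega
  rw [this]

/-- The vertices of which the row `1` is `P`, and the column creases in the column `i` are
alternately translates of `δ • U i` (traversed upwards) and of `δ • D i` (traversed downwards). -/
def grid {M : Type*} [AddCommGroup M] [Module ℝ M] (δ : ℝ) (P U D : ℕ → M) : ℕ × ℕ → M :=
  fun v => P v.2 + (δ * lowerCount v.1) • D v.2 - (δ * upperCount v.1) • U v.2

/-- The vector from a vertex to the next one below. -/
def down {M : Type*} [AddCommGroup M] (U D : ℕ → M) (j i : ℕ) : M :=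
  if Even j then -U i else D i

section grid
variable {M : Type*} [AddCommGroup M] [Module ℝ M]

theorem grid_one (δ : ℝ) (P U D : ℕ → M) (i : ℕ) : grid δ P U D (1, i) = P i := by
  simp [grid, lowerCount, upperCount]

theorem grid_succ_row (δ : ℝ) (P U D : ℕ → M) (j i : ℕ) :
    grid δ P U D (j + 1, i) = grid δ P U D (j, i) + δ • down U D j i := by
  by_cases h : Even j
  · simp only [grid, down, h, if_true, lowerCount_succ_even h, upperCount_succ_even h]
    module
  · have h' := Nat.not_even_iff_odd.1 h
    simp only [grid, down, h, if_false, lowerCount_succ_odd h', upperCount_succ_odd h']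
    module

/-- The factor by which the row crease `(j, i) - (j, i + 1)` is longer than in the first row. -/
def rowScale (δ : ℝ) (κ μ : ℕ → ℝ) (j i : ℕ) : ℝ :=
  1 + δ * (lowerCount j * μ i - upperCount j * κ i)

theorem grid_succ_col (δ : ℝ) {P E U D : ℕ → M} {κ μ : ℕ → ℝ} {i : ℕ}
    (hP : P (i + 1) = P i + E i) (hU : U (i + 1) = U i + κ i • E i)
    (hD : D (i + 1) = D i + μ i • E i) (j : ℕ) :
    grid δ P U D (j, i + 1) = grid δ P U D (j, i) + rowScale δ κ μ j i • E i := by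
  simp only [grid, rowScale, hP, hU, hD]
  module

end grid

/-- A planar polygonal line `P` with edges `E`, together with the directions `U` and `D` of the
creases above and below it, in strips parallel to its edges. -/
structure IsPlanarRow (P E U D : ℕ → E2) (κ μ : ℕ → ℝ) : Prop where
  stepP : ∀ i, P (i + 1) = P i + E i
  stepU : ∀ i, U (i + 1) = U i + κ i • E i
  stepD : ∀ i, D (i + 1) = D i + μ i • E i
  posU : ∀ i, 0 < cross2 (E i) (U i)
  negD : ∀ i, cross2 (E i) (D i) < 0
  posX : ∀ i, 0 < E i 0

/-- The strips are thin enough for the columns to be ordered from left to right. -/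
structure IsThin (m n : ℕ) (P E U D : ℕ → E2) (κ μ : ℕ → ℝ) (δ : ℝ) : Prop where
  pos : 0 < δ
  scale : ∀ i ≤ n, ∀ j ≤ m + 1, 0 < rowScale δ κ μ j i
  order : ∀ i ≤ n, ∀ j ≤ m + 1, ∀ j' ≤ m + 1,
    grid δ P U D (j, i) 0 < grid δ P U D (j', i + 1) 0

/-- The conditions are finitely many strict inequalities, continuous in `δ`, which hold at `δ = 0`:
there every scale is `1`, and every column has collapsed to a vertex of the row, which runs to the
right. -/
theorem exists_isThin (m n : ℕ) {P E U D : ℕ → E2} {κ μ : ℕ → ℝ}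
    (h : IsPlanarRow P E U D κ μ) : ∃ δ, IsThin m n P E U D κ μ δ := by
  open Filter Topology in
  have h1 : ∀ᶠ δ in 𝓝[>] (0 : ℝ), ∀ i ∈ Finset.range (n + 1), ∀ j ∈ Finset.range (m + 2),
      0 < rowScale δ κ μ j i := by
    rw [Filter.eventually_all_finset]
    intro i _
    rw [Filter.eventually_all_finset]
    intro j _
    have : Continuous fun δ : ℝ => rowScale δ κ μ j i := by unfold rowScale; fun_prop
    exact (this.continuousAt.eventually (lt_mem_nhds (by simp [rowScale]))).filter_mono
      nhdsWithin_le_nhds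
  open Filter Topology in
  have h2 : ∀ᶠ δ in 𝓝[>] (0 : ℝ), ∀ i ∈ Finset.range (n + 1), ∀ j ∈ Finset.range (m + 2),
      ∀ j' ∈ Finset.range (m + 2), 0 < grid δ P U D (j', i + 1) 0 - grid δ P U D (j, i) 0 := by
    rw [Filter.eventually_all_finset]
    intro i _
    rw [Filter.eventually_all_finset]
    intro j _
    rw [Filter.eventually_all_finset]
    intro j' _
    have : Continuous fun δ : ℝ => grid δ P U D (j', i + 1) 0 - grid δ P U D (j, i) 0 := by
      simp only [grid, PiLp.add_apply, PiLp.sub_apply, PiLp.smul_apply, smul_eq_mul]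
      fun_prop
    refine (this.continuousAt.eventually (lt_mem_nhds ?_)).filter_mono nhdsWithin_le_nhds
    simp [grid, h.stepP, h.posX]
  obtain ⟨δ, ⟨h1, h2⟩, h3⟩ := ((h1.and h2).and self_mem_nhdsWithin).exists
  refine ⟨δ, h3, fun i hi j hj => h1 i (by simp; omega) j (by simp; omega),
    fun i hi j hj j' hj' => sub_pos.1 (h2 i (by simp; omega) j (by simp; omega) j' (by simp; omega))⟩

/-! ### Panels of a thin grid meet only in common corners and creases -/

section
variable {m n : ℕ} {P E U D : ℕ → E2} {κ μ : ℕ → ℝ} {δ : ℝ}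

theorem IsPlanarRow.posU_succ (h : IsPlanarRow P E U D κ μ) (i : ℕ) :
    0 < cross2 (E i) (U (i + 1)) := by
  rw [h.stepU, cross2_add_right, cross2_smul_right, cross2_self]
  simpa using h.posU i

theorem IsPlanarRow.negD_succ (h : IsPlanarRow P E U D κ μ) (i : ℕ) :
    cross2 (E i) (D (i + 1)) < 0 := by
  rw [h.stepD, cross2_add_right, cross2_smul_right, cross2_self]
  simpa using h.negD i

theorem IsPlanarRow.down_neg (h : IsPlanarRow P E U D κ μ) (j i : ℕ) :
    cross2 (E i) (down U D j i) < 0 := by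
  unfold down
  split_ifs
  · rw [cross2_neg_right]; linarith [h.posU i]
  · exact h.negD i

theorem IsPlanarRow.down_succ_neg (h : IsPlanarRow P E U D κ μ) (j i : ℕ) :
    cross2 (E i) (down U D j (i + 1)) < 0 := by
  unfold down
  split_ifs
  · rw [cross2_neg_right]; linarith [h.posU_succ i]
  · exact h.negD_succ i

/-- The cross product with `E i` measures height across the strips of the column. Both kinds of
column creases, traversed downwards, lower it. -/
theorem IsPlanarRow.height_strictAnti (h : IsPlanarRow P E U D κ μ) (hδ : 0 < δ) (i : ℕ) :
    StrictAnti fun j => cross2 (E i) (grid δ P U D (j, i)) := by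
  refine strictAnti_nat_of_succ_lt fun j => ?_
  rw [grid_succ_row, cross2_add_right, cross2_smul_right]
  nlinarith [mul_neg_of_pos_of_neg hδ (h.down_neg j i)]

theorem IsPlanarRow.height_succ (h : IsPlanarRow P E U D κ μ) (j i : ℕ) :
    cross2 (E i) (grid δ P U D (j, i + 1)) = cross2 (E i) (grid δ P U D (j, i)) := by
  rw [grid_succ_col δ (h.stepP i) (h.stepU i) (h.stepD i), cross2_add_right, cross2_smul_right,
    cross2_self]
  ring

theorem IsPlanarRow.height_next (h : IsPlanarRow P E U D κ μ) (j i : ℕ) :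
    cross2 (E i) (grid δ P U D (j, i + 2)) = cross2 (E i) (grid δ P U D (j, i)) +
      rowScale δ κ μ j (i + 1) * cross2 (E i) (E (i + 1)) := by
  rw [← h.height_succ j i, grid_succ_col δ (h.stepP (i + 1)) (h.stepU (i + 1)) (h.stepD (i + 1)),
    cross2_add_right, cross2_smul_right]

theorem IsPlanarRow.height_prev (h : IsPlanarRow P E U D κ μ) (j i : ℕ) :
    cross2 (E (i + 1)) (grid δ P U D (j, i)) = cross2 (E (i + 1)) (grid δ P U D (j, i + 1)) +
      rowScale δ κ μ j i * cross2 (E i) (E (i + 1)) := by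
  rw [grid_succ_col δ (h.stepP i) (h.stepU i) (h.stepD i),
    cross2_add_right, cross2_smul_right, cross2_swap (E i)]
  ring

theorem IsThin.lt_of_lt (ht : IsThin m n P E U D κ μ δ) {i i' j j' : ℕ} (hi : i < i')
    (hi' : i' ≤ n + 1) (hj : j ≤ m + 1) (hj' : j' ≤ m + 1) :
    grid δ P U D (j, i) 0 < grid δ P U D (j', i') 0 := by
  induction i', hi using Nat.le_induction generalizing j' with
  | base => exact ht.order i (by omega) j hj j' hj'
  | succ k hk ih =>
    exact (ih (by omega) hj').trans (ht.order k (by omega) j' hj' j' hj')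

theorem mem_corners {j i a b : ℕ} :
    (a, b) ∈ corners j i ↔ (a = j ∨ a = j + 1) ∧ (b = i ∨ b = i + 1) := by
  simp only [corners, Set.mem_insert_iff, Set.mem_singleton_iff, Prod.mk.injEq]
  tauto

theorem IsPlanarRow.height_mem (h : IsPlanarRow P E U D κ μ) {i : ℕ} (a : ℕ) {b : ℕ}
    (hb : b = i ∨ b = i + 1) :
    cross2 (E i) (grid δ P U D (a, b)) = cross2 (E i) (grid δ P U D (a, i)) := by
  rcases hb with rfl | rfl
  · rfl
  · exact h.height_succ a i

/-- Panels of the same column. -/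
theorem IsPlanarRow.inter_same (h : IsPlanarRow P E U D κ μ) (hδ : 0 < δ) {i j j' : ℕ}
    (hj : j < j') :
    panel (grid δ P U D) j' i ∩ panel (grid δ P U D) j i ⊆
      convexHull ℝ (grid δ P U D '' (corners j' i ∩ corners j i)) := by
  have hanti := h.height_strictAnti hδ i
  -- The separating line carries the lower edge of the upper panel. A corner of the lower panel on
  -- it lies in row `j + 1`, so it is a common corner.
  refine convexHull_inter_subset_left _ (crossLeft (E i))
    (cross2 (E i) (grid δ P U D (j + 1, i))) ?_ ?_ ?_
  · rintro ⟨a, b⟩ hab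
    rw [mem_corners] at hab
    rw [crossLeft_apply, h.height_mem a hab.2]
    exact hanti.antitone (by omega)
  · rintro ⟨a, b⟩ hab
    rw [mem_corners] at hab
    rw [crossLeft_apply, h.height_mem a hab.2]
    exact hanti.antitone (by omega)
  · rintro ⟨a, b⟩ hab heq
    rw [mem_corners] at hab
    rw [crossLeft_apply, h.height_mem a hab.2] at heq
    have := hanti.injective heq
    exact ⟨mem_corners.2 hab, mem_corners.2 ⟨Or.inr this, hab.2⟩⟩

/-- Panels that are neighbours in the same strip between two rows. -/
theorem IsPlanarRow.inter_adjacent (h : IsPlanarRow P E U D κ μ) (ht : IsThin m n P E U D κ μ δ)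
    {i j : ℕ} (hi : i + 1 ≤ n) (hj : j ≤ m) :
    panel (grid δ P U D) j i ∩ panel (grid δ P U D) j (i + 1) ⊆
      convexHull ℝ (grid δ P U D '' (corners j i ∩ corners j (i + 1))) := by
  -- The line of the common column crease separates the two panels: the crease itself lies on it,
  -- the other corners strictly to the left or to the right.
  have hmid : ∀ a, (a = j ∨ a = j + 1) →
      cross2 (down U D j (i + 1)) (grid δ P U D (a, i + 1)) =
        cross2 (down U D j (i + 1)) (grid δ P U D (j, i + 1)) := by
    rintro a (rfl | rfl)
    · rfl
    · rw [grid_succ_row, cross2_add_right, cross2_smul_right, cross2_self]; ring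
  have hleft : ∀ a, (a = j ∨ a = j + 1) →
      cross2 (down U D j (i + 1)) (grid δ P U D (a, i)) <
        cross2 (down U D j (i + 1)) (grid δ P U D (j, i + 1)) := by
    intro a ha
    rw [← hmid a ha, grid_succ_col δ (h.stepP i) (h.stepU i) (h.stepD i), cross2_add_right,
      cross2_smul_right, cross2_swap _ (E i)]
    nlinarith [mul_pos (ht.scale i (by omega) a (by omega)) (neg_pos.2 (h.down_succ_neg j i))]
  have hright : ∀ a, (a = j ∨ a = j + 1) →
      cross2 (down U D j (i + 1)) (grid δ P U D (j, i + 1)) <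
        cross2 (down U D j (i + 1)) (grid δ P U D (a, i + 1 + 1)) := by
    intro a ha
    rw [← hmid a ha, grid_succ_col δ (h.stepP (i + 1)) (h.stepU (i + 1)) (h.stepD (i + 1)),
      cross2_add_right, cross2_smul_right, cross2_swap _ (E (i + 1))]
    nlinarith [mul_pos (ht.scale (i + 1) (by omega) a (by omega))
      (neg_pos.2 (h.down_neg j (i + 1)))]
  refine convexHull_inter_subset_left _ (crossLeft (down U D j (i + 1)))
    (cross2 (down U D j (i + 1)) (grid δ P U D (j, i + 1))) ?_ ?_ ?_
  · rintro ⟨a, b⟩ hab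
    rw [mem_corners] at hab
    rcases hab.2 with rfl | rfl
    · exact (hleft a hab.1).le
    · exact (hmid a hab.1).le
  · rintro ⟨a, b⟩ hab
    rw [mem_corners] at hab
    rcases hab.2 with rfl | rfl
    · exact (hmid a hab.1).ge
    · exact (hright a hab.1).le
  · rintro ⟨a, b⟩ hab heq
    rw [mem_corners] at hab
    rcases hab.2 with rfl | rfl
    · exact absurd heq (hleft a hab.1).ne
    · exact ⟨mem_corners.2 hab, mem_corners.2 ⟨hab.1, Or.inl rfl⟩⟩

theorem IsThin.inter_of_row (ht : IsThin m n P E U D κ μ δ) {i j j' : ℕ} (hi : i + 1 ≤ n)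
    (f : E2 →ₗ[ℝ] ℝ) (c : ℝ) (r : ℕ) (hr : r ≤ m + 1) (hrj' : r = j' ∨ r = j' + 1)
    (hs : ∀ a b, (a = j ∨ a = j + 1) → (b = i ∨ b = i + 1) →
      f (grid δ P U D (a, b)) ≤ c ∧ (f (grid δ P U D (a, b)) = c → a = r))
    (ht' : ∀ a b, (a = j' ∨ a = j' + 1) → (b = i + 1 ∨ b = i + 1 + 1) →
      c ≤ f (grid δ P U D (a, b)) ∧ (f (grid δ P U D (a, b)) = c → a = r)) :
    panel (grid δ P U D) j i ∩ panel (grid δ P U D) j' (i + 1) ⊆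
      convexHull ℝ (grid δ P U D '' (corners j i ∩ corners j' (i + 1))) := by
  refine convexHull_inter_subset_of_two _ f coordX c (grid δ P U D (r, i + 1) 0) ?_ ?_ ?_ ?_ ?_
  · rintro ⟨a, b⟩ hab
    rw [mem_corners] at hab
    exact (hs a b hab.1 hab.2).1
  · rintro ⟨a, b⟩ hab
    rw [mem_corners] at hab
    exact (ht' a b hab.1 hab.2).1
  · rintro ⟨a, b⟩ hab heq
    rw [mem_corners] at hab
    obtain rfl := (hs a b hab.1 hab.2).2 heq
    rcases hab.2 with rfl | rfl
    · exact (ht.lt_of_lt (by omega) (by omega) hr hr).le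
    · exact le_rfl
  · rintro ⟨a, b⟩ hab heq
    rw [mem_corners] at hab
    obtain rfl := (ht' a b hab.1 hab.2).2 heq
    rcases hab.2 with rfl | rfl
    · exact le_rfl
    · exact (ht.lt_of_lt (by omega) (by omega) hr hr).le
  · rintro ⟨a, b⟩ hab heq hx
    rw [mem_corners] at hab
    obtain rfl := (hs a b hab.1 hab.2).2 heq
    rcases hab.2 with rfl | rfl
    · exact absurd hx (ht.lt_of_lt (by omega) (by omega) hr hr).ne
    · exact ⟨mem_corners.2 hab, mem_corners.2 ⟨hrj', Or.inl rfl⟩⟩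

/-- Panels in neighbouring columns and different strips. -/
theorem IsPlanarRow.inter_diagonal (h : IsPlanarRow P E U D κ μ) (ht : IsThin m n P E U D κ μ δ)
    {i j j' : ℕ} (hi : i + 1 ≤ n) (hj : j ≤ m) (hj' : j' ≤ m) (hne : j ≠ j') :
    panel (grid δ P U D) j i ∩ panel (grid δ P U D) j' (i + 1) ⊆
      convexHull ℝ (grid δ P U D '' (corners j i ∩ corners j' (i + 1))) := by
  have hH := h.height_strictAnti ht.pos i
  have hG := h.height_strictAnti ht.pos (i + 1)
  have hHlt : ∀ {a r}, r ≤ a → cross2 (E i) (grid δ P U D (a, i)) ≤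
      cross2 (E i) (grid δ P U D (r, i)) := fun har => hH.antitone har
  have hGlt : ∀ {a r}, r ≤ a → cross2 (E (i + 1)) (grid δ P U D (a, i + 1)) ≤
      cross2 (E (i + 1)) (grid δ P U D (r, i + 1)) := fun har => hG.antitone har
  have hHeq : ∀ {a r}, cross2 (E i) (grid δ P U D (a, i)) =
      cross2 (E i) (grid δ P U D (r, i)) → a = r := fun e => hH.injective e
  have hGeq : ∀ {a r}, cross2 (E (i + 1)) (grid δ P U D (a, i + 1)) =
      cross2 (E (i + 1)) (grid δ P U D (r, i + 1)) → a = r := fun e => hG.injective e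
  -- The separating line carries a row crease in row `j'` or `j' + 1`, the side of the right panel's
  -- strip that faces the left panel. Whether this crease is taken from column `i` or `i + 1`
  -- depends on the turn of the row: it must be the one beyond whose end the row bends away on the
  -- correct side. Only vertices of that row can lie on the line, and there the first coordinate
  -- separates the columns.
  rcases hne.lt_or_gt with hlt | hlt <;> rcases le_total 0 (cross2 (E i) (E (i + 1))) with hc | hc
  · refine ht.inter_of_row hi (crossLeft (-E (i + 1)))
      (-cross2 (E (i + 1)) (grid δ P U D (j', i + 1))) j' (by omega) (Or.inl rfl) ?_ ?_
    · rintro a b ha (rfl | rfl)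
      · rw [crossLeft_apply, cross2_neg_left, h.height_prev]
        have h1 := hGlt (show a ≤ j' by omega)
        have h2 := mul_nonneg (ht.scale b (by omega) a (by omega)).le hc
        exact ⟨by linarith, fun e => hGeq (by linarith)⟩
      · rw [crossLeft_apply, cross2_neg_left]
        have h1 := hGlt (show a ≤ j' by omega)
        exact ⟨by linarith, fun e => hGeq (by linarith)⟩
    · intro a b ha hb
      rw [crossLeft_apply, cross2_neg_left, h.height_mem a hb]
      have h1 := hGlt (show j' ≤ a by omega)
      exact ⟨by linarith, fun e => hGeq (by linarith)⟩
  · refine ht.inter_of_row hi (crossLeft (-E i))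
      (-cross2 (E i) (grid δ P U D (j', i))) j' (by omega) (Or.inl rfl) ?_ ?_
    · intro a b ha hb
      rw [crossLeft_apply, cross2_neg_left, h.height_mem a hb]
      have h1 := hHlt (show a ≤ j' by omega)
      exact ⟨by linarith, fun e => hHeq (by linarith)⟩
    · rintro a b ha (rfl | rfl)
      · rw [crossLeft_apply, cross2_neg_left, h.height_succ]
        have h1 := hHlt (show j' ≤ a by omega)
        exact ⟨by linarith, fun e => hHeq (by linarith)⟩
      · rw [crossLeft_apply, cross2_neg_left, h.height_next]
        have h1 := hHlt (show j' ≤ a by omega)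
        have h2 := mul_nonneg (ht.scale (i + 1) (by omega) a (by omega)).le (neg_nonneg.2 hc)
        exact ⟨by linarith, fun e => hHeq (by linarith)⟩
  · refine ht.inter_of_row hi (crossLeft (E i))
      (cross2 (E i) (grid δ P U D (j' + 1, i))) (j' + 1) (by omega) (Or.inr rfl) ?_ ?_
    · intro a b ha hb
      rw [crossLeft_apply, h.height_mem a hb]
      exact ⟨hHlt (by omega), fun e => hHeq e⟩
    · rintro a b ha (rfl | rfl)
      · rw [crossLeft_apply, h.height_succ]
        exact ⟨hHlt (by omega), fun e => hHeq e⟩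
      · rw [crossLeft_apply, h.height_next]
        have h1 := hHlt (show a ≤ j' + 1 by omega)
        have h2 := mul_nonneg (ht.scale (i + 1) (by omega) a (by omega)).le hc
        exact ⟨by linarith, fun e => hHeq (by linarith)⟩
  · refine ht.inter_of_row hi (crossLeft (E (i + 1)))
      (cross2 (E (i + 1)) (grid δ P U D (j' + 1, i + 1))) (j' + 1) (by omega) (Or.inr rfl) ?_ ?_
    · rintro a b ha (rfl | rfl)
      · rw [crossLeft_apply, h.height_prev]
        have h1 := hGlt (show j' + 1 ≤ a by omega)
        have h2 := mul_nonneg (ht.scale b (by omega) a (by omega)).le (neg_nonneg.2 hc)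
        exact ⟨by linarith, fun e => hGeq (by linarith)⟩
      · rw [crossLeft_apply]
        exact ⟨hGlt (by omega), fun e => hGeq e⟩
    · intro a b ha hb
      rw [crossLeft_apply, h.height_mem a hb]
      exact ⟨hGlt (by omega), fun e => hGeq e⟩

/-- Panels in columns that are not neighbours. -/
theorem IsThin.inter_far (ht : IsThin m n P E U D κ μ δ)
    {i i' j j' : ℕ} (hi : i + 2 ≤ i') (hi' : i' ≤ n) (hj : j ≤ m) (hj' : j' ≤ m) :
    panel (grid δ P U D) j i ∩ panel (grid δ P U D) j' i' ⊆
      convexHull ℝ (grid δ P U D '' (corners j i ∩ corners j' i')) := by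
  have hx : ∀ a b, (a, b) ∈ corners j i → ∀ a' b', (a', b') ∈ corners j' i' →
      grid δ P U D (a, b) 0 < grid δ P U D (a', b') 0 := by
    intro a b hab a' b' hab'
    rw [mem_corners] at hab hab'
    exact ht.lt_of_lt (by omega) (by omega) (by omega) (by omega)
  have hord : ∀ a b, (a, b) ∈ corners j i →
      grid δ P U D (a, b) 0 ≤ max (grid δ P U D (j, i + 1) 0) (grid δ P U D (j + 1, i + 1) 0) := by
    intro a b hab
    rw [mem_corners] at hab
    rcases hab.2 with rfl | rfl
    · exact (ht.lt_of_lt (by omega) (by omega) (by omega) (by omega)).le.trans (le_max_left _ _)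
    · rcases hab.1 with rfl | rfl
      · exact le_max_left _ _
      · exact le_max_right _ _
  refine fun x hx' => absurd (convexHull_inter_subset _ coordX
    (max (grid δ P U D (j, i + 1) 0) (grid δ P U D (j + 1, i + 1) 0))
    (fun y hy => hord y.1 y.2 hy) (fun y hy => ?_) hx').2 ?_
  · exact max_le (hx _ _ (mem_corners.2 (by omega)) y.1 y.2 hy).le
      (hx _ _ (mem_corners.2 (by omega)) y.1 y.2 hy).le
  · rw [Set.eq_empty_of_forall_notMem (s := {y ∈ corners j' i' | _}) ?_]
    · simp
    · rintro y ⟨hy, heq⟩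
      exact absurd heq (max_lt (hx _ _ (mem_corners.2 (by omega)) y.1 y.2 hy)
        (hx _ _ (mem_corners.2 (by omega)) y.1 y.2 hy)).ne'

/-- The grid over a planar row, with thin strips, is a creased paper. -/
theorem IsPlanarRow.isCreasedPaper (h : IsPlanarRow P E U D κ μ)
    (ht : IsThin m n P E U D κ μ δ) : IsCreasedPaper m n (grid δ P U D) where
  convex := by
    intro j hj i hi
    have e1 : grid δ P U D (j + 1, i) = grid δ P U D (j, i) + δ • down U D j i :=
      grid_succ_row δ P U D j i
    have e2 : grid δ P U D (j, i + 1) = grid δ P U D (j, i) + rowScale δ κ μ j i • E i :=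
      grid_succ_col δ (h.stepP i) (h.stepU i) (h.stepD i) j
    have e3 : grid δ P U D (j + 1, i + 1) =
        grid δ P U D (j + 1, i) + rowScale δ κ μ (j + 1) i • E i :=
      grid_succ_col δ (h.stepP i) (h.stepU i) (h.stepD i) (j + 1)
    have e4 : grid δ P U D (j + 1, i + 1) = grid δ P U D (j, i + 1) + δ • down U D j (i + 1) :=
      grid_succ_row δ P U D j (i + 1)
    have d1 : grid δ P U D (j + 1, i) - grid δ P U D (j, i) = δ • down U D j i := by
      rw [e1]; abel
    have d2 : grid δ P U D (j + 1, i + 1) - grid δ P U D (j + 1, i) =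
        rowScale δ κ μ (j + 1) i • E i := by rw [e3]; abel
    have d3 : grid δ P U D (j, i + 1) - grid δ P U D (j + 1, i + 1) =
        -(δ • down U D j (i + 1)) := by rw [e4]; abel
    have d4 : grid δ P U D (j, i) - grid δ P U D (j, i + 1) =
        -(rowScale δ κ μ j i • E i) := by rw [e2]; abel
    have k1 := ht.scale i hi j (by omega)
    have k2 := ht.scale i hi (j + 1) (by omega)
    have c1 := neg_pos.2 (h.down_neg j i)
    have c2 := neg_pos.2 (h.down_succ_neg j i)
    unfold ConvexQuad
    rw [d1, d2, d3, d4]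
    simp only [cross2_neg_left, cross2_neg_right, cross2_smul_left, cross2_smul_right,
      cross2_swap (down U D j i) (E i), cross2_swap (down U D j (i + 1)) (E i)]
    have p1 := mul_pos (mul_pos ht.pos k2) c1
    have p2 := mul_pos (mul_pos ht.pos k2) c2
    have p3 := mul_pos (mul_pos ht.pos k1) c2
    have p4 := mul_pos (mul_pos ht.pos k1) c1
    refine ⟨?_, ?_, ?_, ?_⟩ <;> linarith
  inter := by
    have key : ∀ j ≤ m, ∀ i ≤ n, ∀ j' ≤ m, ∀ i' ≤ n, i ≤ i' →
        panel (grid δ P U D) j i ∩ panel (grid δ P U D) j' i' ⊆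
          convexHull ℝ (grid δ P U D '' (corners j i ∩ corners j' i')) := by
      intro j hj i hi j' hj' i' hi' hii
      rcases lt_trichotomy i' (i + 1) with hlt | rfl | hgt
      · obtain rfl : i = i' := by omega
        rcases lt_trichotomy j j' with hlt' | rfl | hgt'
        · rw [Set.inter_comm, Set.inter_comm (corners j i)]
          exact h.inter_same ht.pos hlt'
        · simp [panel]
        · exact h.inter_same ht.pos hgt'
      · by_cases hjj : j = j'
        · subst hjj
          exact h.inter_adjacent ht hi' hj
        · exact h.inter_diagonal ht hi' hj hj' hjj
      · exact ht.inter_far (by omega) hi' hj hj'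
    intro j hj i hi j' hj' i' hi'
    apply Set.Subset.antisymm
    · rcases le_total i i' with hii | hii
      · exact key j hj i hi j' hj' i' hi' hii
      · rw [Set.inter_comm, Set.inter_comm (corners j i)]
        exact key j' hj' i' hi' j hj i hi hii
    · exact Set.subset_inter (convexHull_mono (Set.image_mono Set.inter_subset_left))
        (convexHull_mono (Set.image_mono Set.inter_subset_right))

end

/-! ### Folded rows -/

/-- There is a linear isometry of the plane into space which takes two independent vectors to two
vectors with the same inner products. -/
theorem exists_linearIsometry {A B : E2} {a b : E3} (h : cross2 A B ≠ 0)
    (haa : inner ℝ a a = inner ℝ A A) (hab : inner ℝ a b = inner ℝ A B)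
    (hbb : inner ℝ b b = inner ℝ B B) : ∃ T : E2 →ₗᵢ[ℝ] E3, T A = a ∧ T B = b := by
  -- The coefficients are the coordinates of `v` in the basis `A`, `B`, by Cramer's rule. Equal Gram
  -- matrices make the map isometric.
  let L : E2 →ₗ[ℝ] E3 :=
    { toFun := fun v => (cross2 v B / cross2 A B) • a + (cross2 A v / cross2 A B) • b
      map_add' := fun v w => by
        rw [cross2_add_left, cross2_add_right, add_div, add_div]; module
      map_smul' := fun r v => by
        rw [cross2_smul_left, cross2_smul_right, mul_div_assoc, mul_div_assoc,
          RingHom.id_apply]; module }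
  have hL : ∀ v, L v = (cross2 v B / cross2 A B) • a + (cross2 A v / cross2 A B) • b :=
    fun v => rfl
  have hv : ∀ v : E2, v = (cross2 v B / cross2 A B) • A + (cross2 A v / cross2 A B) • B := by
    intro v
    have e : ∀ i, v i = cross2 v B / cross2 A B * A i + cross2 A v / cross2 A B * B i := by
      intro i
      field_simp
      fin_cases i <;> simp only [cross2, Fin.zero_eta, Fin.mk_one] <;> ring
    ext i
    simpa using e i
  refine ⟨⟨L, fun v => ?_⟩, ?_, ?_⟩
  · rw [← sq_eq_sq₀ (norm_nonneg _) (norm_nonneg _), ← real_inner_self_eq_norm_sq,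
      ← real_inner_self_eq_norm_sq, hL]
    conv_rhs => rw [hv v]
    simp only [inner_add_left, inner_add_right, real_inner_smul_left, real_inner_smul_right,
      haa, hab, hbb, real_inner_comm a b, real_inner_comm A B]
  · change L A = a
    rw [hL, cross2_self, div_self h]; simp
  · change L B = b
    rw [hL, cross2_self, div_self h]; simp

/-- A linear isometry, moved so that it takes `V` to `W`. -/
theorem exists_affineIsometry (T : E2 →ₗᵢ[ℝ] E3) (V : E2) (W : E3) :
    ∃ S : E2 →ᵃⁱ[ℝ] E3, ∀ x, S x = W + T (x - V) := by
  refine ⟨((AffineIsometryEquiv.vaddConst ℝ W).toAffineIsometry.comp T.toAffineIsometry).comp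
    (AffineIsometryEquiv.vaddConst ℝ V).symm.toAffineIsometry, fun x => ?_⟩
  simp [add_comm]

/-- `x`, `e`, `u`, `d` are the positions in space of a planar row, with the panels above and below
it: the panels are congruent to those in the plane. -/
structure IsFoldedRow (E U D : ℕ → E2) (κ μ : ℕ → ℝ) (x e u d : ℕ → E3) : Prop where
  stepP : ∀ i, x (i + 1) = x i + e i
  stepU : ∀ i, u (i + 1) = u i + κ i • e i
  stepD : ∀ i, d (i + 1) = d i + μ i • e i
  inner_ee : ∀ i, inner ℝ (e i) (e i) = inner ℝ (E i) (E i)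
  inner_eu : ∀ i, inner ℝ (e i) (u i) = inner ℝ (E i) (U i)
  inner_uu : ∀ i, inner ℝ (u i) (u i) = inner ℝ (U i) (U i)
  inner_ed : ∀ i, inner ℝ (e i) (d i) = inner ℝ (E i) (D i)
  inner_dd : ∀ i, inner ℝ (d i) (d i) = inner ℝ (D i) (D i)

section
variable {m n : ℕ} {P E U D : ℕ → E2} {κ μ : ℕ → ℝ} {δ : ℝ} {x e u d : ℕ → E3}

/-- Up to translation and scaling, a panel is spanned by its row edge and by the upper or the lower
creases, according to the parity of `j`. The isometry fitted to the edge and its left crease also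
fits the right crease, because the two creases differ by the same multiple of the edge in the plane
and in space. -/
theorem IsPlanarRow.isFoldedState (h : IsPlanarRow P E U D κ μ)
    (hf : IsFoldedRow E U D κ μ x e u d) :
    IsFoldedState m n (grid δ P U D) (grid δ x u d) := by
  intro j _ i _
  obtain ⟨T, hTE, hTd, hTd'⟩ : ∃ T : E2 →ₗᵢ[ℝ] E3, T (E i) = e i ∧
      T (down U D j i) = down u d j i ∧ T (down U D j (i + 1)) = down u d j (i + 1) := by
    by_cases hj : Even j
    · obtain ⟨T, h1, h2⟩ := exists_linearIsometry (h.posU i).ne' (hf.inner_ee i) (hf.inner_eu i)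
        (hf.inner_uu i)
      refine ⟨T, h1, ?_, ?_⟩
      · simp [down, hj, h2]
      · simp [down, hj, h2, h1, h.stepU, hf.stepU]
    · obtain ⟨T, h1, h2⟩ := exists_linearIsometry (h.negD i).ne (hf.inner_ee i) (hf.inner_ed i)
        (hf.inner_dd i)
      refine ⟨T, h1, ?_, ?_⟩
      · simp [down, hj, h2]
      · simp [down, hj, h2, h1, h.stepD, hf.stepD]
  obtain ⟨S, hS⟩ := exists_affineIsometry T (grid δ P U D (j, i)) (grid δ x u d (j, i))
  refine ⟨S, ?_⟩
  have e0 : grid δ x u d (j, i) = S (grid δ P U D (j, i)) := by simp [hS]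
  have e1 : grid δ x u d (j, i + 1) = S (grid δ P U D (j, i + 1)) := by
    rw [hS, grid_succ_col δ (h.stepP i) (h.stepU i) (h.stepD i),
      grid_succ_col δ (hf.stepP i) (hf.stepU i) (hf.stepD i), add_sub_cancel_left, map_smul, hTE]
  have e2 : grid δ x u d (j + 1, i) = S (grid δ P U D (j + 1, i)) := by
    rw [hS, grid_succ_row, grid_succ_row, add_sub_cancel_left, map_smul, hTd]
  have e3 : grid δ x u d (j + 1, i + 1) = S (grid δ P U D (j + 1, i + 1)) := by
    rw [grid_succ_row, e1, hS, hS, grid_succ_row δ P, add_sub_right_comm, map_add, map_smul, hTd',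
      add_assoc]
  rintro c hc
  simp only [corners, Set.mem_insert_iff, Set.mem_singleton_iff] at hc
  rcases hc with rfl | rfl | rfl | rfl
  · exact e0
  · exact e1
  · exact e2
  · exact e3

/-! ### Folding angles of a folded row -/

theorem perp_smul_left {r : ℝ} (hr : r ≠ 0) (a b : E3) : perp (r • a) b = perp a b := by
  unfold perp
  rw [real_inner_smul_left, real_inner_smul_left, real_inner_smul_right, smul_smul]
  congr 2
  by_cases h : inner ℝ a a = 0
  · rw [h]; simp
  · field_simp

theorem perp_neg_left (a b : E3) : perp (-a) b = perp a b := by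
  simpa using perp_smul_left (r := -1) (by norm_num) a b

theorem perp_smul_right (r : ℝ) (a b : E3) : perp a (r • b) = r • perp a b := by
  unfold perp
  rw [real_inner_smul_right]; module

theorem perp_neg_right (a b : E3) : perp a (-b) = -perp a b := by
  simpa using perp_smul_right (-1) a b

theorem perp_add (a b b' : E3) : perp a (b + b') = perp a b + perp a b' := by
  unfold perp
  rw [inner_add_right]; module

theorem perp_self (a : E3) : perp a a = 0 := by
  unfold perp
  by_cases h : a = 0
  · simp [h]
  · rw [div_self (inner_self_ne_zero.2 h)]; simp

theorem perp_add_smul (a b : E3) (r : ℝ) : perp a (b + r • a) = perp a b := by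
  rw [perp_add, perp_smul_right, perp_self]; simp

theorem IsFoldedRow.edge (hf : IsFoldedRow E U D κ μ x e u d) (j i : ℕ) :
    grid δ x u d (j, i + 1) - grid δ x u d (j, i) = rowScale δ κ μ j i • e i := by
  rw [grid_succ_col δ (hf.stepP i) (hf.stepU i) (hf.stepD i)]; abel

theorem foldAngle_def' {A B X Y c l r : E3} (hc : perp (B - A) = perp c) (hl : X - A = l)
    (hr : Y - A = r) :
    foldAngle A B X Y = π - InnerProductGeometry.angle (perp c l) (perp c r) := by
  rw [foldAngle, hc, hl, hr]

theorem grid_sub_row (j i : ℕ) :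
    grid δ x u d (j, i) - grid δ x u d (j + 1, i) = -(δ • down u d j i) := by
  rw [grid_succ_row]; abel

theorem grid_sub_row' (j i : ℕ) :
    grid δ x u d (j + 1, i) - grid δ x u d (j, i) = δ • down u d j i := by
  rw [grid_succ_row]; abel

/-- The folding angle is the same on all row creases of a column. -/
theorem IsFoldedRow.rowFold_eq (hf : IsFoldedRow E U D κ μ x e u d) (hδ : 0 < δ) {j i : ℕ}
    (hj : 1 ≤ j) (hs : 0 < rowScale δ κ μ j i) :
    rowFold (grid δ x u d) j i =
      π - InnerProductGeometry.angle (perp (e i) (u i)) (perp (e i) (d i)) := by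
  obtain ⟨k, rfl⟩ : ∃ k, j = k + 1 := ⟨j - 1, by omega⟩
  rw [rowFold, Nat.add_sub_cancel,
    foldAngle_def' (c := e i) (by rw [hf.edge]; funext b; exact perp_smul_left hs.ne' _ _)
      (grid_sub_row k i) (grid_sub_row' (k + 1) i), ← smul_neg, perp_smul_right, perp_smul_right,
    InnerProductGeometry.angle_smul_left_of_pos _ _ hδ,
    InnerProductGeometry.angle_smul_right_of_pos _ _ hδ]
  -- From one row to the next, the creases above and below exchange their roles and both are
  -- reversed, which does not change the angle between them.
  by_cases hk : Even k
  · have : ¬ Even (k + 1) := by simpa [Nat.even_add_one] using hk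
    simp [down, hk, this]
  · have : Even (k + 1) := by simpa [Nat.even_add_one] using hk
    simp only [down, hk, this, if_true, if_false, perp_neg_right,
      InnerProductGeometry.angle_neg_neg]
    rw [InnerProductGeometry.angle_comm]

/-- If the components orthogonal to `c` point the same way, then `r` lies in the open half-plane
bounded by the line of `c` that contains `l`. -/
theorem angle_perp_ne_zero {c l r : E3} (h : ∀ a : ℝ, 0 < a → ∀ b : ℝ, r ≠ a • l + b • c) :
    InnerProductGeometry.angle (perp c l) (perp c r) ≠ 0 := by
  rw [Ne, InnerProductGeometry.angle_eq_zero_iff]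
  rintro ⟨-, a, ha, hr⟩
  refine h a ha (inner ℝ c r / inner ℝ c c - a * (inner ℝ c l / inner ℝ c c)) ?_
  unfold perp at hr
  rw [sub_eq_iff_eq_add] at hr
  exact hr.trans (by module)

theorem sub_angle_lt_pi {a b : E3} (h : InnerProductGeometry.angle a b ≠ 0) :
    π - InnerProductGeometry.angle a b < π := by
  have := (InnerProductGeometry.angle_nonneg a b).lt_of_ne' h
  linarith

/-- The panels beside a column crease do not clash when the two row edges are not on the same side
of the crease in one plane. -/
theorem IsFoldedRow.colFold_lt (hf : IsFoldedRow E U D κ μ x e u d) (hδ : 0 < δ) {j i : ℕ}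
    (hs : 0 < rowScale δ κ μ j i) (hs' : 0 < rowScale δ κ μ j (i + 1))
    (hu : ∀ a : ℝ, 0 < a → ∀ b : ℝ, e (i + 1) ≠ a • (-e i) + b • u (i + 1))
    (hd : ∀ a : ℝ, 0 < a → ∀ b : ℝ, e (i + 1) ≠ a • (-e i) + b • d (i + 1)) :
    colFold (grid δ x u d) j (i + 1) < π := by
  have hc : ∀ a : ℝ, 0 < a → ∀ b : ℝ, e (i + 1) ≠ a • (-e i) + b • down u d j (i + 1) := by
    intro a ha b
    unfold down
    split_ifs
    · rw [smul_neg b, ← neg_smul b]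
      exact hu a ha (-b)
    · exact hd a ha b
  have hl : grid δ x u d (j, i) - grid δ x u d (j, i + 1) = rowScale δ κ μ j i • (-e i) := by
    rw [← neg_sub, hf.edge, smul_neg]
  rw [colFold, Nat.add_sub_cancel, foldAngle_def' (c := down u d j (i + 1))
      (by rw [grid_sub_row']; funext b; exact perp_smul_left hδ.ne' _ _)
      hl (hf.edge j (i + 1)), perp_smul_right, perp_smul_right,
    InnerProductGeometry.angle_smul_left_of_pos _ _ hs,
    InnerProductGeometry.angle_smul_right_of_pos _ _ hs']
  exact sub_angle_lt_pi (angle_perp_ne_zero hc)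

/-! ### Sector angles -/

/-- The sector angles at the vertex `i` of a planar row. -/
def rowSector (E U D : ℕ → E2) (i : ℕ) : Fin 4 → ℝ :=
  ![InnerProductGeometry.angle (U i) (E i), InnerProductGeometry.angle (U i) (-E (i - 1)),
    InnerProductGeometry.angle (D i) (-E (i - 1)), InnerProductGeometry.angle (D i) (E i)]

theorem grid_angle (V : ℕ × ℕ → E2) {v w r : ℕ × ℕ} {a b : ℝ} {X Y : E2} (ha : 0 < a)
    (hb : 0 < b) (hX : V v - V w = a • X) (hY : V r - V w = b • Y) :
    EuclideanGeometry.angle (V v) (V w) (V r) = InnerProductGeometry.angle X Y := by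
  rw [EuclideanGeometry.angle, vsub_eq_sub, vsub_eq_sub, hX, hY,
    InnerProductGeometry.angle_smul_left_of_pos _ _ ha,
    InnerProductGeometry.angle_smul_right_of_pos _ _ hb]

theorem IsPlanarRow.sector_eq (h : IsPlanarRow P E U D κ μ) (ht : IsThin m n P E U D κ μ δ)
    {j i : ℕ} (hj : j + 1 ≤ m) (hi : i + 1 ≤ n) :
    sector (grid δ P U D) (j + 1) (i + 1) =
      ![InnerProductGeometry.angle (-down U D j (i + 1)) (E (i + 1)),
        InnerProductGeometry.angle (-down U D j (i + 1)) (-E i),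
        InnerProductGeometry.angle (down U D (j + 1) (i + 1)) (-E i),
        InnerProductGeometry.angle (down U D (j + 1) (i + 1)) (E (i + 1))] := by
  have hu : grid δ P U D (j, i + 1) - grid δ P U D (j + 1, i + 1) =
      δ • (-down U D j (i + 1)) := by
    rw [grid_succ_row, smul_neg]; abel
  have hd : grid δ P U D (j + 1 + 1, i + 1) - grid δ P U D (j + 1, i + 1) =
      δ • down U D (j + 1) (i + 1) := by
    rw [grid_succ_row]; abel
  have hl : grid δ P U D (j + 1, i) - grid δ P U D (j + 1, i + 1) =
      rowScale δ κ μ (j + 1) i • (-E i) := by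
    rw [grid_succ_col δ (h.stepP i) (h.stepU i) (h.stepD i), smul_neg]; abel
  have hr : grid δ P U D (j + 1, i + 1 + 1) - grid δ P U D (j + 1, i + 1) =
      rowScale δ κ μ (j + 1) (i + 1) • E (i + 1) := by
    rw [grid_succ_col δ (h.stepP (i + 1)) (h.stepU (i + 1)) (h.stepD (i + 1))]; abel
  have s1 := ht.scale i (by omega) (j + 1) (by omega)
  have s2 := ht.scale (i + 1) hi (j + 1) (by omega)
  simp only [sector, Nat.add_sub_cancel]
  rw [grid_angle _ ht.pos s2 hu hr, grid_angle _ ht.pos s1 hu hl, grid_angle _ ht.pos s1 hd hl,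
    grid_angle _ ht.pos s2 hd hr]

/-- The grid over a planar row is of the parallel repeating type. -/
theorem IsPlanarRow.isParallelRepeating (h : IsPlanarRow P E U D κ μ)
    (ht : IsThin m n P E U D κ μ δ)
    (hsum : ∀ i, 1 ≤ i → i ≤ n → ∑ k, rowSector E U D i k = 2 * π)
    (hcross : ∀ i, 1 ≤ i → i ≤ n → ¬ (rowSector E U D i 0 = rowSector E U D i 2 ∧
      rowSector E U D i 1 = rowSector E U D i 3)) :
    IsParallelRepeating m n (grid δ P U D) (rowSector E U D) where
  paper := h.isCreasedPaper ht
  sum_eq := hsum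
  not_cross := hcross
  odd_row := by
    intro j i hj hj' hi hi' hodd k
    obtain ⟨j, rfl⟩ : ∃ k, j = k + 1 := ⟨j - 1, by omega⟩
    obtain ⟨i, rfl⟩ : ∃ k, i = k + 1 := ⟨i - 1, by omega⟩
    have h1 : Even j := by simpa [Nat.odd_add_one] using hodd
    have h2 : ¬ Even (j + 1) := by simpa [Nat.even_add_one] using h1
    rw [h.sector_eq ht hj' hi']
    simp [rowSector, down, h1, h2]
  even_row := by
    intro j i hj hj' hi hi' heven k
    obtain ⟨j, rfl⟩ : ∃ k, j = k + 1 := ⟨j - 1, by omega⟩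
    obtain ⟨i, rfl⟩ : ∃ k, i = k + 1 := ⟨i - 1, by omega⟩
    have h1 : ¬ Even j := by simpa [Nat.even_add_one] using heven
    rw [h.sector_eq ht hj' hi']
    fin_cases k <;>
    simp [rowSector, down, h1, heven, InnerProductGeometry.angle_neg_left, Fin.rev]

end

/-! ### Rotations and coordinates in moving frames -/

/-- The rotation of space given by the quaternion `1 + Q j + P k`, up to normalization. -/
def rot (P Q : ℝ) : Matrix (Fin 3) (Fin 3) ℝ :=
  (1 + P ^ 2 + Q ^ 2)⁻¹ • !![1 - Q ^ 2 - P ^ 2, -(2 * P), 2 * Q;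
    2 * P, 1 + Q ^ 2 - P ^ 2, 2 * Q * P; -(2 * Q), 2 * Q * P, 1 - Q ^ 2 + P ^ 2]

theorem rot_den_pos (P Q : ℝ) : 0 < 1 + P ^ 2 + Q ^ 2 := by positivity

/-- The group of rotations of space. -/
abbrev SO3 : Submonoid (Matrix (Fin 3) (Fin 3) ℝ) := Matrix.specialOrthogonalGroup (Fin 3) ℝ

theorem mem_SO3_iff {M : Matrix (Fin 3) (Fin 3) ℝ} :
    M ∈ SO3 ↔ M * M.transpose = 1 ∧ M.det = 1 := by
  rw [Matrix.mem_specialOrthogonalGroup_iff, Matrix.mem_orthogonalGroup_iff]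

theorem rot_mem (P Q : ℝ) : rot P Q ∈ SO3 := by
  have h := (rot_den_pos P Q).ne'
  rw [mem_SO3_iff]
  constructor
  · ext i j
    fin_cases i <;> fin_cases j <;>
      simp [rot, Matrix.mul_apply, Fin.sum_univ_three] <;> field_simp <;> ring
  · simp [rot, Matrix.det_fin_three]
    field_simp
    ring

/-- The vector of which the coordinates in the frame `M` are `v`. -/
def loc (M : Matrix (Fin 3) (Fin 3) ℝ) (v : Fin 3 → ℝ) : E3 := WithLp.toLp 2 (M.mulVec v)

theorem loc_mul (M N : Matrix (Fin 3) (Fin 3) ℝ) (v : Fin 3 → ℝ) :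
    loc (M * N) v = loc M (N.mulVec v) := by
  simp [loc, Matrix.mulVec_mulVec]

theorem loc_add (M : Matrix (Fin 3) (Fin 3) ℝ) (v w : Fin 3 → ℝ) :
    loc M (v + w) = loc M v + loc M w := by
  simp [loc, Matrix.mulVec_add]

theorem loc_smul (M : Matrix (Fin 3) (Fin 3) ℝ) (r : ℝ) (v : Fin 3 → ℝ) :
    loc M (r • v) = r • loc M v := by
  simp [loc, Matrix.mulVec_smul]

theorem loc_neg (M : Matrix (Fin 3) (Fin 3) ℝ) (v : Fin 3 → ℝ) :
    loc M (-v) = -loc M v := by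
  simp [loc, Matrix.mulVec_neg]

theorem inner_loc {M : Matrix (Fin 3) (Fin 3) ℝ} (hM : M ∈ SO3) (v w : Fin 3 → ℝ) :
    inner ℝ (loc M v) (loc M w) = v 0 * w 0 + v 1 * w 1 + v 2 * w 2 := by
  have h : M.transpose * M = 1 := mul_eq_one_comm.1 (mem_SO3_iff.1 hM).1
  have : inner ℝ (loc M v) (loc M w) = w ⬝ᵥ v := by
    rw [loc, loc, EuclideanSpace.inner_eq_star_dotProduct]
    simp only [star_trivial]
    rw [Matrix.dotProduct_mulVec, Matrix.vecMul_mulVec, ← Matrix.dotProduct_mulVec]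
    rw [h]; simp
  rw [this, dotProduct, Fin.sum_univ_three]; ring

theorem exists_eq_loc {M : Matrix (Fin 3) (Fin 3) ℝ} (hM : M ∈ SO3) (x : E3) :
    ∃ v, x = loc M v := by
  refine ⟨M.transpose.mulVec x, ?_⟩
  rw [loc, Matrix.mulVec_mulVec, (mem_SO3_iff.1 hM).1]
  simp

theorem loc_injective {M : Matrix (Fin 3) (Fin 3) ℝ} (hM : M ∈ SO3) :
    Function.Injective (loc M) := by
  have h : M.transpose * M = 1 := mul_eq_one_comm.1 (mem_SO3_iff.1 hM).1
  intro v w hvw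
  have := congrArg (fun x : E3 => M.transpose.mulVec x.ofLp) hvw
  simpa [loc, Matrix.mulVec_mulVec, h] using this

theorem det_loc {M : Matrix (Fin 3) (Fin 3) ℝ} (hM : M ∈ SO3) (a b c : Fin 3 → ℝ) :
    Matrix.det (Matrix.of fun r k => (![loc M a, loc M b, loc M c] r) k) =
      Matrix.det (Matrix.of ![a, b, c]) := by
  have : (Matrix.of fun r k => (![loc M a, loc M b, loc M c] r) k) =
      Matrix.of ![a, b, c] * M.transpose := by
    ext r k
    fin_cases r <;> simp [loc, Matrix.mul_apply, Matrix.mulVec, dotProduct, mul_comm]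
  rw [this, Matrix.det_mul, Matrix.det_transpose, (mem_SO3_iff.1 hM).2, mul_one]

theorem perp_loc {M : Matrix (Fin 3) (Fin 3) ℝ} (hM : M ∈ SO3) {l : ℝ} (hl : l ≠ 0)
    (v : Fin 3 → ℝ) :
    perp (l • loc M ![1, 0, 0]) (loc M v) = loc M ![0, v 1, v 2] := by
  rw [perp_smul_left hl, perp, inner_loc hM, inner_loc hM, sub_eq_iff_eq_add, ← loc_smul,
    ← loc_add]
  congr 1
  ext i
  fin_cases i <;> simp

theorem angle_loc {M : Matrix (Fin 3) (Fin 3) ℝ} (hM : M ∈ SO3) (a b : ℂ) :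
    InnerProductGeometry.angle (loc M ![0, a.re, a.im]) (loc M ![0, b.re, b.im]) =
      InnerProductGeometry.angle a b := by
  have hn : ∀ a : ℂ, ‖loc M ![0, a.re, a.im]‖ = ‖a‖ := by
    intro a
    rw [← sq_eq_sq₀ (norm_nonneg _) (norm_nonneg _), ← real_inner_self_eq_norm_sq,
      inner_loc hM, ← Complex.normSq_eq_norm_sq, Complex.normSq_apply]
    simp
  rw [InnerProductGeometry.angle, InnerProductGeometry.angle, hn, hn, inner_loc hM]
  simp [Complex.inner]
  ring_nf

/-! ### The plane in complex coordinates -/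

/-- The point of the plane with a given complex coordinate. -/
def toE2 (w : ℂ) : E2 := !₂[w.re, w.im]

theorem toE2_add (v w : ℂ) : toE2 (v + w) = toE2 v + toE2 w := by
  ext i; fin_cases i <;> simp [toE2]

theorem toE2_smul (r : ℝ) (w : ℂ) : toE2 (r * w) = r • toE2 w := by
  ext i; fin_cases i <;> simp [toE2]

theorem toE2_neg (w : ℂ) : toE2 (-w) = -toE2 w := by
  ext i; fin_cases i <;> simp [toE2]

theorem cross2_toE2 (v w : ℂ) : cross2 (toE2 v) (toE2 w) = v.re * w.im - v.im * w.re := by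
  simp [cross2, toE2]

theorem inner_toE2 (v w : ℂ) : inner ℝ (toE2 v) (toE2 w) = v.re * w.re + v.im * w.im := by
  simp [toE2, EuclideanSpace.inner_eq_star_dotProduct, dotProduct, Fin.sum_univ_two, mul_comm]

/-- Multiplication by `rotc p` is the planar rotation by the angle `2 arctan p`. -/
def rotc (p : ℝ) : ℂ := (1 + p * Complex.I) / (1 - p * Complex.I)

theorem one_sub_ne (p : ℝ) : (1 - p * Complex.I : ℂ) ≠ 0 := by
  intro h
  simpa using congrArg Complex.re h

theorem one_add_ne (p : ℝ) : (1 + p * Complex.I : ℂ) ≠ 0 := by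
  intro h
  simpa using congrArg Complex.re h

theorem normSq_rotc (p : ℝ) : Complex.normSq (rotc p) = 1 := by
  have : (0 : ℝ) < 1 + p * p := by nlinarith [mul_self_nonneg p]
  rw [rotc, map_div₀, Complex.normSq_apply, Complex.normSq_apply]
  simp
  exact this.ne'

theorem rotc_zero : rotc 0 = 1 := by simp [rotc]

theorem rotc_mul_neg (p : ℝ) : rotc p * rotc (-p) = 1 := by
  have h1 := one_sub_ne p
  have h2 := one_add_ne p
  simp only [rotc, Complex.ofReal_neg, neg_mul, sub_neg_eq_add, ← sub_eq_add_neg]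
  field_simp

theorem rotc_re (p : ℝ) : (rotc p).re = (1 - p ^ 2) / (1 + p ^ 2) := by
  have h : (0 : ℝ) < 1 + p ^ 2 := by positivity
  simp [rotc, Complex.div_re, Complex.normSq_apply]
  field_simp
  ring

theorem rotc_im (p : ℝ) : (rotc p).im = 2 * p / (1 + p ^ 2) := by
  have h : (0 : ℝ) < 1 + p ^ 2 := by positivity
  simp [rotc, Complex.div_im, Complex.normSq_apply]
  field_simp
  ring

/-! ### Rows with a straight-line vertex and flat-foldable vertices -/

/-- The parameters of a row: the length `len₀` of the edge to the left of the first inner vertex,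
which is of the straight-line kind and determined by `τ`; the lengths `len k` of the following
edges; and the numbers `p k` and `q k` which determine the flat-foldable vertex `k + 2`, where
`2 arctan (p k)` is the angle by which the row turns in the plane. -/
structure RowParams where
  p : ℕ → ℝ
  q : ℕ → ℝ
  len : ℕ → ℝ
  len₀ : ℝ
  τ : ℝ

namespace RowParams
variable (R : RowParams)

/-- The unit vector of the edge `k + 1` in the plane. -/
def dir : ℕ → ℂ
  | 0 => 1
  | k + 1 => dir k * rotc (R.p k)

/-- The relative width of the strip above the edge `k + 1`. -/
def widthU : ℕ → ℝ
  | 0 => 1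
  | k + 1 => widthU k * ((R.q k + R.p k) / (R.q k - R.p k))

/-- The relative width of the strip below the edge `k + 1`. -/
def widthD : ℕ → ℝ
  | 0 => 1
  | k + 1 => widthD k * ((R.q k - R.p k) / (R.q k + R.p k))

/-- The slopes of the upper crease at the vertex `k + 1`, relative to the edge `k + 1`. -/
def startU : ℕ → ℝ
  | 0 => 0
  | k + 1 => (R.p k * R.q k - 1) / (R.q k + R.p k)

/-- The slopes of the lower crease at the vertex `k + 1`, relative to the edge `k + 1`. -/
def startD : ℕ → ℝ
  | 0 => 0
  | k + 1 => -(R.p k * R.q k + 1) / (R.q k - R.p k)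

/-- The slope of the upper crease at the vertex `k + 2`, relative to the edge `k + 1`. -/
def endU (k : ℕ) : ℝ := -(R.p k * R.q k + 1) / (R.q k - R.p k)

/-- The slope of the lower crease at the vertex `k + 2`, relative to the edge `k + 1`. -/
def endD (k : ℕ) : ℝ := (R.p k * R.q k - 1) / (R.q k + R.p k)

/-- The points of a polygonal line with given edges, the vertex `1` of which is `o`. -/
def points {M : Type*} [AddCommGroup M] (o : M) (e : ℕ → M) : ℕ → M
  | 0 => o - e 0
  | k + 1 => o + ∑ l ∈ Finset.range k, e (l + 1)

theorem points_succ {M : Type*} [AddCommGroup M] (o : M) (e : ℕ → M) (i : ℕ) :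
    points o e (i + 1) = points o e i + e i := by
  cases i with
  | zero => simp [points]
  | succ k => simp [points, Finset.sum_range_succ, add_assoc]

/-- The edges in the plane. -/
def edge : ℕ → E2
  | 0 => R.len₀ • !₂[Real.sin R.τ, Real.cos R.τ]
  | k + 1 => toE2 (R.len k * R.dir k)

/-- The upper creases in the plane. -/
def upper : ℕ → E2
  | 0 => toE2 Complex.I
  | k + 1 => toE2 (R.widthU k * (R.dir k * (R.startU k + Complex.I)))

/-- The lower creases in the plane. -/
def lower : ℕ → E2
  | 0 => toE2 (-Complex.I)
  | k + 1 => toE2 (R.widthD k * (R.dir k * (R.startD k - Complex.I)))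

/-- The increment of the upper creases along an edge. -/
def shiftU : ℕ → ℝ
  | 0 => 0
  | k + 1 => R.widthU k * (R.endU k - R.startU k) / R.len k

/-- The increment of the lower creases along an edge. -/
def shiftD : ℕ → ℝ
  | 0 => 0
  | k + 1 => R.widthD k * (R.endD k - R.startD k) / R.len k

/-- The conditions on the parameters. -/
structure Valid : Prop where
  p_lt : ∀ k, |R.p k| < |R.q k|
  len_pos : ∀ k, 0 < R.len k
  len₀_pos : 0 < R.len₀
  τ_pos : 0 < R.τ
  τ_lt : R.τ < π / 2
  dir_re : ∀ k, 0 < (R.dir k).re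

variable {R}

/-- This is the ratio of consecutive strip widths. It has the sign of `q² - p²`, so the condition on
the absolute values is what keeps each crease on its side of the row. -/
theorem Valid.quot_pos (h : R.Valid) (k : ℕ) : 0 < (R.q k + R.p k) / (R.q k - R.p k) := by
  have h1 := h.p_lt k
  rcases lt_abs.1 h1 with h2 | h2
  · have := abs_lt.1 h2
    exact div_pos (by linarith) (by linarith)
  · have := abs_lt.1 h2
    exact div_pos_of_neg_of_neg (by linarith) (by linarith)

theorem Valid.add_ne (h : R.Valid) (k : ℕ) : R.q k + R.p k ≠ 0 := by
  intro h0
  have := h.quot_pos k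
  simp [h0] at this

theorem Valid.sub_ne (h : R.Valid) (k : ℕ) : R.q k - R.p k ≠ 0 := by
  intro h0
  have := h.quot_pos k
  simp [h0] at this

theorem Valid.widthU_pos (h : R.Valid) (k : ℕ) : 0 < R.widthU k := by
  induction k with
  | zero => simp [widthU]
  | succ k ih => exact mul_pos ih (h.quot_pos k)

theorem Valid.widthD_pos (h : R.Valid) (k : ℕ) : 0 < R.widthD k := by
  induction k with
  | zero => simp [widthD]
  | succ k ih =>
    refine mul_pos ih ?_
    rw [← inv_div]
    exact inv_pos.2 (h.quot_pos k)

theorem normSq_dir (k : ℕ) : Complex.normSq (R.dir k) = 1 := by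
  induction k with
  | zero => simp [dir]
  | succ k ih => simp [dir, ih, normSq_rotc]

theorem dir_sq (k : ℕ) : (R.dir k).re ^ 2 + (R.dir k).im ^ 2 = 1 := by
  rw [← R.normSq_dir k, Complex.normSq_apply]; ring

/-- The upper crease at a flat-foldable vertex, in terms of the edge to the left. -/
theorem Valid.upper_eq (h : R.Valid) (k : ℕ) :
    R.upper (k + 2) = toE2 (R.widthU k * (R.dir k * (R.endU k + Complex.I))) := by
  have h1 : (R.q k + R.p k : ℂ) ≠ 0 := by exact_mod_cast h.add_ne k
  have h2 : (R.q k - R.p k : ℂ) ≠ 0 := by exact_mod_cast h.sub_ne k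
  have h3 := one_sub_ne (R.p k)
  simp only [upper, widthU, dir, startU, endU, rotc]
  congr 1
  push_cast
  field_simp
  linear_combination (2 * R.widthU k * R.dir k * R.p k * R.q k) * Complex.I_sq

theorem Valid.lower_eq (h : R.Valid) (k : ℕ) :
    R.lower (k + 2) = toE2 (R.widthD k * (R.dir k * (R.endD k - Complex.I))) := by
  have h1 : (R.q k + R.p k : ℂ) ≠ 0 := by exact_mod_cast h.add_ne k
  have h2 : (R.q k - R.p k : ℂ) ≠ 0 := by exact_mod_cast h.sub_ne k
  have h3 := one_sub_ne (R.p k)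
  simp only [lower, widthD, dir, startD, endD, rotc]
  congr 1
  push_cast
  field_simp
  linear_combination -(2 * R.widthD k * R.dir k * R.p k * R.q k) * Complex.I_sq

/-- The creases at both ends of an edge have the same width relative to it, and differ only in their
slopes. Their difference is therefore a multiple of the edge. -/
theorem Valid.isPlanarRow (h : R.Valid) :
    IsPlanarRow (points 0 R.edge) R.edge R.upper R.lower R.shiftU R.shiftD where
  stepP := points_succ 0 R.edge
  stepU i := by
    cases i with
    | zero => simp [upper, shiftU, widthU, dir, startU]
    | succ k =>
      have hl : (R.len k : ℂ) ≠ 0 := by exact_mod_cast (h.len_pos k).ne'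
      rw [h.upper_eq, upper, shiftU, edge, ← toE2_smul, ← toE2_add]
      congr 1
      push_cast
      field_simp
      ring
  stepD i := by
    cases i with
    | zero => simp [lower, shiftD, widthD, dir, startD]
    | succ k =>
      have hl : (R.len k : ℂ) ≠ 0 := by exact_mod_cast (h.len_pos k).ne'
      rw [h.lower_eq, lower, shiftD, edge, ← toE2_smul, ← toE2_add]
      congr 1
      push_cast
      field_simp
      ring
  posU i := by
    cases i with
    | zero =>
      have := mul_pos h.len₀_pos
        (Real.sin_pos_of_pos_of_lt_pi h.τ_pos (by linarith [h.τ_lt, Real.pi_pos]))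
      simpa [cross2, edge, upper, toE2] using this
    | succ k =>
      have := mul_pos (h.len_pos k) (h.widthU_pos k)
      have h2 := R.dir_sq k
      rw [edge, upper, cross2_toE2]
      simp
      linear_combination this - R.len k * R.widthU k * h2
  negD i := by
    cases i with
    | zero =>
      have := mul_pos h.len₀_pos
        (Real.sin_pos_of_pos_of_lt_pi h.τ_pos (by linarith [h.τ_lt, Real.pi_pos]))
      simpa [cross2, edge, lower, toE2] using this
    | succ k =>
      have := mul_pos (h.len_pos k) (h.widthD_pos k)
      have h2 := R.dir_sq k
      rw [edge, lower, cross2_toE2]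
      simp
      linear_combination this - R.len k * R.widthD k * h2
  posX i := by
    cases i with
    | zero =>
      have := mul_pos h.len₀_pos
        (Real.sin_pos_of_pos_of_lt_pi h.τ_pos (by linarith [h.τ_lt, Real.pi_pos]))
      simpa [edge] using this
    | succ k =>
      have := mul_pos (h.len_pos k) (h.dir_re k)
      simpa [edge, toE2] using this

end RowParams

namespace RowParams
variable {R : RowParams}

/-! ### The sector angles of the row -/

theorem angle_slope {w l : ℝ} (hw : 0 < w) (hl : 0 < l) {z : ℂ}
    (hz : z.re ^ 2 + z.im ^ 2 = 1) (x σ : ℝ) (hσ : σ ^ 2 = 1) :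
    InnerProductGeometry.angle (toE2 (w * (z * (x + σ * Complex.I)))) (toE2 (l * z)) =
      Real.arccos (x / √(1 + x ^ 2)) := by
  rw [toE2_smul, toE2_smul, InnerProductGeometry.angle_smul_left_of_pos _ _ hw,
    InnerProductGeometry.angle_smul_right_of_pos _ _ hl, InnerProductGeometry.angle]
  have h1 : ‖toE2 z‖ = 1 := by
    rw [← sq_eq_sq₀ (norm_nonneg _) zero_le_one, ← real_inner_self_eq_norm_sq, inner_toE2]
    linear_combination hz
  have h2 : ‖toE2 (z * (x + σ * Complex.I))‖ = √(1 + x ^ 2) := by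
    rw [← sq_eq_sq₀ (norm_nonneg _) (Real.sqrt_nonneg _), ← real_inner_self_eq_norm_sq,
      inner_toE2, Real.sq_sqrt (by positivity)]
    simp
    linear_combination (x ^ 2 + σ ^ 2) * hz + hσ
  rw [h1, h2, inner_toE2, mul_one]
  congr 2
  simp
  linear_combination x * hz

/-- The upper crease has the same slope relative to the right edge as the lower crease relative to
the left edge, and vice versa. Since the left edge is reversed in a sector, opposite sectors are
supplementary. -/
theorem Valid.sector_flat (h : R.Valid) (k : ℕ) :
    rowSector R.edge R.upper R.lower (k + 2) =
      ![Real.arccos (R.endD k / √(1 + R.endD k ^ 2)),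
        π - Real.arccos (R.endU k / √(1 + R.endU k ^ 2)),
        π - Real.arccos (R.endD k / √(1 + R.endD k ^ 2)),
        Real.arccos (R.endU k / √(1 + R.endU k ^ 2))] := by
  have e1 := angle_slope (h.widthU_pos (k + 1)) (h.len_pos (k + 1)) (R.dir_sq (k + 1))
    (R.endD k) 1 (by norm_num)
  have e2 := angle_slope (h.widthU_pos k) (h.len_pos k) (R.dir_sq k) (R.endU k) 1 (by norm_num)
  have e3 := angle_slope (h.widthD_pos k) (h.len_pos k) (R.dir_sq k) (R.endD k) (-1)
    (by norm_num)
  have e4 := angle_slope (h.widthD_pos (k + 1)) (h.len_pos (k + 1)) (R.dir_sq (k + 1))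
    (R.endU k) (-1) (by norm_num)
  simp only [Complex.ofReal_neg, Complex.ofReal_one, one_mul, neg_mul, ← sub_eq_add_neg]
    at e1 e2 e3 e4
  have hs : R.startU (k + 1) = R.endD k := rfl
  have hs' : R.startD (k + 1) = R.endU k := rfl
  rw [← hs] at e1
  rw [← hs'] at e4
  rw [← h.upper_eq] at e2
  rw [← h.lower_eq] at e3
  simp only [rowSector, show k + 2 - 1 = k + 1 from rfl,
    InnerProductGeometry.angle_neg_right]
  rw [show R.edge (k + 1) = toE2 (R.len k * R.dir k) from rfl, e2, e3,
    show R.edge (k + 2) = toE2 (R.len (k + 1) * R.dir (k + 1)) from rfl,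
    show R.upper (k + 2) = toE2 (R.widthU (k + 1) *
      (R.dir (k + 1) * (R.startU (k + 1) + Complex.I))) from rfl,
    show R.lower (k + 2) = toE2 (R.widthD (k + 1) *
      (R.dir (k + 1) * (R.startD (k + 1) - Complex.I))) from rfl, e1, e4, hs, hs']

theorem Valid.sector_one (h : R.Valid) :
    rowSector R.edge R.upper R.lower 1 = ![π / 2, π - R.τ, R.τ, π / 2] := by
  have hu : R.upper 1 = toE2 Complex.I := by simp [upper, widthU, dir, startU]
  have hd : R.lower 1 = -toE2 Complex.I := by
    simp [lower, widthD, dir, startD, toE2_neg]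
  have e1 : InnerProductGeometry.angle (toE2 Complex.I) (R.edge 1) = π / 2 := by
    rw [← InnerProductGeometry.inner_eq_zero_iff_angle_eq_pi_div_two]
    simp [edge, dir, inner_toE2]
  have e2 : InnerProductGeometry.angle (toE2 Complex.I) (R.edge 0) = R.τ := by
    have n1 : ‖toE2 Complex.I‖ = 1 := by
      rw [← sq_eq_sq₀ (norm_nonneg _) zero_le_one, ← real_inner_self_eq_norm_sq, inner_toE2]
      simp
    have n2 : ‖(!₂[Real.sin R.τ, Real.cos R.τ] : E2)‖ = 1 := by
      rw [EuclideanSpace.norm_eq]; simp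
    rw [edge, InnerProductGeometry.angle_smul_right_of_pos _ _ h.len₀_pos,
      InnerProductGeometry.angle, n1, n2]
    simp only [toE2, EuclideanSpace.inner_eq_star_dotProduct, dotProduct, Fin.sum_univ_two]
    simp
    exact Real.arccos_cos h.τ_pos.le (by linarith [h.τ_lt, Real.pi_pos])
  simp only [rowSector, Nat.sub_self, hu, hd, InnerProductGeometry.angle_neg_right,
    InnerProductGeometry.angle_neg_left, e1, e2]
  congr 4
  · ring_nf
  · ring_nf

theorem Valid.flatFoldable (h : R.Valid) (k : ℕ) :
    FlatFoldable (rowSector R.edge R.upper R.lower (k + 2)) := by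
  rw [h.sector_flat]
  constructor <;> simp

theorem Valid.straightLine (h : R.Valid) :
    StraightLine (rowSector R.edge R.upper R.lower 1) := by
  rw [h.sector_one]
  constructor <;> simp

theorem Valid.sum_sector (h : R.Valid) (i : ℕ) :
    ∑ k, rowSector R.edge R.upper R.lower (i + 1) k = 2 * π := by
  rw [Fin.sum_univ_four]
  cases i with
  | zero => linarith [h.straightLine.1, h.straightLine.2]
  | succ k => linarith [(h.flatFoldable k).1, (h.flatFoldable k).2]

theorem arccos_slope_eq {x : ℝ} (h : Real.arccos (x / √(1 + x ^ 2)) = π / 2) : x = 0 := by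
  rw [Real.arccos_eq_pi_div_two] at h
  rcases div_eq_zero_iff.1 h with h | h
  · exact h
  · exact absurd h (Real.sqrt_pos.2 (by positivity)).ne'

theorem Valid.not_cross (h : R.Valid) (i : ℕ) :
    ¬ (rowSector R.edge R.upper R.lower (i + 1) 0 = rowSector R.edge R.upper R.lower (i + 1) 2 ∧
      rowSector R.edge R.upper R.lower (i + 1) 1 = rowSector R.edge R.upper R.lower (i + 1) 3) := by
  rintro ⟨h1, h2⟩
  cases i with
  | zero =>
    rw [zero_add, h.sector_one] at h1
    simp at h1
    linarith [h.τ_lt]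
  | succ k =>
    rw [h.sector_flat] at h1 h2
    simp at h1 h2
    -- In a flat-foldable cross all sectors are right angles, so both slopes vanish. That would mean
    -- `p q = 1` and `p q = -1`.
    have e1 := arccos_slope_eq (x := R.endD k) (by linarith)
    have e2 := arccos_slope_eq (x := R.endU k) (by linarith)
    have e3 := (div_eq_zero_iff.1 e1).resolve_right (h.add_ne k)
    have e4 := (div_eq_zero_iff.1 e2).resolve_right (h.sub_ne k)
    linarith

/-! ### The folded row -/

variable (R)

/-- The sine of half the signed folding angle on the edge `k + 1`. -/
def alt (s : ℝ) (k : ℕ) : ℝ := (-1) ^ k * s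

/-- The frame of the edge `k + 1`; it bisects the panels above and below, for folding angles of
which the halves have cosine `c` and sine `± s`. -/
def frame (c s : ℝ) : ℕ → Matrix (Fin 3) (Fin 3) ℝ
  | 0 => 1
  | k + 1 => frame c s k * rot (R.p k * c) (R.q k * alt s k)

/-- The edges of the folded row. -/
def edge3 (c s : ℝ) : ℕ → E3
  | 0 => R.len₀ • loc 1 ![√(1 - (Real.cos R.τ / c) ^ 2), Real.cos R.τ / c, 0]
  | k + 1 => R.len k • loc (R.frame c s k) ![1, 0, 0]

/-- The upper creases of the folded row. -/
def upper3 (c s : ℝ) : ℕ → E3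
  | 0 => loc 1 ![0, c, s]
  | k + 1 => R.widthU k • loc (R.frame c s k) ![R.startU k, c, alt s k]

/-- The lower creases of the folded row. -/
def lower3 (c s : ℝ) : ℕ → E3
  | 0 => loc 1 ![0, -c, s]
  | k + 1 => R.widthD k • loc (R.frame c s k) ![R.startD k, -c, alt s k]

variable {R}

theorem frame_mem (c s : ℝ) (k : ℕ) : R.frame c s k ∈ SO3 := by
  induction k with
  | zero => exact SO3.one_mem
  | succ k ih => exact SO3.mul_mem ih (rot_mem _ _)

theorem alt_succ (s : ℝ) (k : ℕ) : alt s (k + 1) = -alt s k := by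
  unfold alt; rw [pow_succ]; ring

theorem alt_sq (s : ℝ) (k : ℕ) : alt s k ^ 2 = s ^ 2 := by
  unfold alt; rw [mul_pow, ← pow_mul, mul_comm k, pow_mul]; simp

/-- The identity behind rigid foldability: with `p` and `q` fixed it holds for every `c` and `σ` on
the unit circle. Cleared of denominators, the crease seen from the right edge, with third coordinate
of sign `-σ`, becomes the crease seen from the left edge. So the folding angle keeps its magnitude
and alternates in sign from edge to edge. -/
theorem rot_upper {p q c σ : ℝ} (h : c ^ 2 + σ ^ 2 = 1) :
    (rot (p * c) (q * σ)).mulVec ![p * q - 1, (q + p) * c, -((q + p) * σ)] =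
      ![-(p * q + 1), (q - p) * c, (q - p) * σ] := by
  have h3 := (rot_den_pos (p * c) (q * σ)).ne'
  rw [rot, Matrix.smul_mulVec, inv_smul_eq_iff₀ h3]
  ext i
  fin_cases i <;> simp [Matrix.mulVec, dotProduct, Fin.sum_univ_three]
  · linear_combination -(2 * p * q) * h
  · linear_combination -(2 * p ^ 2 * q * c) * h
  · linear_combination (2 * p * q ^ 2 * σ) * h

theorem rot_lower {p q c σ : ℝ} (h : c ^ 2 + σ ^ 2 = 1) :
    (rot (p * c) (q * σ)).mulVec ![-(p * q + 1), -((q - p) * c), -((q - p) * σ)] =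
      ![p * q - 1, -((q + p) * c), (q + p) * σ] := by
  have h3 := (rot_den_pos (p * c) (q * σ)).ne'
  rw [rot, Matrix.smul_mulVec, inv_smul_eq_iff₀ h3]
  ext i
  fin_cases i <;> simp [Matrix.mulVec, dotProduct, Fin.sum_univ_three]
  · linear_combination (2 * p * q) * h
  · linear_combination (2 * p ^ 2 * q * c) * h
  · linear_combination -(2 * p * q ^ 2 * σ) * h

/-- The upper crease at a flat-foldable vertex, in the frame of the edge to the left. -/
theorem Valid.upper3_eq (h : R.Valid) {c s : ℝ} (hcs : c ^ 2 + s ^ 2 = 1) (k : ℕ) :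
    R.upper3 c s (k + 2) =
      R.widthU k • loc (R.frame c s k) ![R.endU k, c, alt s k] := by
  have h1 := h.add_ne k
  have h2 := h.sub_ne k
  have hs : c ^ 2 + alt s k ^ 2 = 1 := by rw [alt_sq, hcs]
  have e1 : ![R.endU k, c, alt s k] =
      (R.q k - R.p k)⁻¹ • ![-(R.p k * R.q k + 1), (R.q k - R.p k) * c,
        (R.q k - R.p k) * alt s k] := by
    ext i
    fin_cases i <;> simp [endU] <;> field_simp
  have e2 : ![R.startU (k + 1), c, -alt s k] =
      (R.q k + R.p k)⁻¹ • ![R.p k * R.q k - 1, (R.q k + R.p k) * c,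
        -((R.q k + R.p k) * alt s k)] := by
    ext i
    fin_cases i <;> simp [startU] <;> field_simp
  rw [upper3, frame, loc_mul, alt_succ, e1, e2, Matrix.mulVec_smul, rot_upper hs, loc_smul,
    loc_smul, smul_smul, smul_smul, widthU]
  congr 1
  field_simp

/-- The lower crease at a flat-foldable vertex, in the frame of the edge to the left. -/
theorem Valid.lower3_eq (h : R.Valid) {c s : ℝ} (hcs : c ^ 2 + s ^ 2 = 1) (k : ℕ) :
    R.lower3 c s (k + 2) =
      R.widthD k • loc (R.frame c s k) ![R.endD k, -c, alt s k] := by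
  have h1 := h.add_ne k
  have h2 := h.sub_ne k
  have hs : c ^ 2 + alt s k ^ 2 = 1 := by rw [alt_sq, hcs]
  have e1 : ![R.endD k, -c, alt s k] =
      (R.q k + R.p k)⁻¹ • ![R.p k * R.q k - 1, -((R.q k + R.p k) * c),
        (R.q k + R.p k) * alt s k] := by
    ext i
    fin_cases i <;> simp [endD] <;> field_simp
  have e2 : ![R.startD (k + 1), -c, -alt s k] =
      (R.q k - R.p k)⁻¹ • ![-(R.p k * R.q k + 1), -((R.q k - R.p k) * c),
        -((R.q k - R.p k) * alt s k)] := by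
    ext i
    fin_cases i <;> simp [startD] <;> field_simp
  rw [lower3, frame, loc_mul, alt_succ, e1, e2, Matrix.mulVec_smul, rot_lower hs, loc_smul,
    loc_smul, smul_smul, smul_smul, widthD]
  congr 1
  field_simp

theorem Valid.cos_pos (h : R.Valid) : 0 < Real.cos R.τ :=
  Real.cos_pos_of_mem_Ioo ⟨by linarith [h.τ_pos, Real.pi_pos], h.τ_lt⟩

theorem Valid.sin_pos (h : R.Valid) : 0 < Real.sin R.τ :=
  Real.sin_pos_of_pos_of_lt_pi h.τ_pos (by linarith [h.τ_lt, Real.pi_pos])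

/-- The points of the folded row, with the first inner vertex at `o`. -/
theorem Valid.isFoldedRow (h : R.Valid) {c s : ℝ} (hcs : c ^ 2 + s ^ 2 = 1)
    (hc : Real.cos R.τ ≤ c) (o : E3) :
    IsFoldedRow R.edge R.upper R.lower R.shiftU R.shiftD (points o (R.edge3 c s)) (R.edge3 c s)
      (R.upper3 c s) (R.lower3 c s) := by
  have hc0 : 0 < c := h.cos_pos.trans_le hc
  -- The edge in front of the straight-line vertex exists precisely while half the folding angle has
  -- not passed `τ`.
  have hg : 0 ≤ 1 - (Real.cos R.τ / c) ^ 2 := by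
    have h1 : Real.cos R.τ / c ≤ 1 := (div_le_one hc0).2 hc
    have h2 : 0 ≤ Real.cos R.τ / c := div_nonneg h.cos_pos.le hc0.le
    nlinarith
  have hS : ∀ k, c ^ 2 + alt s k ^ 2 = 1 := fun k => by rw [alt_sq, hcs]
  refine ⟨points_succ o _, ?_, ?_, ?_, ?_, ?_, ?_, ?_⟩
  · rintro (_ | k)
    · simp [upper3, shiftU, widthU, frame, startU, alt]
    · rw [h.upper3_eq hcs, upper3, shiftU, edge3, smul_smul, ← loc_smul, ← loc_smul, ← loc_smul,
        ← loc_add]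
      have := (h.len_pos k).ne'
      congr 1
      ext i
      fin_cases i <;> simp
      field_simp
      ring
  · rintro (_ | k)
    · simp [lower3, shiftD, widthD, frame, startD, alt]
    · rw [h.lower3_eq hcs, lower3, shiftD, edge3, smul_smul, ← loc_smul, ← loc_smul, ← loc_smul,
        ← loc_add]
      have := (h.len_pos k).ne'
      congr 1
      ext i
      fin_cases i <;> simp
      field_simp
      ring
  · rintro (_ | k)
    · simp only [edge, edge3, real_inner_smul_left, real_inner_smul_right,
        inner_loc SO3.one_mem]
      have : inner ℝ (!₂[Real.sin R.τ, Real.cos R.τ] : E2) !₂[Real.sin R.τ, Real.cos R.τ] = 1 := by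
        rw [real_inner_self_eq_norm_sq, EuclideanSpace.norm_eq]; simp
      rw [this]
      simp [Real.mul_self_sqrt hg, -mul_eq_mul_left_iff]
      ring
    · simp only [edge, edge3, real_inner_smul_left, real_inner_smul_right,
        inner_loc (frame_mem c s k), toE2_smul, inner_toE2]
      simp [-mul_eq_mul_left_iff, -mul_eq_mul_right_iff]
      linear_combination -(R.len k * R.len k) * R.dir_sq k
  · rintro (_ | k)
    · simp only [edge, edge3, upper, upper3, real_inner_smul_left, inner_loc SO3.one_mem]
      simp [toE2, EuclideanSpace.inner_eq_star_dotProduct, dotProduct, Fin.sum_univ_two,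
        -mul_eq_mul_left_iff]
      field_simp
    · simp only [edge, edge3, upper, upper3, real_inner_smul_left, real_inner_smul_right,
        inner_loc (frame_mem c s k), toE2_smul, inner_toE2]
      simp [-mul_eq_mul_left_iff, -mul_eq_mul_right_iff]
      linear_combination -(R.len k * R.widthU k * R.startU k) * R.dir_sq k
  · rintro (_ | k)
    · simp only [upper, upper3, inner_loc SO3.one_mem, inner_toE2]
      simp [-mul_eq_mul_left_iff, -mul_eq_mul_right_iff]
      linear_combination hcs
    · simp only [upper, upper3, real_inner_smul_left, real_inner_smul_right,
        inner_loc (frame_mem c s k), toE2_smul, inner_toE2]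
      simp [-mul_eq_mul_left_iff, -mul_eq_mul_right_iff]
      linear_combination (R.widthU k ^ 2) * hS k -
        (R.widthU k ^ 2 * (R.startU k ^ 2 + 1)) * R.dir_sq k
  · rintro (_ | k)
    · simp only [edge, edge3, lower, lower3, real_inner_smul_left, inner_loc SO3.one_mem]
      simp [toE2, EuclideanSpace.inner_eq_star_dotProduct, dotProduct, Fin.sum_univ_two,
        -mul_eq_mul_left_iff]
      field_simp
    · simp only [edge, edge3, lower, lower3, real_inner_smul_left, real_inner_smul_right,
        inner_loc (frame_mem c s k), toE2_smul, inner_toE2]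
      simp [-mul_eq_mul_left_iff, -mul_eq_mul_right_iff]
      linear_combination -(R.len k * R.widthD k * R.startD k) * R.dir_sq k
  · rintro (_ | k)
    · simp only [lower, lower3, inner_loc SO3.one_mem, inner_toE2]
      simp [-mul_eq_mul_left_iff, -mul_eq_mul_right_iff]
      linear_combination hcs
    · simp only [lower, lower3, real_inner_smul_left, real_inner_smul_right,
        inner_loc (frame_mem c s k), toE2_smul, inner_toE2]
      simp [-mul_eq_mul_left_iff, -mul_eq_mul_right_iff]
      linear_combination (R.widthD k ^ 2) * hS k -
        (R.widthD k ^ 2 * (R.startD k ^ 2 + 1)) * R.dir_sq k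

end RowParams

namespace RowParams
variable {R : RowParams}

/-! ### Folding angles of the row -/

theorem perp_upper3 (h : R.Valid) (c s : ℝ) (k : ℕ) :
    perp (R.edge3 c s (k + 1)) (R.upper3 c s (k + 1)) =
      R.widthU k • loc (R.frame c s k) ![0, c, alt s k] := by
  rw [edge3, upper3, perp_smul_right, perp_loc (frame_mem c s k) (h.len_pos k).ne']
  rfl

theorem perp_lower3 (h : R.Valid) (c s : ℝ) (k : ℕ) :
    perp (R.edge3 c s (k + 1)) (R.lower3 c s (k + 1)) =
      R.widthD k • loc (R.frame c s k) ![0, -c, alt s k] := by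
  rw [edge3, lower3, perp_smul_right, perp_loc (frame_mem c s k) (h.len_pos k).ne']
  rfl

/-- Orthogonally to the edge, the creases point to `(c, σ)` and `(-c, σ)` with `σ = ± sin x`, which
enclose the angle `π - 2 x`. -/
theorem Valid.angle_row (h : R.Valid) {x : ℝ} (hx : 0 ≤ x) (hx' : x ≤ π / 2) (k : ℕ) :
    π - InnerProductGeometry.angle
      (perp (R.edge3 (Real.cos x) (Real.sin x) (k + 1))
        (R.upper3 (Real.cos x) (Real.sin x) (k + 1)))
      (perp (R.edge3 (Real.cos x) (Real.sin x) (k + 1))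
        (R.lower3 (Real.cos x) (Real.sin x) (k + 1))) = 2 * x := by
  rw [perp_upper3 h, perp_lower3 h, InnerProductGeometry.angle_smul_left_of_pos _ _
    (h.widthU_pos k), InnerProductGeometry.angle_smul_right_of_pos _ _ (h.widthD_pos k)]
  set c := Real.cos x with hc
  set s := Real.sin x with hs
  have hS : c ^ 2 + alt s k ^ 2 = 1 := by rw [alt_sq, hc, hs]; exact Real.cos_sq_add_sin_sq x
  have n1 : ‖loc (R.frame c s k) ![0, c, alt s k]‖ = 1 := by
    rw [← sq_eq_sq₀ (norm_nonneg _) zero_le_one, ← real_inner_self_eq_norm_sq,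
      inner_loc (frame_mem c s k)]
    simp; linear_combination hS
  have n2 : ‖loc (R.frame c s k) ![0, -c, alt s k]‖ = 1 := by
    rw [← sq_eq_sq₀ (norm_nonneg _) zero_le_one, ← real_inner_self_eq_norm_sq,
      inner_loc (frame_mem c s k)]
    simp; linear_combination hS
  have e : inner ℝ (loc (R.frame c s k) ![0, c, alt s k])
      (loc (R.frame c s k) ![0, -c, alt s k]) = Real.cos (π - 2 * x) := by
    rw [inner_loc (frame_mem c s k), Real.cos_pi_sub, Real.cos_two_mul, ← hc]
    simp; linear_combination hS
  rw [InnerProductGeometry.angle, n1, n2, e, mul_one, div_one,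
    Real.arccos_cos (by linarith) (by linarith)]
  ring

theorem rot_mulVec_one (P Q : ℝ) :
    (rot P Q).mulVec ![1, 0, 0] = (1 + P ^ 2 + Q ^ 2)⁻¹ •
      ![1 - Q ^ 2 - P ^ 2, 2 * P, -(2 * Q)] := by
  ext i
  fin_cases i <;> simp [rot, Matrix.mulVec, dotProduct, Fin.sum_univ_three]

theorem edge3_succ (c s : ℝ) (k : ℕ) :
    R.edge3 c s (k + 2) = (R.len (k + 1) / (1 + (R.p k * c) ^ 2 + (R.q k * alt s k) ^ 2)) •
      loc (R.frame c s k) ![1 - (R.q k * alt s k) ^ 2 - (R.p k * c) ^ 2, 2 * (R.p k * c),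
        -(2 * (R.q k * alt s k))] := by
  rw [edge3, frame, loc_mul, rot_mulVec_one, loc_smul, smul_smul, div_eq_mul_inv]

/-- Two neighbouring edges do not lie on the same side of an upper crease in one plane. -/
theorem Valid.edge3_ne_upper (h : R.Valid) {c s : ℝ} (hcs : c ^ 2 + s ^ 2 = 1) (hc : 0 < c)
    (k : ℕ) (a : ℝ) (ha : 0 < a) (b : ℝ) :
    R.edge3 c s (k + 2) ≠ a • (-R.edge3 c s (k + 1)) + b • R.upper3 c s (k + 2) := by
  intro heq
  have hr := h.quot_pos k
  have h1 := h.add_ne k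
  have h2 := h.sub_ne k
  have hl := h.len_pos k
  have hS : c ^ 2 + alt s k ^ 2 = 1 := by rw [alt_sq, hcs]
  rw [edge3_succ, h.upper3_eq hcs, edge3] at heq
  simp only [← loc_smul, ← loc_neg, ← loc_add] at heq
  have hinj := loc_injective (frame_mem c s k) heq
  have hden := rot_den_pos (R.p k * c) (R.q k * alt s k)
  have hlam := div_pos (h.len_pos (k + 1)) hden
  set lam := R.len (k + 1) / (1 + (R.p k * c) ^ 2 + (R.q k * alt s k) ^ 2)
  have c0 := congrFun hinj 0
  have c1 := congrFun hinj 1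
  have c2 := congrFun hinj 2
  simp at c0 c1 c2
  set σ := alt s k
  set B := b * R.widthU k with hB
  -- Eliminating the coefficient of the crease from the last two coordinates leaves only the flat
  -- state.
  have hσ : σ = 0 := by
    have : lam * c * (R.q k + R.p k) * (2 * σ) = 0 := by linear_combination σ * c1 - c * c2
    simpa [hlam.ne', hc.ne', h1] using this
  rw [hσ] at c0 hS
  have hc1 : c = 1 := by nlinarith
  subst hc1
  have hB1 : B = lam * (2 * R.p k) := by linear_combination -c1
  -- In the flat state the two edges lie on opposite sides of the crease, so the first coordinate
  -- makes `a` negative.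
  have hval : a * R.len k = -(lam * (1 + R.p k ^ 2) * ((R.q k + R.p k) / (R.q k - R.p k))) := by
    have e : a * R.len k = B * R.endU k - lam * (1 - R.p k ^ 2) := by
      linear_combination c0
    rw [e, hB1, endU]
    field_simp
    ring
  have : 0 < lam * (1 + R.p k ^ 2) * ((R.q k + R.p k) / (R.q k - R.p k)) := by positivity
  linarith [mul_pos ha hl]

/-- Two neighbouring edges do not lie on the same side of a lower crease in one plane. -/
theorem Valid.edge3_ne_lower (h : R.Valid) {c s : ℝ} (hcs : c ^ 2 + s ^ 2 = 1) (hc : 0 < c)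
    (k : ℕ) (a : ℝ) (ha : 0 < a) (b : ℝ) :
    R.edge3 c s (k + 2) ≠ a • (-R.edge3 c s (k + 1)) + b • R.lower3 c s (k + 2) := by
  intro heq
  have hr := inv_pos.2 (h.quot_pos k)
  rw [inv_div] at hr
  have h1 := h.add_ne k
  have h2 := h.sub_ne k
  have hl := h.len_pos k
  have hS : c ^ 2 + alt s k ^ 2 = 1 := by rw [alt_sq, hcs]
  rw [edge3_succ, h.lower3_eq hcs, edge3] at heq
  simp only [← loc_smul, ← loc_neg, ← loc_add] at heq
  have hinj := loc_injective (frame_mem c s k) heq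
  have hden := rot_den_pos (R.p k * c) (R.q k * alt s k)
  have hlam := div_pos (h.len_pos (k + 1)) hden
  set lam := R.len (k + 1) / (1 + (R.p k * c) ^ 2 + (R.q k * alt s k) ^ 2)
  have c0 := congrFun hinj 0
  have c1 := congrFun hinj 1
  have c2 := congrFun hinj 2
  simp at c0 c1 c2
  set σ := alt s k
  set B := b * R.widthD k with hB
  -- As for the upper crease, with `q - p` in place of `q + p`.
  have hσ : σ = 0 := by
    have : lam * c * (R.q k - R.p k) * (2 * σ) = 0 := by linear_combination -σ * c1 - c * c2
    simpa [hlam.ne', hc.ne', h2] using this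
  rw [hσ] at c0 hS
  have hc1 : c = 1 := by nlinarith
  subst hc1
  have hB1 : B = -(lam * (2 * R.p k)) := by linear_combination c1
  have hval : a * R.len k = -(lam * (1 + R.p k ^ 2) * ((R.q k - R.p k) / (R.q k + R.p k))) := by
    have e : a * R.len k = B * R.endD k - lam * (1 - R.p k ^ 2) := by
      linear_combination c0
    rw [e, hB1, endD]
    field_simp
    ring
  have : 0 < lam * (1 + R.p k ^ 2) * ((R.q k - R.p k) / (R.q k + R.p k)) := by positivity
  linarith [mul_pos ha hl]

/-- The first coordinate decides: it is positive for the edge on the left-hand side, at most zero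
for the reversed edge `0`, and zero for `x`. -/
theorem Valid.edge3_one_ne (h : R.Valid) (c s : ℝ) (a : ℝ) (ha : 0 < a) (b : ℝ) {x : E3}
    (hx : x 0 = 0) : R.edge3 c s 1 ≠ a • (-R.edge3 c s 0) + b • x := by
  intro heq
  have h0 := congrFun (congrArg WithLp.ofLp heq) 0
  simp [edge3, frame, loc, hx] at h0
  have h1 := h.len_pos 0
  have h2 := mul_nonneg ha.le (mul_nonneg h.len₀_pos.le
    (Real.sqrt_nonneg (1 - (Real.cos R.τ / c) ^ 2)))
  linarith

/-- Before the final state, edge `0` has a nonzero first coordinate while its creases have none. A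
coincidence of half-planes would thus make the creases positively proportional, but their second
coordinates are `c` and `-c`. -/
theorem Valid.angle_row_zero_ne (h : R.Valid) {c s : ℝ} (hc : Real.cos R.τ < c) :
    InnerProductGeometry.angle (perp (R.edge3 c s 0) (R.upper3 c s 0))
      (perp (R.edge3 c s 0) (R.lower3 c s 0)) ≠ 0 := by
  refine angle_perp_ne_zero fun a ha b heq => ?_
  have hc0 := h.cos_pos.trans hc
  have hg : 0 < √(1 - (Real.cos R.τ / c) ^ 2) := by
    have h1 : Real.cos R.τ / c < 1 := (div_lt_one hc0).2 hc
    have h2 : 0 < Real.cos R.τ / c := div_pos h.cos_pos hc0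
    exact Real.sqrt_pos.2 (by nlinarith)
  have h0 := congrFun (congrArg WithLp.ofLp heq) 0
  have h1 := congrFun (congrArg WithLp.ofLp heq) 1
  simp [edge3, upper3, lower3, loc] at h0 h1
  rcases h0 with h0 | h0 | h0
  · subst h0
    have := mul_pos ha hc0
    simp at h1
    linarith
  · exact h.len₀_pos.ne' h0
  · exact hg.ne' h0

/-- At half-angle `τ` the edge `0` points along the second axis, in the plane of the two creases.
Both of these then have the same component orthogonal to it, along the third axis. -/
theorem Valid.angle_row_zero (h : R.Valid) :
    InnerProductGeometry.angle
      (perp (R.edge3 (Real.cos R.τ) (Real.sin R.τ) 0)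
        (R.upper3 (Real.cos R.τ) (Real.sin R.τ) 0))
      (perp (R.edge3 (Real.cos R.τ) (Real.sin R.τ) 0)
        (R.lower3 (Real.cos R.τ) (Real.sin R.τ) 0)) = 0 := by
  have key : ∀ y : ℝ, perp (R.edge3 (Real.cos R.τ) (Real.sin R.τ) 0)
      (loc 1 ![0, y, Real.sin R.τ]) = loc 1 ![0, 0, Real.sin R.τ] := by
    intro y
    rw [edge3, perp_smul_left h.len₀_pos.ne', div_self h.cos_pos.ne', perp, inner_loc SO3.one_mem,
      inner_loc SO3.one_mem, sub_eq_iff_eq_add, ← loc_smul, ← loc_add]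
    congr 1
    ext i
    fin_cases i <;> simp
  rw [upper3, lower3, key, key]
  refine InnerProductGeometry.angle_self fun h0 => h.sin_pos.ne' ?_
  simpa [loc] using congrFun (congrArg WithLp.ofLp h0) 2

/-! ### The folding motion -/

/-- The horizontal embedding of the plane. -/
def embed : E2 →ₗᵢ[ℝ] E3 where
  toFun w := loc 1 ![w 0, w 1, 0]
  map_add' v w := by
    rw [← loc_add]; congr 1; ext i; fin_cases i <;> simp
  map_smul' r w := by
    rw [RingHom.id_apply, ← loc_smul]; congr 1; ext i; fin_cases i <;> simp
  norm_map' w := by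
    rw [← sq_eq_sq₀ (norm_nonneg _) (norm_nonneg _), ← real_inner_self_eq_norm_sq,
      ← real_inner_self_eq_norm_sq]
    change inner ℝ (loc 1 ![w 0, w 1, 0]) (loc 1 ![w 0, w 1, 0]) = _
    rw [inner_loc SO3.one_mem]
    simp [EuclideanSpace.norm_eq, Real.sq_sqrt, add_nonneg, sq_nonneg]
    ring

theorem embed_apply (w : E2) : embed w = loc 1 ![w 0, w 1, 0] := rfl

/-- For `c = 1` and `s = 0` each vertex rotates the frame about the third axis only, by the planar
angle `2 arctan p`. The folded row is then the planar one, embedded horizontally. -/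
theorem frame_flat (k : ℕ) (w : ℂ) :
    loc (R.frame 1 0 k) ![w.re, w.im, 0] = embed (toE2 (R.dir k * w)) := by
  induction k generalizing w with
  | zero => simp [frame, dir, embed_apply, toE2]
  | succ k ih =>
    have e : (rot (R.p k * 1) (R.q k * alt 0 k)).mulVec ![w.re, w.im, 0] =
        ![(rotc (R.p k) * w).re, (rotc (R.p k) * w).im, 0] := by
      have hp : (1 + R.p k ^ 2) ≠ 0 := by positivity
      ext i
      fin_cases i <;>
        simp [rot, alt, Matrix.mulVec, dotProduct, Fin.sum_univ_three, rotc_re, rotc_im] <;>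
        field_simp <;> ring
    rw [frame, loc_mul, e, ih, dir, mul_assoc]

theorem Valid.edge3_flat (h : R.Valid) (i : ℕ) : R.edge3 1 0 i = embed (R.edge i) := by
  cases i with
  | zero =>
    have e : √(1 - Real.cos R.τ ^ 2) = Real.sin R.τ := by
      rw [← Real.sin_sq, Real.sqrt_sq h.sin_pos.le]
    rw [edge3, edge, map_smul, embed_apply, div_one, e]
    rfl
  | succ k =>
    have := R.frame_flat k 1
    simp only [Complex.one_re, Complex.one_im, mul_one] at this
    rw [edge3, edge, this, toE2_smul, map_smul]

theorem upper3_flat (i : ℕ) : R.upper3 1 0 i = embed (R.upper i) := by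
  cases i with
  | zero => simp [upper3, upper, embed_apply, toE2]
  | succ k =>
    have := R.frame_flat k (R.startU k + Complex.I)
    simp at this
    rw [upper3, upper, toE2_smul, map_smul, ← this]
    simp [alt]

theorem lower3_flat (i : ℕ) : R.lower3 1 0 i = embed (R.lower i) := by
  cases i with
  | zero => simp [lower3, lower, embed_apply, toE2]
  | succ k =>
    have := R.frame_flat k (R.startD k - Complex.I)
    simp at this
    rw [lower3, lower, toE2_smul, map_smul, ← this]
    simp [alt]

theorem Valid.points_flat (h : R.Valid) (o : E3) (i : ℕ) :
    points o (R.edge3 1 0) i = o + embed (points 0 R.edge i) := by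
  cases i with
  | zero => simp [points, h.edge3_flat, sub_eq_add_neg]
  | succ k => simp [points, h.edge3_flat]

variable (R) in
/-- The folding motion of the grid over the row. -/
def motion (δ : ℝ) (o : E3) (t : ℝ) : ℕ × ℕ → E3 :=
  grid δ (points o (R.edge3 (Real.cos (t * R.τ)) (Real.sin (t * R.τ))))
    (R.upper3 (Real.cos (t * R.τ)) (Real.sin (t * R.τ)))
    (R.lower3 (Real.cos (t * R.τ)) (Real.sin (t * R.τ)))

theorem continuous_loc {X : Type*} [TopologicalSpace X] {F : X → Matrix (Fin 3) (Fin 3) ℝ}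
    {v : X → Fin 3 → ℝ} (hF : Continuous F) (hv : Continuous v) :
    Continuous fun t => loc (F t) (v t) :=
  (PiLp.continuous_toLp 2 _).comp (hF.matrix_mulVec hv)

theorem continuous_vec3 {X : Type*} [TopologicalSpace X] {a b c : X → ℝ} (ha : Continuous a)
    (hb : Continuous b) (hc : Continuous c) : Continuous fun t => ![a t, b t, c t] := by
  refine continuous_pi fun i => ?_
  fin_cases i <;> simpa

theorem continuous_rot {X : Type*} [TopologicalSpace X] {P Q : X → ℝ} (hP : Continuous P)
    (hQ : Continuous Q) : Continuous fun t => rot (P t) (Q t) := by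
  unfold rot
  refine Continuous.smul (Continuous.inv₀ (by fun_prop) fun t => (rot_den_pos _ _).ne') ?_
  refine continuous_matrix fun i j => ?_
  fin_cases i <;> fin_cases j <;> simp <;> fun_prop

section continuity
variable {X : Type*} [TopologicalSpace X] {c s : X → ℝ}

theorem continuous_alt (hs : Continuous s) (k : ℕ) : Continuous fun t => alt (s t) k := by
  unfold alt; fun_prop

theorem continuous_frame (hc : Continuous c) (hs : Continuous s) (k : ℕ) :
    Continuous fun t => R.frame (c t) (s t) k := by
  induction k with
  | zero => exact continuous_const
  | succ k ih =>
    exact ih.matrix_mul (continuous_rot (continuous_const.mul hc)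
      (continuous_const.mul (continuous_alt hs k)))

theorem continuous_edge3 (hc : Continuous c) (hs : Continuous s) (h0 : ∀ t, c t ≠ 0) (i : ℕ) :
    Continuous fun t => R.edge3 (c t) (s t) i := by
  cases i with
  | zero =>
    have hg : Continuous fun t => Real.cos R.τ / c t := continuous_const.div hc h0
    simp only [edge3]
    exact (continuous_loc continuous_const (continuous_vec3
      (Real.continuous_sqrt.comp (continuous_const.sub (hg.pow 2))) hg
      continuous_const)).const_smul R.len₀
  | succ k =>
    simp only [edge3]
    exact (continuous_loc (continuous_frame hc hs k) continuous_const).const_smul (R.len k)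

theorem continuous_upper3 (hc : Continuous c) (hs : Continuous s) (i : ℕ) :
    Continuous fun t => R.upper3 (c t) (s t) i := by
  cases i with
  | zero => exact continuous_loc continuous_const (continuous_vec3 continuous_const hc hs)
  | succ k =>
    simp only [upper3]
    exact (continuous_loc (continuous_frame hc hs k)
      (continuous_vec3 continuous_const hc (continuous_alt hs k))).const_smul (R.widthU k)

theorem continuous_lower3 (hc : Continuous c) (hs : Continuous s) (i : ℕ) :
    Continuous fun t => R.lower3 (c t) (s t) i := by
  cases i with
  | zero => exact continuous_loc continuous_const (continuous_vec3 continuous_const hc.neg hs)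
  | succ k =>
    simp only [lower3]
    exact (continuous_loc (continuous_frame hc hs k)
      (continuous_vec3 continuous_const hc.neg (continuous_alt hs k))).const_smul (R.widthD k)

theorem continuous_points {o : E3} {e : X → ℕ → E3} (he : ∀ i, Continuous fun t => e t i)
    (i : ℕ) : Continuous fun t => points o (e t) i := by
  cases i with
  | zero => exact continuous_const.sub (he 0)
  | succ k => exact continuous_const.add (continuous_finsetSum _ fun l _ => he (l + 1))

end continuity

theorem Valid.cos_le (h : R.Valid) {t : ℝ} (ht : 0 ≤ t) (ht' : t ≤ 1) :
    Real.cos R.τ ≤ Real.cos (t * R.τ) := by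
  have := h.τ_pos
  refine Real.cos_le_cos_of_nonneg_of_le_pi (by positivity) (by linarith [h.τ_lt, Real.pi_pos])
    ?_
  nlinarith

theorem Valid.cos_lt (h : R.Valid) {t : ℝ} (ht : 0 ≤ t) (ht' : t < 1) :
    Real.cos R.τ < Real.cos (t * R.τ) := by
  have := h.τ_pos
  refine Real.cos_lt_cos_of_nonneg_of_le_pi (by positivity) (by linarith [h.τ_lt, Real.pi_pos])
    ?_
  nlinarith

theorem Valid.motion_rowFold_zero (h : R.Valid) {m n : ℕ} {δ : ℝ} {P : ℕ → E2}
    (ht : IsThin m n P R.edge R.upper R.lower R.shiftU R.shiftD δ) (o : E3) {j : ℕ} (hj : 1 ≤ j)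
    (hj' : j ≤ m) : rowFold (R.motion δ o 1) j 0 = π := by
  have hf := h.isFoldedRow (Real.cos_sq_add_sin_sq R.τ) le_rfl o
  rw [motion, one_mul, hf.rowFold_eq ht.pos hj (ht.scale 0 (by omega) j (by omega)),
    h.angle_row_zero, sub_zero]

theorem Valid.motion_rowFold_succ (h : R.Valid) {m n : ℕ} {δ : ℝ} {P : ℕ → E2}
    (ht : IsThin m n P R.edge R.upper R.lower R.shiftU R.shiftD δ) (o : E3) {t : ℝ} (ht0 : 0 ≤ t)
    (ht1 : t ≤ 1) {j i : ℕ} (hj : 1 ≤ j) (hj' : j ≤ m) (hi : i + 1 ≤ n) :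
    rowFold (R.motion δ o t) j (i + 1) = 2 * (t * R.τ) := by
  have hf := h.isFoldedRow (Real.cos_sq_add_sin_sq (t * R.τ)) (h.cos_le ht0 ht1) o
  have := h.τ_pos
  rw [motion, hf.rowFold_eq ht.pos hj (ht.scale (i + 1) hi j (by omega)),
    h.angle_row (by positivity) (by nlinarith [h.τ_lt])]

/-- Half the folding angle is `t τ` at time `t`. Columns never clash, rows right of the first vertex
have folding angle `2 t τ < π`, and the leftmost row creases close exactly at `t = 1`. -/
theorem Valid.isFoldingMotion (h : R.Valid) {m n : ℕ} (hm : 1 ≤ m) {δ : ℝ}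
    (ht : IsThin m n (points 0 R.edge) R.edge R.upper R.lower R.shiftU R.shiftD δ) (o : E3) :
    IsFoldingMotion m n (grid δ (points 0 R.edge) R.upper R.lower) (R.motion δ o) where
  continuous := by
    intro j _ i _
    -- The formula for edge `0` divides by `cos (t τ)`, whose positivity is guaranteed for times in
    -- `[0, 1]`.
    rw [continuousOn_iff_continuous_domRestrict]
    have hc : Continuous fun t : Set.Icc (0 : ℝ) 1 => Real.cos (t * R.τ) := by fun_prop
    have hs : Continuous fun t : Set.Icc (0 : ℝ) 1 => Real.sin (t * R.τ) := by fun_prop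
    have h0 : ∀ t : Set.Icc (0 : ℝ) 1, Real.cos (t * R.τ) ≠ 0 := fun t =>
      (h.cos_pos.trans_le (h.cos_le t.2.1 t.2.2)).ne'
    exact ((continuous_points (continuous_edge3 hc hs h0) i).add
      ((continuous_lower3 hc hs i).const_smul (δ * lowerCount j))).sub
      ((continuous_upper3 hc hs i).const_smul (δ * upperCount j))
  folded := by
    intro t ht'
    exact h.isPlanarRow.isFoldedState
      (h.isFoldedRow (Real.cos_sq_add_sin_sq _) (h.cos_le ht'.1 ht'.2) o)
  planar := by
    obtain ⟨S, hS⟩ := exists_affineIsometry embed 0 o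
    refine ⟨S, fun j _ i _ => ?_⟩
    rw [hS, motion]
    simp only [zero_mul, Real.cos_zero, Real.sin_zero, grid, h.points_flat, upper3_flat,
      lower3_flat, sub_zero, map_sub, map_add, map_smul]
    abel
  clashFree := by
    intro t ht'
    have hlt := h.cos_lt ht'.1 ht'.2
    have hcs := Real.cos_sq_add_sin_sq (t * R.τ)
    have hf := h.isFoldedRow hcs hlt.le o
    have hc := h.cos_pos.trans hlt
    constructor
    · rintro j (_ | i) hj hj' hi
      · rw [motion, hf.rowFold_eq ht.pos hj (ht.scale 0 hi j (by omega))]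
        exact sub_angle_lt_pi (h.angle_row_zero_ne hlt)
      · rw [h.motion_rowFold_succ ht o ht'.1 ht'.2.le hj hj' hi]
        have := h.τ_pos
        nlinarith [h.τ_lt, ht'.2]
    · rintro j (_ | i) hj hi hi'
      · omega
      · refine hf.colFold_lt ht.pos (ht.scale i (by omega) j (by omega))
          (ht.scale (i + 1) hi' j (by omega)) ?_ ?_
        · rcases i with _ | k
          · intro a ha b
            exact h.edge3_one_ne _ _ a ha b (by simp [upper3, frame, loc, startU])
          · exact h.edge3_ne_upper hcs hc k
        · rcases i with _ | k
          · intro a ha b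
            exact h.edge3_one_ne _ _ a ha b (by simp [lower3, frame, loc, startD])
          · exact h.edge3_ne_lower hcs hc k
  clash := by
    intro hcl
    exact (hcl.1 1 0 le_rfl hm (Nat.zero_le _)).ne
      (h.motion_rowFold_zero ht o le_rfl hm)

end RowParams

/-! ### Spherical trigonometry -/

theorem inner_perp {d : E3} (hd : d ≠ 0) (x y : E3) :
    inner ℝ (perp d x) (perp d y) = ‖x‖ * ‖y‖ *
      (Real.cos (InnerProductGeometry.angle x y) -
        Real.cos (InnerProductGeometry.angle x d) * Real.cos (InnerProductGeometry.angle y d)) := by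
  have h1 := InnerProductGeometry.cos_angle_mul_norm_mul_norm x y
  have h2 := InnerProductGeometry.cos_angle_mul_norm_mul_norm x d
  have h3 := InnerProductGeometry.cos_angle_mul_norm_mul_norm y d
  have hd' : ‖d‖ ≠ 0 := norm_ne_zero_iff.2 hd
  simp only [perp, inner_sub_left, inner_sub_right, real_inner_smul_left, real_inner_smul_right,
    real_inner_self_eq_norm_sq, real_inner_comm x d, real_inner_comm y d]
  rw [← h1, ← h2, ← h3]
  field_simp
  ring

theorem norm_perp {d : E3} (hd : d ≠ 0) (x : E3) :
    ‖perp d x‖ = ‖x‖ * Real.sin (InnerProductGeometry.angle x d) := by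
  rw [← sq_eq_sq₀ (norm_nonneg _)
    (mul_nonneg (norm_nonneg _) (InnerProductGeometry.sin_angle_nonneg _ _)),
    ← real_inner_self_eq_norm_sq, inner_perp hd]
  by_cases hx : x = 0
  · simp [hx]
  · rw [InnerProductGeometry.angle_self hx, Real.cos_zero, mul_pow, Real.sin_sq]
    ring

/-- The spherical law of cosines. -/
theorem angle_perp {d x y : E3} (hd : d ≠ 0) (hx : x ≠ 0) (hy : y ≠ 0) :
    InnerProductGeometry.angle (perp d x) (perp d y) =
      sphAngle (InnerProductGeometry.angle x y) (InnerProductGeometry.angle x d)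
        (InnerProductGeometry.angle y d) := by
  have hx' : ‖x‖ ≠ 0 := norm_ne_zero_iff.2 hx
  have hy' : ‖y‖ ≠ 0 := norm_ne_zero_iff.2 hy
  rw [InnerProductGeometry.angle, sphAngle, inner_perp hd, norm_perp hd, norm_perp hd,
    mul_mul_mul_comm, mul_div_mul_left _ _ (mul_ne_zero hx' hy')]

theorem sphExtAngle_eq (a b c : ℝ) : sphExtAngle a b c = π - sphAngle a b c := by
  rw [sphExtAngle, sphAngle, ← Real.arccos_neg, ← neg_div, neg_sub]

/-! ### Angles in the plane orthogonal to an edge -/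

theorem exists_unit_arg {a b : ℂ} (ha : a ≠ 0) (hb : b ≠ 0) :
    ∃ s : ℤˣ, InnerProductGeometry.angle a b = (s : ℤ) * (a / b).arg := by
  rw [Complex.angle_eq_abs_arg ha hb]
  rcases abs_choice (a / b).arg with h | h
  · exact ⟨1, by simp [h]⟩
  · exact ⟨-1, by simp [h]⟩

theorem zsmul_unit_pi (s : ℤˣ) : ((s : ℤ) • (π : Real.Angle)) = π := by
  rcases Int.units_eq_one_or s with rfl | rfl <;> simp

/-- The unsigned angles are arguments up to sign. With `s` chosen as the product of the two signs,
the arguments relative to `x` combine to that of `d / u`, and `x` drops out; a sign in front of `π`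
is irrelevant modulo `2π`. -/
theorem exists_unit_fold {u d x : ℂ} (hu : u ≠ 0) (hd : d ≠ 0) (hx : x ≠ 0) :
    ∃ s t : ℤˣ, ((π - InnerProductGeometry.angle u x + (s : ℤ) * InnerProductGeometry.angle d x
      : ℝ) : Real.Angle) = (t : ℤ) • ((π : Real.Angle) + ((d / u).arg : Real.Angle)) := by
  obtain ⟨s1, h1⟩ := exists_unit_arg hu hx
  obtain ⟨s2, h2⟩ := exists_unit_arg hd hx
  refine ⟨s1 * s2, s1, ?_⟩
  have e : ((d / u).arg : Real.Angle) =
      ((d / x).arg : Real.Angle) - ((u / x).arg : Real.Angle) := by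
    rw [← Complex.arg_div_coe_angle (div_ne_zero hd hx) (div_ne_zero hu hx),
      div_div_div_cancel_right₀ hx]
  have hs : ((s2 : ℤ) : ℝ) * ((s2 : ℤ) : ℝ) = 1 := by
    rcases Int.units_eq_one_or s2 with rfl | rfl <;> simp
  have e2 : π - InnerProductGeometry.angle u x +
      ((s1 * s2 : ℤˣ) : ℤ) * InnerProductGeometry.angle d x =
      π + (s1 : ℤ) * ((d / x).arg - (u / x).arg) := by
    rw [h1, h2]; push_cast; linear_combination ((s1 : ℤ) : ℝ) * (d / x).arg * hs
  rw [e2, Real.Angle.coe_add, Real.Angle.intCast_mul_eq_zsmul, Real.Angle.coe_sub, ← e,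
    smul_add, zsmul_unit_pi]

theorem exists_units_fold {u d x y : ℂ} (hu : u ≠ 0) (hd : d ≠ 0) (hx : x ≠ 0) (hy : y ≠ 0) :
    ∃ s s' s'' : ℤˣ, ((π - InnerProductGeometry.angle u x +
      (s : ℤ) * InnerProductGeometry.angle d x : ℝ) : Real.Angle) =
      (((s'' : ℤ) * (π - InnerProductGeometry.angle u y +
        (s' : ℤ) * InnerProductGeometry.angle d y) : ℝ) : Real.Angle) := by
  obtain ⟨s, t, h⟩ := exists_unit_fold hu hd hx
  obtain ⟨s', t', h'⟩ := exists_unit_fold hu hd hy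
  refine ⟨s, s', t * t', ?_⟩
  rw [h, Real.Angle.intCast_mul_eq_zsmul, h', smul_smul, ← Units.val_mul, mul_assoc,
    Int.units_mul_self, mul_one]

/-- The argument of `y / x` is the difference of those of `u / x` and `u / y`, each an unsigned
angle up to sign. -/
theorem exists_units_torsion {u x y : ℂ} (hu : u ≠ 0) (hx : x ≠ 0) (hy : y ≠ 0) :
    ∃ s s' : ℤˣ, ((y / x).arg : Real.Angle) = (((s : ℤ) * InnerProductGeometry.angle u x +
      (s' : ℤ) * InnerProductGeometry.angle u y : ℝ) : Real.Angle) := by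
  obtain ⟨s1, h1⟩ := exists_unit_arg hu hx
  obtain ⟨s2, h2⟩ := exists_unit_arg hu hy
  refine ⟨s1, -s2, ?_⟩
  have hs : ∀ s : ℤˣ, ((s : ℤ) : ℝ) * ((s : ℤ) : ℝ) = 1 := by
    intro s
    rcases Int.units_eq_one_or s with rfl | rfl <;> simp
  have e : ((s1 : ℤ) : ℝ) * InnerProductGeometry.angle u x +
      ((-s2 : ℤˣ) : ℤ) * InnerProductGeometry.angle u y = (u / x).arg - (u / y).arg := by
    rw [h1, h2]; push_cast
    linear_combination (u / x).arg * hs s1 - (u / y).arg * hs s2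
  rw [e, Real.Angle.coe_sub,
    ← Complex.arg_div_coe_angle (div_ne_zero hu hx) (div_ne_zero hu hy)]
  congr 2
  field_simp

/-- Coordinates in the plane orthogonal to the first vector of a frame. -/
theorem exists_perp_eq {F : Matrix (Fin 3) (Fin 3) ℝ} (hF : F ∈ SO3) {l : ℝ} (hl : l ≠ 0) (x : E3) :
    ∃ w : ℂ, perp (l • loc F ![1, 0, 0]) x = loc F ![0, w.re, w.im] := by
  obtain ⟨v, rfl⟩ := exists_eq_loc hF x
  exact ⟨⟨v 1, v 2⟩, perp_loc hF hl v⟩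

/-- In the frame of the edge, the inner product and the determinant are, up to a common positive
factor, the real and imaginary parts of `y / x`. -/
theorem torsion_loc {F : Matrix (Fin 3) (Fin 3) ℝ} (hF : F ∈ SO3) {l : ℝ} (hl : 0 < l) {x y : ℂ}
    (hx : x ≠ 0) :
    Complex.arg ⟨‖l • loc F ![1, 0, 0]‖ * inner ℝ (loc F ![0, x.re, x.im]) (loc F ![0, y.re, y.im]),
      Matrix.det (Matrix.of fun r c =>
        (![l • loc F ![1, 0, 0], loc F ![0, x.re, x.im], loc F ![0, y.re, y.im]] r) c)⟩ =
      (y / x).arg := by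
  have hn : ‖l • loc F ![1, 0, 0]‖ = l := by
    rw [← sq_eq_sq₀ (norm_nonneg _) hl.le, ← real_inner_self_eq_norm_sq, real_inner_smul_left,
      real_inner_smul_right, inner_loc hF]
    simp; ring
  have hpos : 0 < l * Complex.normSq x := mul_pos hl (Complex.normSq_pos.2 hx)
  rw [← Complex.arg_real_mul (y / x) hpos, hn, inner_loc hF, ← loc_smul, det_loc hF]
  congr 1
  have hx' := (Complex.normSq_pos.2 hx).ne'
  apply Complex.ext
  · simp [Complex.div_re]
    field_simp
  · simp [Complex.div_im, Matrix.det_fin_three]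
    field_simp

/-- The equations between the sector angles of a folded row and the angles of the polygonal line,
for the vertices at both ends of an edge `e₁`. -/
theorem generalEquations_of_edges {F : Matrix (Fin 3) (Fin 3) ℝ} (hF : F ∈ SO3) {l : ℝ} (hl : 0 < l)
    {e₀ e₁ e₂ u d : E3} (κ μ : ℝ) (h₁ : e₁ = l • loc F ![1, 0, 0])
    (h₀ : e₀ ≠ 0) (h₂ : e₂ ≠ 0) (hu : perp e₁ u ≠ 0) (hd : perp e₁ d ≠ 0)
    (hx : perp e₁ (-e₀) ≠ 0) (hy : perp e₁ e₂ ≠ 0) {θ : ℝ}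
    (hθ : (θ : Real.Angle) = (Complex.arg ⟨‖e₁‖ * inner ℝ (perp e₁ (-e₀)) (perp e₁ e₂),
      Matrix.det (Matrix.of fun r c => (![e₁, perp e₁ (-e₀), perp e₁ e₂] r) c)⟩ : ℝ)) :
    GeneralEquations
      ![InnerProductGeometry.angle u e₁, InnerProductGeometry.angle u (-e₀),
        InnerProductGeometry.angle d (-e₀), InnerProductGeometry.angle d e₁]
      ![InnerProductGeometry.angle (u + κ • e₁) e₂, InnerProductGeometry.angle (u + κ • e₁) (-e₁),
        InnerProductGeometry.angle (d + μ • e₁) (-e₁), InnerProductGeometry.angle (d + μ • e₁) e₂]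
      (InnerProductGeometry.angle (-e₀) e₁) (InnerProductGeometry.angle (-e₁) e₂) θ := by
  have hp0 : ∀ v : E3, perp v 0 = 0 := fun v => by simp [perp]
  have e₁0 : e₁ ≠ 0 := by
    rw [h₁]
    refine smul_ne_zero hl.ne' fun h => ?_
    have := inner_loc hF ![1, 0, 0] ![1, 0, 0]
    simp [h] at this
  have nu : u ≠ 0 := fun h => hu (by rw [h, hp0])
  have nd : d ≠ 0 := fun h => hd (by rw [h, hp0])
  have nu' : u + κ • e₁ ≠ 0 := fun h => hu (by rw [← perp_add_smul e₁ u κ, h, hp0])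
  have nd' : d + μ • e₁ ≠ 0 := fun h => hd (by rw [← perp_add_smul e₁ d μ, h, hp0])
  -- One spherical triangle for each pair of a crease and a neighbouring edge. Those at the far end
  -- have `-e₁` as vertex, since the sector angles there are measured from the reversed edge.
  have a1 := angle_perp e₁0 nu (neg_ne_zero.2 h₀)
  have a2 := angle_perp e₁0 nd (neg_ne_zero.2 h₀)
  have a3 := angle_perp (neg_ne_zero.2 e₁0) nu' h₂
  have a4 := angle_perp (neg_ne_zero.2 e₁0) nd' h₂
  rw [perp_neg_left, perp_neg_left, perp_add_smul, InnerProductGeometry.angle_comm e₂] at a3 a4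
  obtain ⟨x, ex⟩ := exists_perp_eq hF hl.ne' (-e₀)
  obtain ⟨y, ey⟩ := exists_perp_eq hF hl.ne' e₂
  obtain ⟨v, ev⟩ := exists_perp_eq hF hl.ne' u
  obtain ⟨w, ew⟩ := exists_perp_eq hF hl.ne' d
  rw [← h₁] at ex ey ev ew
  have nz : ∀ w : ℂ, loc F ![0, w.re, w.im] ≠ 0 → w ≠ 0 := by
    rintro w h rfl
    refine h ?_
    have : (![0, (0 : ℂ).re, (0 : ℂ).im] : Fin 3 → ℝ) = 0 := by
      ext i; fin_cases i <;> simp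
    rw [this]; simp [loc]
  have hx' := nz x (ex ▸ hx)
  have hy' := nz y (ey ▸ hy)
  have hv' := nz v (ev ▸ hu)
  have hw' := nz w (ew ▸ hd)
  rw [ex, ey, h₁, torsion_loc hF hl hx'] at hθ
  rw [ev, ex, angle_loc hF] at a1
  rw [ew, ex, angle_loc hF] at a2
  rw [ev, ey, angle_loc hF] at a3
  rw [ew, ey, angle_loc hF] at a4
  constructor
  · obtain ⟨s, s', s'', h⟩ := exists_units_fold hv' hw' hx' hy'
    refine ⟨s, s', s'', ?_⟩
    rw [sphExtAngle_eq, sphExtAngle_eq]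
    simpa [a1, a2, a3, a4] using h
  · obtain ⟨s, s', h⟩ := exists_units_torsion hv' hx' hy'
    refine ⟨s, s', ?_⟩
    rw [hθ, h]
    simp [a1, a3]

/-! ### The equations for the folded row -/

theorem angle_eq_of_inner {V W : Type*} [NormedAddCommGroup V] [InnerProductSpace ℝ V]
    [NormedAddCommGroup W] [InnerProductSpace ℝ W] {x y : V} {x' y' : W}
    (hx : inner ℝ x x = inner ℝ x' x') (hy : inner ℝ y y = inner ℝ y' y')
    (hxy : inner ℝ y x = inner ℝ y' x') :
    InnerProductGeometry.angle x y = InnerProductGeometry.angle x' y' := by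
  have nx : ‖x‖ = ‖x'‖ := by
    rwa [← sq_eq_sq₀ (norm_nonneg _) (norm_nonneg _), ← real_inner_self_eq_norm_sq,
      ← real_inner_self_eq_norm_sq]
  have ny : ‖y‖ = ‖y'‖ := by
    rwa [← sq_eq_sq₀ (norm_nonneg _) (norm_nonneg _), ← real_inner_self_eq_norm_sq,
      ← real_inner_self_eq_norm_sq]
  rw [InnerProductGeometry.angle, InnerProductGeometry.angle, nx, ny, real_inner_comm, hxy,
    real_inner_comm]

/-- The sector angles of a row do not change when it is folded. -/
theorem IsFoldedRow.rowSector_eq {P E U D : ℕ → E2} {κ μ : ℕ → ℝ} {x e u d : ℕ → E3}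
    (h : IsPlanarRow P E U D κ μ) (hf : IsFoldedRow E U D κ μ x e u d) (i : ℕ) :
    rowSector E U D (i + 1) =
      ![InnerProductGeometry.angle (u (i + 1)) (e (i + 1)),
        InnerProductGeometry.angle (u (i + 1)) (-e i),
        InnerProductGeometry.angle (d (i + 1)) (-e i),
        InnerProductGeometry.angle (d (i + 1)) (e (i + 1))] := by
  have hu : inner ℝ (e i) (u (i + 1)) = inner ℝ (E i) (U (i + 1)) := by
    rw [hf.stepU, h.stepU, inner_add_right, inner_add_right, real_inner_smul_right,
      real_inner_smul_right, hf.inner_eu, hf.inner_ee]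
  have hd : inner ℝ (e i) (d (i + 1)) = inner ℝ (E i) (D (i + 1)) := by
    rw [hf.stepD, h.stepD, inner_add_right, inner_add_right, real_inner_smul_right,
      real_inner_smul_right, hf.inner_ed, hf.inner_ee]
  simp only [rowSector, Nat.add_sub_cancel, InnerProductGeometry.angle_neg_right]
  rw [angle_eq_of_inner (hf.inner_uu _) (hf.inner_ee _) (hf.inner_eu _),
    angle_eq_of_inner (hf.inner_uu _) (hf.inner_ee _) hu,
    angle_eq_of_inner (hf.inner_dd _) (hf.inner_ee _) hd,
    angle_eq_of_inner (hf.inner_dd _) (hf.inner_ee _) (hf.inner_ed _)]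

namespace RowParams
variable {R : RowParams}

theorem turnAngle_points (o : E3) (e : ℕ → E3) (i : ℕ) :
    turnAngle (points o e) (i + 1) = InnerProductGeometry.angle (-e i) (e (i + 1)) := by
  rw [turnAngle, Nat.add_sub_cancel, EuclideanGeometry.angle, vsub_eq_sub, vsub_eq_sub,
    points_succ o e (i + 1), points_succ o e i]
  congr 1 <;> abel

theorem coe_torsionAngle_points (o : E3) (e : ℕ → E3) (i : ℕ) :
    (torsionAngle (points o e) (i + 1) : Real.Angle) =
      (Complex.arg ⟨‖e (i + 1)‖ * inner ℝ (perp (e (i + 1)) (-e i)) (perp (e (i + 1)) (e (i + 2))),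
        Matrix.det (Matrix.of fun r c => (![e (i + 1), perp (e (i + 1)) (-e i),
          perp (e (i + 1)) (e (i + 2))] r) c)⟩ : ℝ) := by
  have h1 : points o e (i + 1 + 1) - points o e (i + 1) = e (i + 1) := by
    rw [points_succ o e (i + 1)]; abel
  have h2 : points o e i - points o e (i + 1) = -e i := by
    rw [points_succ o e i]; abel
  have h3 : points o e (i + 1 + 2) - points o e (i + 1 + 1) = e (i + 2) := by
    rw [points_succ o e (i + 2)]; abel
  simp only [torsionAngle, Nat.add_sub_cancel, h1, h2, h3]
  exact Real.Angle.coe_toIcoMod _ _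

/-- In the final state, edge `0` points along the second axis and edge `1` along the first. -/
theorem Valid.turnAngle_one (h : R.Valid) (s : ℝ) :
    InnerProductGeometry.angle (-R.edge3 (Real.cos R.τ) s 0) (R.edge3 (Real.cos R.τ) s 1) =
      π / 2 := by
  rw [← InnerProductGeometry.inner_eq_zero_iff_angle_eq_pi_div_two, inner_neg_left, edge3, edge3,
    real_inner_smul_left, real_inner_smul_right, frame, inner_loc SO3.one_mem,
    div_self h.cos_pos.ne']
  simp

/-- In the frame of the left edge, the right edge has third coordinate proportional to `q σ`, which
is nonzero as soon as the row is folded. So the edges are not collinear. -/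
theorem Valid.turnAngle_succ (h : R.Valid) {c s : ℝ} (hs : s ≠ 0) (k : ℕ) :
    0 < InnerProductGeometry.angle (-R.edge3 c s (k + 1)) (R.edge3 c s (k + 2)) ∧
      InnerProductGeometry.angle (-R.edge3 c s (k + 1)) (R.edge3 c s (k + 2)) < π := by
  have key : ∀ r : ℝ, R.edge3 c s (k + 2) ≠ r • (-R.edge3 c s (k + 1)) := by
    intro r heq
    rw [edge3_succ, edge3] at heq
    simp only [← loc_smul, ← loc_neg] at heq
    have h2 := congrFun (loc_injective (frame_mem c s k) heq) 2
    have hq : R.q k ≠ 0 := fun h0 => by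
      have := h.p_lt k
      rw [h0, abs_zero] at this
      exact absurd this (abs_nonneg _).not_gt
    have hden := rot_den_pos (R.p k * c) (R.q k * alt s k)
    have hlen := h.len_pos (k + 1)
    simp [alt, hs, hq, hlen.ne'] at h2
    exact hden.ne' (by rw [alt]; exact h2)
  constructor
  · refine (InnerProductGeometry.angle_nonneg _ _).lt_of_ne' fun h0 => ?_
    obtain ⟨-, r, -, hr⟩ := InnerProductGeometry.angle_eq_zero_iff.1 h0
    exact key r hr
  · refine (InnerProductGeometry.angle_le_pi _ _).lt_of_ne fun h0 => ?_
    obtain ⟨-, r, -, hr⟩ := InnerProductGeometry.angle_eq_pi_iff.1 h0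
    exact key r hr

theorem Valid.turnAngle_mem (h : R.Valid) (i : ℕ) :
    0 < InnerProductGeometry.angle (-R.edge3 (Real.cos R.τ) (Real.sin R.τ) i)
        (R.edge3 (Real.cos R.τ) (Real.sin R.τ) (i + 1)) ∧
      InnerProductGeometry.angle (-R.edge3 (Real.cos R.τ) (Real.sin R.τ) i)
        (R.edge3 (Real.cos R.τ) (Real.sin R.τ) (i + 1)) < π := by
  cases i with
  | zero =>
    rw [h.turnAngle_one]
    constructor <;> linarith [Real.pi_pos]
  | succ k => exact h.turnAngle_succ h.sin_pos.ne' k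

theorem Valid.firstEquations (h : R.Valid) :
    FirstEquations (rowSector R.edge R.upper R.lower 1) (π / 2) π (2 * R.τ) := by
  rw [h.sector_one]
  constructor
  · simp [sphExtAngle]
    ring
  · simp [sphExtAngle]
    rw [Real.arccos_cos h.τ_pos.le (by linarith [h.τ_lt, Real.pi_pos])]

theorem edge3_ne_zero {c s : ℝ} (h : R.Valid) (hf : ∀ i, inner ℝ (R.edge3 c s i) (R.edge3 c s i) =
    inner ℝ (R.edge i) (R.edge i)) (i : ℕ) : R.edge3 c s i ≠ 0 := by
  intro h0
  have h1 := hf i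
  rw [h0, inner_zero_left] at h1
  have h2 := inner_self_eq_zero.1 h1.symm
  have := h.isPlanarRow.posX i
  rw [h2] at this
  simp at this

theorem Valid.generalEquations (h : R.Valid) (o : E3) (k : ℕ) :
    GeneralEquations (rowSector R.edge R.upper R.lower (k + 1))
      (rowSector R.edge R.upper R.lower (k + 2))
      (turnAngle (points o (R.edge3 (Real.cos R.τ) (Real.sin R.τ))) (k + 1))
      (turnAngle (points o (R.edge3 (Real.cos R.τ) (Real.sin R.τ))) (k + 2))
      (torsionAngle (points o (R.edge3 (Real.cos R.τ) (Real.sin R.τ))) (k + 1)) := by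
  have hf := h.isFoldedRow (Real.cos_sq_add_sin_sq R.τ) le_rfl o
  have hne := edge3_ne_zero h hf.inner_ee
  have hθ := coe_torsionAngle_points o (R.edge3 (Real.cos R.τ) (Real.sin R.τ)) k
  have b1 := h.turnAngle_mem k
  have b2 := h.turnAngle_mem (k + 1)
  rw [hf.rowSector_eq h.isPlanarRow k, hf.rowSector_eq h.isPlanarRow (k + 1),
    turnAngle_points, turnAngle_points, hf.stepU (k + 1), hf.stepD (k + 1)]
  have hnz : ∀ y : ℝ, loc (R.frame (Real.cos R.τ) (Real.sin R.τ) k)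
      ![0, y, alt (Real.sin R.τ) k] ≠ 0 := by
    intro y h0
    have := congrFun (loc_injective (frame_mem (Real.cos R.τ) (Real.sin R.τ) k)
      (h0.trans (by simp [loc] : (0 : E3) = loc _ 0))) 2
    simp [alt, h.sin_pos.ne'] at this
  refine generalEquations_of_edges
    (e₁ := R.edge3 (Real.cos R.τ) (Real.sin R.τ) (k + 1))
    (frame_mem (Real.cos R.τ) (Real.sin R.τ) k) (h.len_pos k)
    _ _ rfl (hne k) (hne (k + 2)) ?_ ?_ ?_ ?_ hθ
  · rw [perp_upper3 h]
    exact smul_ne_zero (h.widthU_pos k).ne' (hnz _)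
  · rw [perp_lower3 h]
    exact smul_ne_zero (h.widthD_pos k).ne' (hnz _)
  · rw [← norm_ne_zero_iff, norm_perp (hne (k + 1))]
    exact mul_ne_zero (norm_ne_zero_iff.2 (neg_ne_zero.2 (hne k)))
      (Real.sin_pos_of_pos_of_lt_pi b1.1 b1.2).ne'
  · rw [← perp_neg_left, ← norm_ne_zero_iff, norm_perp (neg_ne_zero.2 (hne (k + 1))),
      InnerProductGeometry.angle_comm]
    exact mul_ne_zero (norm_ne_zero_iff.2 (hne (k + 2)))
      (Real.sin_pos_of_pos_of_lt_pi b2.1 b2.2).ne'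

end RowParams

/-! ### Rotations about two of the axes of a frame -/

/-- The rotation by `φ` about the second axis. -/
def rotY (φ : ℝ) : Matrix (Fin 3) (Fin 3) ℝ :=
  !![Real.cos φ, 0, Real.sin φ; 0, 1, 0; -Real.sin φ, 0, Real.cos φ]

/-- The rotation by `ψ` about the third axis. -/
def rotZ (ψ : ℝ) : Matrix (Fin 3) (Fin 3) ℝ :=
  !![Real.cos ψ, -Real.sin ψ, 0; Real.sin ψ, Real.cos ψ, 0; 0, 0, 1]

theorem rotY_mem (φ : ℝ) : rotY φ ∈ SO3 := by
  have h := Real.cos_sq_add_sin_sq φ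
  rw [mem_SO3_iff]
  constructor
  · ext i j
    fin_cases i <;> fin_cases j <;> simp [rotY, Matrix.mul_apply, Fin.sum_univ_three] <;>
      first | ring1 | linear_combination h
  · simp [rotY, Matrix.det_fin_three]
    linear_combination h

theorem rotZ_mem (ψ : ℝ) : rotZ ψ ∈ SO3 := by
  have h := Real.cos_sq_add_sin_sq ψ
  rw [mem_SO3_iff]
  constructor
  · ext i j
    fin_cases i <;> fin_cases j <;> simp [rotZ, Matrix.mul_apply, Fin.sum_univ_three] <;>
      first | ring1 | linear_combination h
  · simp [rotZ, Matrix.det_fin_three]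
    linear_combination h

theorem rotY_mul (φ φ' : ℝ) : rotY φ * rotY φ' = rotY (φ + φ') := by
  ext i j
  fin_cases i <;> fin_cases j <;>
    simp [rotY, Matrix.mul_apply, Fin.sum_univ_three, Real.cos_add, Real.sin_add] <;> ring

theorem rotZ_mul (φ φ' : ℝ) : rotZ φ * rotZ φ' = rotZ (φ + φ') := by
  ext i j
  fin_cases i <;> fin_cases j <;>
    simp [rotZ, Matrix.mul_apply, Fin.sum_univ_three, Real.cos_add, Real.sin_add] <;> ring

theorem rotY_zero : rotY 0 = 1 := by
  ext i j
  fin_cases i <;> fin_cases j <;> simp [rotY]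

theorem rotZ_zero : rotZ 0 = 1 := by
  ext i j
  fin_cases i <;> fin_cases j <;> simp [rotZ]

/-- A half-turn about the second axis reverses the third axis, and with it the sense of rotation
about it. -/
theorem rotY_pi_conj (ψ : ℝ) : rotY π * rotZ (-ψ) * rotY (-π) = rotZ ψ := by
  ext i j
  fin_cases i <;> fin_cases j <;>
    simp [rotY, rotZ, Matrix.mul_apply, Fin.sum_univ_three]

theorem cos_eq_tan_half {x : ℝ} (h : Real.cos (x / 2) ≠ 0) :
    Real.cos x = (1 - Real.tan (x / 2) ^ 2) / (1 + Real.tan (x / 2) ^ 2) := by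
  have hp : 1 + Real.tan (x / 2) ^ 2 ≠ 0 := by positivity
  have h1 := Real.cos_sq_add_sin_sq (x / 2)
  have h2 : Real.cos x = 2 * Real.cos (x / 2) ^ 2 - 1 := by
    rw [← Real.cos_two_mul]; ring_nf
  rw [eq_div_iff hp, h2, Real.tan_eq_sin_div_cos]
  field_simp
  linear_combination (2 * Real.cos (x / 2) ^ 2) * h1

theorem sin_eq_tan_half {x : ℝ} (h : Real.cos (x / 2) ≠ 0) :
    Real.sin x = 2 * Real.tan (x / 2) / (1 + Real.tan (x / 2) ^ 2) := by
  have hp : 1 + Real.tan (x / 2) ^ 2 ≠ 0 := by positivity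
  have h1 := Real.cos_sq_add_sin_sq (x / 2)
  have h2 : Real.sin x = 2 * Real.sin (x / 2) * Real.cos (x / 2) := by
    rw [← Real.sin_two_mul]; ring_nf
  rw [eq_div_iff hp, h2, Real.tan_eq_sin_div_cos]
  field_simp
  linear_combination Real.sin (x / 2) * h1

theorem rot_zero_tan {φ : ℝ} (h : Real.cos (φ / 2) ≠ 0) : rot 0 (Real.tan (φ / 2)) = rotY φ := by
  have hp : 1 + Real.tan (φ / 2) ^ 2 ≠ 0 := by positivity
  unfold rot rotY
  rw [cos_eq_tan_half h, sin_eq_tan_half h]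
  ext i j
  fin_cases i <;> fin_cases j <;> simp <;> field_simp

/-- In quaternions `k` anticommutes with `j`, so multiplying `cos (ψ/2) + sin (ψ/2) k` on both sides
by the unit quaternion of `rotY (π / 4)` leaves the `k` term alone and turns the real part into `cos
(ψ/2) (1 + j) / √2`. Division by `cos (ψ/2) / √2` gives `1 + j + √2 tan (ψ/2) k`. -/
theorem rot_sqrt_tan {ψ : ℝ} (h : Real.cos (ψ / 2) ≠ 0) :
    rot (√2 * Real.tan (ψ / 2)) 1 = rotY (π / 4) * rotZ ψ * rotY (π / 4) := by
  have hp : 1 + Real.tan (ψ / 2) ^ 2 ≠ 0 := by positivity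
  have hs : √2 ^ 2 = 2 := Real.sq_sqrt (by norm_num)
  have hd : 1 + (√2 * Real.tan (ψ / 2)) ^ 2 + 1 ^ 2 = 2 * (1 + Real.tan (ψ / 2) ^ 2) := by
    rw [mul_pow, hs]; ring
  unfold rot rotY rotZ
  rw [cos_eq_tan_half h, sin_eq_tan_half h, Real.cos_pi_div_four, Real.sin_pi_div_four, hd]
  ext i j
  fin_cases i <;> fin_cases j <;> simp [Matrix.mul_apply, Fin.sum_univ_three] <;> field_simp <;>
    (try simp only [hs]) <;> ring

theorem rot_neg_sqrt_tan {ψ : ℝ} (h : Real.cos (ψ / 2) ≠ 0) :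
    rot (-(√2 * Real.tan (ψ / 2))) (-1) = rotY (-(π / 4)) * rotZ (-ψ) * rotY (-(π / 4)) := by
  have hp : 1 + Real.tan (ψ / 2) ^ 2 ≠ 0 := by positivity
  have hs : √2 ^ 2 = 2 := Real.sq_sqrt (by norm_num)
  have hd : 1 + (-(√2 * Real.tan (ψ / 2))) ^ 2 + (-1) ^ 2 = 2 * (1 + Real.tan (ψ / 2) ^ 2) := by
    rw [neg_sq, mul_pow, hs]; ring
  unfold rot rotY rotZ
  rw [Real.cos_neg, Real.sin_neg, Real.cos_neg, Real.sin_neg, cos_eq_tan_half h,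
    sin_eq_tan_half h, Real.cos_pi_div_four, Real.sin_pi_div_four, hd]
  ext i j
  fin_cases i <;> fin_cases j <;> simp [Matrix.mul_apply, Fin.sum_univ_three] <;> field_simp <;>
    (try simp only [hs]) <;> ring

/-- Every unit vector is obtained from the first vector of a frame by rotating the frame about its
third and then about its second axis. -/
theorem exists_rotZ_rotY {F : Matrix (Fin 3) (Fin 3) ℝ} (hF : F ∈ SO3) {d : E3} (hd : ‖d‖ = 1) :
    ∃ θ φ : ℝ, |φ| ≤ π ∧ loc (F * (rotZ θ * rotY φ)) ![1, 0, 0] = d := by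
  obtain ⟨v, rfl⟩ := exists_eq_loc hF d
  have hv : v 0 ^ 2 + v 1 ^ 2 + v 2 ^ 2 = 1 := by
    have := inner_loc hF v v
    rw [real_inner_self_eq_norm_sq, hd] at this
    linear_combination -this
  have h1 : -1 ≤ v 2 := by nlinarith [sq_nonneg (v 0), sq_nonneg (v 1)]
  have h2 : v 2 ≤ 1 := by nlinarith [sq_nonneg (v 0), sq_nonneg (v 1)]
  have hn : ‖(⟨v 0, v 1⟩ : ℂ)‖ = √(1 - v 2 ^ 2) := by
    rw [Complex.norm_def, Complex.normSq_apply]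
    congr 1
    linear_combination hv
  -- Longitude and latitude of the vector; a positive rotation about the second axis lowers the
  -- third coordinate, hence the sign.
  refine ⟨Complex.arg ⟨v 0, v 1⟩, -Real.arcsin (v 2), ?_, ?_⟩
  · rw [abs_neg, abs_le]
    have := Real.arcsin_le_pi_div_two (v 2)
    have := Real.neg_pi_div_two_le_arcsin (v 2)
    constructor <;> linarith [Real.pi_pos]
  · rw [loc_mul]
    congr 1
    have e0 := Complex.norm_mul_cos_arg ⟨v 0, v 1⟩
    have e1 := Complex.norm_mul_sin_arg ⟨v 0, v 1⟩
    rw [hn] at e0 e1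
    ext i
    fin_cases i <;> simp [rotZ, rotY, Matrix.mulVec, dotProduct, Fin.sum_univ_three,
      Matrix.mul_apply, Real.cos_arcsin, Real.sin_arcsin h1 h2]
    · linear_combination e0
    · linear_combination e1

/-! ### Polygonal lines made of admissible vertices -/

/-- The state of a polygonal line at a vertex: the number of the target which it is close to, the
direction of the next edge in the plane, the frame of the next edge in the final folded state, and
the position of the vertex in the final folded state. -/
structure LineState where
  target : ℕ
  dir : ℂ
  frame : Matrix (Fin 3) (Fin 3) ℝ
  pos : E3

/-- One more edge, and a flat-foldable vertex at its end. -/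
structure LineStep (c s ε : ℝ) (T : ℕ → E3) (S S' : LineState) : Prop where
  target : S'.target = S.target ∨ S'.target = S.target + 1
  vertex : ∃ P Q l : ℝ, |P| / c < |Q| / s ∧ 0 < l ∧ S'.dir = S.dir * rotc (P / c) ∧
    S'.frame = S.frame * rot P Q ∧ S'.pos = S.pos + l • loc S.frame ![1, 0, 0]
  dir_re : 0 < S'.dir.re
  near : dist S'.pos (T S'.target) < ε

/-- Arbitrarily close to every position near a target, the frame can be rotated by `G`, while the
direction of the row in the plane changes from `z` to `z'`. -/
def CanTurn (c s ε : ℝ) (T : ℕ → E3) (z z' : ℂ) (G : Matrix (Fin 3) (Fin 3) ℝ) : Prop :=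
  ∀ (k : ℕ) (F : Matrix (Fin 3) (Fin 3) ℝ) (x : E3), dist x (T k) < ε →
    ∃ x', dist x' (T k) < ε ∧
      Relation.ReflTransGen (LineStep c s ε T) ⟨k, z, F, x⟩ ⟨k, z', F * G, x'⟩

section
variable {c s ε : ℝ} {T : ℕ → E3}

theorem exists_small_step (x v y : E3) {r : ℝ} (h : dist x y < r) :
    ∃ l : ℝ, 0 < l ∧ dist (x + l • v) y < r := by
  open Filter Topology in
  have hc : Continuous fun l : ℝ => dist (x + l • v) y := by fun_prop
  have h1 : ∀ᶠ l in nhdsWithin (0 : ℝ) (Set.Ioi 0), dist (x + l • v) y < r :=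
    (hc.continuousAt.eventually (gt_mem_nhds (by simpa using h))).filter_mono nhdsWithin_le_nhds
  obtain ⟨l, h2, h3⟩ := (h1.and self_mem_nhdsWithin).exists
  exact ⟨l, h3, h2⟩

theorem CanTurn.trans {z z' z'' : ℂ} {G G' : Matrix (Fin 3) (Fin 3) ℝ}
    (h : CanTurn c s ε T z z' G) (h' : CanTurn c s ε T z' z'' G') :
    CanTurn c s ε T z z'' (G * G') := by
  intro k F x hx
  obtain ⟨x', hx', h1⟩ := h k F x hx
  obtain ⟨x'', hx'', h2⟩ := h' k (F * G) x' hx'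
  exact ⟨x'', hx'', h1.trans (by rwa [mul_assoc] at h2)⟩

theorem canTurn_one (z : ℂ) : CanTurn c s ε T z z 1 := fun k F x hx =>
  ⟨x, hx, by rw [mul_one]⟩

theorem canTurn_rot {z : ℂ} {P Q : ℝ} (h : |P| / c < |Q| / s)
    (hz : 0 < (z * rotc (P / c)).re) : CanTurn c s ε T z (z * rotc (P / c)) (rot P Q) := by
  intro k F x hx
  obtain ⟨l, hl, hl'⟩ := exists_small_step x (loc F ![1, 0, 0]) (T k) hx
  exact ⟨_, hl', .single ⟨.inl rfl, ⟨P, Q, l, h, hl, rfl, rfl, rfl⟩, hz, hl'⟩⟩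

/-- Vertices with `P = 0` do not turn the planar row. They need `Q ≠ 0`, so the trivial rotation is
realized by no vertex at all. -/
theorem canTurn_rotY (hs : 0 < s) {z : ℂ} (hz : 0 < z.re) {φ : ℝ} (hφ : |φ| ≤ π) :
    CanTurn c s ε T z z (rotY φ) := by
  have h1 : ∀ φ : ℝ, φ ≠ 0 → |φ| ≤ π / 2 → CanTurn c s ε T z z (rotY φ) := by
    intro φ h0 hφ
    have hp := Real.pi_pos
    rw [abs_le] at hφ
    have hc : 0 < Real.cos (φ / 2) :=
      Real.cos_pos_of_mem_Ioo ⟨by linarith, by linarith⟩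
    have hsin : Real.sin (φ / 2) ≠ 0 := by
      rw [Ne, Real.sin_eq_zero_iff_of_lt_of_lt (by linarith) (by linarith)]
      intro h; exact h0 (by linarith)
    have ht : Real.tan (φ / 2) ≠ 0 := by
      rw [Real.tan_eq_sin_div_cos]; exact div_ne_zero hsin hc.ne'
    have := canTurn_rot (c := c) (s := s) (ε := ε) (T := T) (z := z) (P := 0)
      (Q := Real.tan (φ / 2)) (by simpa using div_pos (abs_pos.2 ht) hs)
      (by simpa [rotc_zero] using hz)
    simpa [rotc_zero, rot_zero_tan hc.ne'] using this
  by_cases h0 : φ = 0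
  · subst h0
    rw [rotY_zero]
    exact canTurn_one z
  · have h2 := h1 (φ / 2) (by simpa using h0) (by rw [abs_div, abs_two]; linarith)
    have := h2.trans h2
    rwa [rotY_mul, add_halves] at this

/-- A vertex `(P, 1)` and later its opposite `(-P, -1)` turn the planar row forth and back, while
each contributes a rotation by `ψ / 2` about the third axis. The angle must be small for `|P| < c`,
which makes both vertices admissible and keeps the intermediate planar direction pointing to the
right. -/
theorem exists_canTurn_rotZ (hs : 0 < s) (hs1 : s < 1) (hc : 0 < c) :
    ∃ r > 0, ∀ ψ : ℝ, |ψ| < r → CanTurn c s ε T 1 1 (rotZ ψ) := by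
  have hcont : ContinuousAt (fun ψ : ℝ => √2 * Real.tan (ψ / 2 / 2)) 0 := by
    refine continuousAt_const.mul ?_
    have : ContinuousAt Real.tan ((0 : ℝ) / 2 / 2) :=
      Real.continuousAt_tan.2 (by simp)
    exact ContinuousAt.comp (f := fun ψ : ℝ => ψ / 2 / 2) (x := (0 : ℝ)) this (by fun_prop)
  have hcos : ContinuousAt (fun ψ : ℝ => Real.cos (ψ / 2 / 2)) 0 := by fun_prop
  have e1 := Metric.eventually_nhds_iff.1 (hcont.eventually
    (Metric.ball_mem_nhds _ hc))
  have e2 := Metric.eventually_nhds_iff.1 (hcos.eventually_ne (y := 0) (by simp))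
  obtain ⟨r1, hr1, e1⟩ := e1
  obtain ⟨r2, hr2, e2⟩ := e2
  refine ⟨min r1 r2, lt_min hr1 hr2, fun ψ hψ => ?_⟩
  have hP := e1 (show dist ψ 0 < r1 by simpa using hψ.trans_le (min_le_left _ _))
  have hC := e2 (show dist ψ 0 < r2 by simpa using hψ.trans_le (min_le_right _ _))
  set P := √2 * Real.tan (ψ / 2 / 2) with hPdef
  have hP : |P| < c := by simpa using hP
  have hPc : |P| / c < 1 := (div_lt_one hc).2 hP
  have hPs : |P| / c < 1 / s := hPc.trans (by rwa [lt_div_iff₀ hs, one_mul])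
  have hre : 0 < (rotc (P / c)).re := by
    rw [rotc_re]
    have h1 : |P / c| < 1 := by rwa [abs_div, abs_of_pos hc]
    have h2 : (P / c) ^ 2 < 1 := by rwa [sq_lt_one_iff_abs_lt_one]
    exact div_pos (by linarith) (by positivity)
  have hq := abs_of_pos Real.pi_pos
  have hY : ∀ z : ℂ, 0 < z.re → ∀ φ : ℝ, |φ| ≤ π → CanTurn c s ε T z z (rotY φ) :=
    fun z hz φ hφ => canTurn_rotY hs hz hφ
  have q1 : |π / 4| ≤ π := by rw [abs_div, hq]; norm_num; linarith [Real.pi_pos]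
  have q2 : |-(π / 4)| ≤ π := by rwa [abs_neg]
  have hup := canTurn_rot (c := c) (s := s) (ε := ε) (T := T) (z := 1) (P := P) (Q := 1)
    (by simpa using hPs) (by simpa using hre)
  rw [one_mul, hPdef, rot_sqrt_tan hC, ← hPdef] at hup
  have hdown := canTurn_rot (c := c) (s := s) (ε := ε) (T := T) (z := rotc (P / c)) (P := -P)
    (Q := -1) (by simpa using hPs) (by rw [neg_div, rotc_mul_neg]; simp)
  rw [neg_div, rotc_mul_neg, hPdef, rot_neg_sqrt_tan hC, ← hPdef] at hdown
  -- The rotations by `π / 4` cancel those on both sides of each of the two vertices; the half-turns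
  -- around the second one reverse its sense.
  have hZ := (((((((hY 1 (by simp) _ q2).trans hup).trans (hY _ hre _ q2)).trans
    (hY _ hre π hq.le)).trans (hY _ hre _ q1)).trans hdown).trans (hY 1 (by simp) _ q1)).trans
      (hY 1 (by simp) (-π) (by rw [abs_neg, hq]))
  have key : rotY (-(π / 4)) * (rotY (π / 4) * rotZ (ψ / 2) * rotY (π / 4)) * rotY (-(π / 4)) *
      rotY π * rotY (π / 4) * (rotY (-(π / 4)) * rotZ (-(ψ / 2)) * rotY (-(π / 4))) *
      rotY (π / 4) * rotY (-π) = rotZ ψ := by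
    have i1 : ∀ M, rotY (-(π / 4)) * (rotY (π / 4) * M) = M := fun M => by
      rw [← mul_assoc, rotY_mul, neg_add_cancel, rotY_zero, one_mul]
    have i2 : ∀ M, rotY (π / 4) * (rotY (-(π / 4)) * M) = M := fun M => by
      rw [← mul_assoc, rotY_mul, add_neg_cancel, rotY_zero, one_mul]
    have i3 := rotY_pi_conj (ψ / 2)
    simp only [mul_assoc] at i3 ⊢
    rw [i1, i2, i2, i1, i3, rotZ_mul, add_halves]
  rwa [key] at hZ

/-- The rotation is divided into equal parts small enough for the preceding construction. -/
theorem canTurn_rotZ (hs : 0 < s) (hs1 : s < 1) (hc : 0 < c) (ψ : ℝ) :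
    CanTurn c s ε T 1 1 (rotZ ψ) := by
  obtain ⟨r, hr, h⟩ := exists_canTurn_rotZ (ε := ε) (T := T) hs hs1 hc
  obtain ⟨N, hN⟩ := exists_nat_gt (|ψ| / r)
  have hN0 : (0 : ℝ) < N := (div_nonneg (abs_nonneg _) hr.le).trans_lt hN
  have h1 := h (ψ / N) (by
    rw [abs_div, abs_of_pos hN0, div_lt_iff₀ hN0]
    rwa [div_lt_iff₀ hr, mul_comm] at hN)
  have h2 : ∀ j : ℕ, CanTurn c s ε T 1 1 (rotZ (j * (ψ / N))) := by
    intro j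
    induction j with
    | zero => simpa [rotZ_zero] using canTurn_one 1
    | succ j ih =>
      have := ih.trans h1
      rw [rotZ_mul] at this
      convert this using 2
      push_cast; ring
  have := h2 N
  rwa [mul_div_cancel₀ _ hN0.ne'] at this

/-- Near each target the frame is first turned towards the next target by short edges. One edge as
long as the distance of the targets then carries the error over unchanged, so errors do not
accumulate. -/
theorem exists_reach (hs : 0 < s) (hs1 : s < 1) (hc : 0 < c) (hε : 0 < ε) (k : ℕ) :
    ∃ (F : Matrix (Fin 3) (Fin 3) ℝ) (x : E3), F ∈ SO3 ∧ dist x (T k) < ε ∧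
      Relation.ReflTransGen (LineStep c s ε T) ⟨0, 1, 1, T 0⟩ ⟨k, 1, F, x⟩ := by
  induction k with
  | zero => exact ⟨1, T 0, SO3.one_mem, by simpa using hε, .refl⟩
  | succ k ih =>
    obtain ⟨F, x, hF, hx, hreach⟩ := ih
    by_cases hT : T (k + 1) = T k
    -- Coinciding targets give no direction to turn to; one short edge advances the counter. The
    -- vertex `(0, 1)` at its end is an arbitrary admissible one.
    · obtain ⟨l, hl, hl'⟩ := exists_small_step x (loc F ![1, 0, 0]) (T (k + 1)) (by rwa [hT])
      refine ⟨F * rot 0 1, x + l • loc F ![1, 0, 0], SO3.mul_mem hF (rot_mem _ _), hl',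
        hreach.tail ⟨.inr rfl, ⟨0, 1, l, by simpa using hs, hl, by simp [rotc_zero], rfl, rfl⟩,
          by simp, hl'⟩⟩
    · have hn : 0 < ‖T (k + 1) - T k‖ := norm_pos_iff.2 (sub_ne_zero.2 hT)
      obtain ⟨θ, φ, hφ, hd⟩ := exists_rotZ_rotY hF
        (d := ‖T (k + 1) - T k‖⁻¹ • (T (k + 1) - T k)) (by
          rw [norm_smul, norm_inv, norm_norm, inv_mul_cancel₀ hn.ne'])
      obtain ⟨x', hx', hturn⟩ :=
        ((canTurn_rotZ hs hs1 hc θ).trans (canTurn_rotY (z := 1) hs (by simp) hφ)) k F x hx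
      have hG : F * (rotZ θ * rotY φ) ∈ SO3 :=
        SO3.mul_mem hF (SO3.mul_mem (rotZ_mem _) (rotY_mem _))
      have hstep : x' + ‖T (k + 1) - T k‖ • loc (F * (rotZ θ * rotY φ)) ![1, 0, 0] =
          T (k + 1) + (x' - T k) := by
        rw [hd, smul_smul, mul_inv_cancel₀ hn.ne', one_smul]; abel
      have hnear : dist (x' + ‖T (k + 1) - T k‖ • loc (F * (rotZ θ * rotY φ)) ![1, 0, 0])
          (T (k + 1)) < ε := by
        rw [hstep, dist_eq_norm, add_sub_cancel_left, ← dist_eq_norm]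
        exact hx'
      exact ⟨F * (rotZ θ * rotY φ) * rot 0 1, _, SO3.mul_mem hG (rot_mem _ _), hnear,
        (hreach.trans hturn).tail ⟨.inr rfl, ⟨0, 1, ‖T (k + 1) - T k‖, by simpa using hs, hn,
          by simp [rotc_zero], rfl, rfl⟩, by simp, hnear⟩⟩

end

/-! ### Partitions that follow a bounded curve -/

theorem norm_le_of_coords {x : E3} {M : Fin 3 → ℝ} (h : ∀ k, |x k| ≤ M k) :
    ‖x‖ ≤ √(∑ k, M k ^ 2) := by
  rw [EuclideanSpace.norm_eq]
  refine Real.sqrt_le_sqrt (Finset.sum_le_sum fun k _ => ?_)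
  rw [Real.norm_eq_abs]
  exact pow_le_pow_left₀ (abs_nonneg _) (h k) 2

theorem DarbouxIntegrableCurve.isBounded {Γ : ℝ → E3} {a b : ℝ}
    (h : DarbouxIntegrableCurve Γ a b) : Bornology.IsBounded (Γ '' Set.Icc a b) := by
  have h1 : ∀ k, ∃ M, ∀ t ∈ Set.Icc a b, |Γ t k| ≤ M := by
    intro k
    obtain ⟨⟨B, hB⟩, ⟨L, hL⟩, -⟩ := h k
    refine ⟨max B (-L), fun t ht => abs_le.2 ⟨?_, ?_⟩⟩
    · have := hL ⟨t, ht, rfl⟩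
      have h2 := le_max_right B (-L)
      simp only at this
      linarith
    · exact (hB ⟨t, ht, rfl⟩).trans (le_max_left _ _)
  choose M hM using h1
  rw [isBounded_iff_forall_norm_le]
  refine ⟨√(∑ k, M k ^ 2), ?_⟩
  rintro _ ⟨t, ht, rfl⟩
  exact norm_le_of_coords fun k => hM k t ht

/-- The elements of a finite set in increasing order, up to the greatest element. -/
theorem exists_enumeration {S : Finset ℝ} {a b : ℝ} (ha : a ∈ S) (hb : b ∈ S)
    (hS : ∀ t ∈ S, a ≤ t ∧ t ≤ b) : ∃ (K : ℕ) (v : ℕ → ℝ), Monotone v ∧ v 0 = a ∧ v K = b ∧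
      (∀ k, v k ∈ S) ∧ ∀ t ∈ S, ∃ k ≤ K, v k = t := by
  have hcard : 0 < S.card := Finset.card_pos.2 ⟨a, ha⟩
  have hlast : ∀ i : Fin S.card, S.orderEmbOfFin rfl i ∈ S := S.orderEmbOfFin_mem rfl
  refine ⟨S.card - 1, fun k => S.orderEmbOfFin rfl ⟨min k (S.card - 1), by omega⟩, ?_, ?_, ?_,
    fun k => hlast _, ?_⟩
  · intro i j hij
    refine (S.orderEmbOfFin rfl).monotone ?_
    simp only [Fin.mk_le_mk]
    omega
  · have := Finset.orderEmbOfFin_zero (s := S) rfl hcard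
    simp only [Nat.zero_min]
    rw [this]
    exact le_antisymm (S.min'_le a ha) ((hS _ (S.min'_mem _)).1)
  · have := Finset.orderEmbOfFin_last (s := S) rfl hcard
    simp only [min_self]
    rw [this]
    exact le_antisymm ((hS _ (S.max'_mem _)).2) (S.le_max' b hb)
  · intro t ht
    have : t ∈ Set.range (S.orderEmbOfFin rfl) := by
      rw [Finset.range_orderEmbOfFin]; exact ht
    obtain ⟨i, hi⟩ := this
    refine ⟨i, by omega, ?_⟩
    rw [← hi]
    exact congrArg _ (Fin.ext (min_eq_left (by omega)))

/-- The graph of a bounded curve is totally bounded. A finite net of it controls parameters and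
values at once, without any continuity; its parameters, sorted and completed by `a` and `b`, form
the partition. -/
theorem exists_partition {Γ : ℝ → E3} {a b : ℝ} (hab : a < b)
    (hΓ : Bornology.IsBounded (Γ '' Set.Icc a b)) {ε : ℝ} (hε : 0 < ε) :
    ∃ (K : ℕ) (v : ℕ → ℝ), Monotone v ∧ v 0 = a ∧ v K = b ∧ (∀ k, v k ∈ Set.Icc a b) ∧
      (∀ k, v (k + 1) - v k ≤ 2 * ε) ∧
      ∀ t ∈ Set.Icc a b, ∃ k ≤ K, dist (Γ t) (Γ (v k)) < ε := by
  have hG : TotallyBounded ((fun t => (t, Γ t)) '' Set.Icc a b) := by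
    have hbd : Bornology.IsBounded ((fun t => (t, Γ t)) '' Set.Icc a b) := by
      refine ((Metric.isBounded_Icc a b).prod hΓ).subset ?_
      rintro _ ⟨t, ht, rfl⟩
      exact ⟨ht, t, ht, rfl⟩
    exact hbd.isCompact_closure.totallyBounded.subset subset_closure
  obtain ⟨Y, hY, hfin, hcov⟩ := Metric.finite_approx_of_totallyBounded hG ε hε
  classical
  let S : Finset ℝ := insert a (insert b (hfin.toFinset.image Prod.fst))
  have hSI : ∀ t ∈ S, a ≤ t ∧ t ≤ b := by
    intro t ht
    simp only [S, Finset.mem_insert, Finset.mem_image, Set.Finite.mem_toFinset] at ht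
    rcases ht with rfl | rfl | ⟨y, hy, rfl⟩
    · exact ⟨le_rfl, hab.le⟩
    · exact ⟨hab.le, le_rfl⟩
    · obtain ⟨s, hs, rfl⟩ := hY hy
      exact hs
  obtain ⟨K, v, hmono, h0, hK, hmem, hsurj⟩ := exists_enumeration (S := S) (a := a) (b := b)
    (by simp [S]) (by simp [S]) hSI
  have hclose : ∀ t ∈ Set.Icc a b, ∃ k ≤ K, dist t (v k) < ε ∧ dist (Γ t) (Γ (v k)) < ε := by
    intro t ht
    have h1 := hcov ⟨t, ht, rfl⟩
    simp only [Set.mem_iUnion, Metric.mem_ball] at h1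
    obtain ⟨y, hy, hd⟩ := h1
    obtain ⟨s, hs, rfl⟩ := hY hy
    obtain ⟨k, hk, rfl⟩ := hsurj s (by
      simp only [S, Finset.mem_insert, Finset.mem_image, Set.Finite.mem_toFinset]
      exact .inr (.inr ⟨_, hy, rfl⟩))
    rw [Prod.dist_eq, max_lt_iff] at hd
    exact ⟨k, hk, hd.1, hd.2⟩
  refine ⟨K, v, hmono, h0, hK, fun k => hSI _ (hmem k), fun k => ?_, fun t ht => ?_⟩
  · have i1 := hSI _ (hmem k)
    have i2 := hSI _ (hmem (k + 1))
    -- Some partition point is within `ε` of the midpoint of two consecutive ones, while none lies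
    -- strictly between them; so half their distance is less than `ε`.
    obtain ⟨l, -, hl, -⟩ := hclose ((v k + v (k + 1)) / 2)
      ⟨by linarith, by linarith⟩
    rw [Real.dist_eq, abs_lt] at hl
    rcases Nat.lt_or_ge k l with h | h
    · have := hmono (show k + 1 ≤ l from h)
      linarith
    · have := hmono h
      linarith
  · obtain ⟨k, hk, -, h⟩ := hclose t ht
    exact ⟨k, hk, h⟩

/-! ### Sequences of steps -/

theorem exists_seq_of_reflTransGen {X : Type*} {r : X → X → Prop} {x y : X}
    (h : Relation.ReflTransGen r x y) :
    ∃ (N : ℕ) (f : ℕ → X), f 0 = x ∧ f N = y ∧ ∀ i < N, r (f i) (f (i + 1)) := by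
  induction h with
  | refl => exact ⟨0, fun _ => x, rfl, rfl, fun i hi => absurd hi (Nat.not_lt_zero i)⟩
  | @tail y z _ hyz ih =>
    obtain ⟨N, f, h0, hN, hf⟩ := ih
    refine ⟨N + 1, fun i => if i ≤ N then f i else z, by simp [h0], by simp, fun i hi => ?_⟩
    rcases Nat.lt_succ_iff_lt_or_eq.1 hi with h | rfl
    · simpa [h.le, Nat.succ_le_of_lt h] using hf i h
    · simpa [hN] using hyz

/-- A discrete intermediate value theorem; it shows that the line visits every target. -/
theorem exists_index_eq {g : ℕ → ℕ} {N : ℕ} (h0 : g 0 = 0)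
    (h : ∀ i < N, g (i + 1) = g i ∨ g (i + 1) = g i + 1) (k : ℕ) (hk : k ≤ g N) :
    ∃ i ≤ N, g i = k := by
  induction N with
  | zero => exact ⟨0, le_rfl, by omega⟩
  | succ N ih =>
    by_cases hk' : k ≤ g N
    · obtain ⟨i, hi, e⟩ := ih (fun i hi => h i (by omega)) hk'
      exact ⟨i, by omega, e⟩
    · have := h N (by omega)
      exact ⟨N + 1, le_rfl, by omega⟩

namespace RowParams

/-- The parameters of a row with prescribed steps in the final folded state. -/
theorem exists_of_steps {τ ε : ℝ} (hτ : 0 < τ) (hτ' : τ < π / 2) (hε : 0 < ε) {T : ℕ → E3} {N : ℕ}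
    {f : ℕ → LineState} (h0 : f 0 = ⟨0, 1, 1, T 0⟩)
    (hf : ∀ i < N, LineStep (Real.cos τ) (Real.sin τ) ε T (f i) (f (i + 1))) :
    ∃ R : RowParams, R.Valid ∧ R.τ = τ ∧ R.len₀ = ε ∧ R.len N = ε ∧
      ∀ k ≤ N, points (T 0) (R.edge3 (Real.cos τ) (Real.sin τ)) (k + 1) = (f k).pos := by
  have hc : 0 < Real.cos τ := Real.cos_pos_of_mem_Ioo ⟨by linarith [Real.pi_pos], hτ'⟩
  have hs : 0 < Real.sin τ := Real.sin_pos_of_pos_of_lt_pi hτ (by linarith [Real.pi_pos])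
  have hv : ∀ i, ∃ P Q l : ℝ, |P| / Real.cos τ < |Q| / Real.sin τ ∧ 0 < l ∧
      (i < N → (f (i + 1)).dir = (f i).dir * rotc (P / Real.cos τ) ∧
        (f (i + 1)).frame = (f i).frame * rot P Q ∧
        (f (i + 1)).pos = (f i).pos + l • loc (f i).frame ![1, 0, 0]) ∧
      (N ≤ i → P = 0 ∧ l = ε) := by
    intro i
    by_cases hi : i < N
    · obtain ⟨P, Q, l, h1, h2, h3, h4, h5⟩ := (hf i hi).vertex
      exact ⟨P, Q, l, h1, h2, fun _ => ⟨h3, h4, h5⟩, fun h => absurd hi (by omega)⟩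
    -- Past the prescribed steps the row goes straight on in the plane, with edges of length `ε`.
    -- The first of these is the edge beyond the last inner vertex.
    · exact ⟨0, 1, ε, by simpa using hs, hε, fun h => absurd h hi, fun _ => ⟨rfl, rfl⟩⟩
  choose P Q l hPQ hl hstep hdef using hv
  -- The factor `(-1) ^ k` cancels the alternating sign of the folding angle, so that the final
  -- frames rotate by the prescribed `P` and `Q`; the condition on `|q|` is not affected.
  let R : RowParams := ⟨fun k => P k / Real.cos τ, fun k => (-1) ^ k * (Q k / Real.sin τ), l, ε, τ⟩
  have hdir : ∀ k ≤ N, R.dir k = (f k).dir := by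
    intro k hk
    induction k with
    | zero => simp [dir, h0]
    | succ k ih => rw [dir, ih (by omega), (hstep k (by omega)).1]
  have hframe : ∀ k ≤ N, R.frame (Real.cos τ) (Real.sin τ) k = (f k).frame := by
    intro k hk
    induction k with
    | zero => simp [frame, h0]
    | succ k ih =>
      rw [frame, ih (by omega), (hstep k (by omega)).2.1]
      have e1 : R.p k * Real.cos τ = P k := div_mul_cancel₀ _ hc.ne'
      have e2 : R.q k * alt (Real.sin τ) k = Q k := by
        have h1 : ((-1 : ℝ) ^ k) * (-1) ^ k = 1 := by rw [← mul_pow]; simp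
        change (-1) ^ k * (Q k / Real.sin τ) * ((-1) ^ k * Real.sin τ) = Q k
        rw [mul_mul_mul_comm, h1, one_mul, div_mul_cancel₀ _ hs.ne']
      rw [e1, e2]
  have hdir_re : ∀ k ≤ N, 0 < (R.dir k).re := by
    intro k hk
    rw [hdir k hk]
    cases k with
    | zero => simp [h0]
    | succ k => exact (hf k (by omega)).dir_re
  refine ⟨R, ⟨fun k => ?_, hl, hε, hτ, hτ', fun k => ?_⟩, rfl, rfl, (hdef N le_rfl).2,
    fun k hk => ?_⟩
  · change |P k / Real.cos τ| < |(-1) ^ k * (Q k / Real.sin τ)|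
    rw [abs_mul, abs_pow, abs_neg, abs_one, one_pow, one_mul, abs_div, abs_div, abs_of_pos hc,
      abs_of_pos hs]
    exact hPQ k
  · by_cases hk : k ≤ N
    · exact hdir_re k hk
    · obtain ⟨j, rfl⟩ : ∃ j, k = N + j := ⟨k - N, by omega⟩
      have : R.dir (N + j) = R.dir N := by
        clear hk
        induction j with
        | zero => rfl
        | succ j ih =>
          have hp : R.p (N + j) = 0 := by
            change P (N + j) / _ = 0
            rw [(hdef (N + j) (by omega)).1, zero_div]
          rw [← Nat.add_assoc, dir, hp, rotc_zero, mul_one, ih]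
      rw [this]
      exact hdir_re N le_rfl
  · induction k with
    | zero => simp [points, h0]
    | succ k ih =>
      rw [points_succ, ih (by omega), (hstep k (by omega)).2.2, edge3, hframe k (by omega)]

end RowParams

/-! ### Rows that follow a curve -/

theorem RowParams.norm_edge3_zero {R : RowParams} (h : R.Valid) (s : ℝ) :
    ‖R.edge3 (Real.cos R.τ) s 0‖ = R.len₀ := by
  rw [← sq_eq_sq₀ (norm_nonneg _) h.len₀_pos.le, ← real_inner_self_eq_norm_sq, edge3,
    real_inner_smul_left, real_inner_smul_right, inner_loc SO3.one_mem, div_self h.cos_pos.ne']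
  simp
  ring

theorem RowParams.norm_edge3_succ {R : RowParams} (h : R.Valid) (c s : ℝ) (k : ℕ) :
    ‖R.edge3 c s (k + 1)‖ = R.len k := by
  rw [← sq_eq_sq₀ (norm_nonneg _) (h.len_pos k).le, ← real_inner_self_eq_norm_sq, edge3,
    real_inner_smul_left, real_inner_smul_right, inner_loc (frame_mem c s k)]
  simp
  ring

/-- A row, the final folded state of which follows a given bounded curve. -/
theorem exists_row_near {Γ : ℝ → E3} {a b : ℝ} (hab : a < b)
    (hΓ : Bornology.IsBounded (Γ '' Set.Icc a b)) {ε τ : ℝ} (hε : 0 < ε) (hτ : 0 < τ)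
    (hτ' : τ < π / 2) :
    ∃ (N : ℕ) (R : RowParams) (A : ℕ → E3), R.Valid ∧ R.τ = τ ∧
      A = RowParams.points (Γ a) (R.edge3 (Real.cos R.τ) (Real.sin R.τ)) ∧
      Metric.hausdorffEDist (A '' Set.Icc 1 (N + 1)) (Γ '' Set.Icc a b) ≤ ENNReal.ofReal ε ∧
      ∃ u : ℕ → ℝ, Monotone u ∧ u 0 = a ∧ u (N + 2) = b ∧ (∀ i, u (i + 1) - u i ≤ ε) ∧
        ∀ i ≤ N + 2, dist (A i) (Γ (u i)) ≤ ε := by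
  obtain ⟨K, v, hmono, hv0, hvK, hvmem, hmesh, hnet⟩ := exists_partition hab hΓ (half_pos hε)
  have hc : 0 < Real.cos τ := Real.cos_pos_of_mem_Ioo ⟨by linarith [Real.pi_pos], hτ'⟩
  have hs : 0 < Real.sin τ := Real.sin_pos_of_pos_of_lt_pi hτ (by linarith [Real.pi_pos])
  have hs1 : Real.sin τ < 1 := by nlinarith [Real.cos_sq_add_sin_sq τ]
  obtain ⟨F, x, -, -, hreach⟩ :=
    exists_reach (T := fun k => Γ (v k)) hs hs1 hc (half_pos hε) K
  obtain ⟨N, f, hf0, hfN, hf⟩ := exists_seq_of_reflTransGen hreach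
  obtain ⟨R, hR, hRτ, hlen₀, hlenN, hpos⟩ :=
    RowParams.exists_of_steps hτ hτ' (half_pos hε) hf0 hf
  rw [← hRτ, hv0] at hpos
  have hnear : ∀ i ≤ N, dist (f i).pos (Γ (v (f i).target)) < ε / 2 := by
    intro i hi
    cases i with
    | zero => simpa [hf0] using half_pos hε
    | succ i => exact (hf i hi).near
  obtain ⟨A, hA⟩ : ∃ A, A = RowParams.points (Γ a) (R.edge3 (Real.cos R.τ) (Real.sin R.τ)) :=
    ⟨_, rfl⟩
  rw [← hA] at hpos
  have hA0 : dist (A 0) (Γ a) = ε / 2 := by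
    rw [hA, RowParams.points, dist_eq_norm, sub_sub_cancel_left, norm_neg,
      RowParams.norm_edge3_zero hR, hlen₀]
  have hAN : dist (A (N + 2)) (A (N + 1)) = ε / 2 := by
    rw [hA, RowParams.points_succ _ _ (N + 1), dist_eq_norm, add_sub_cancel_left,
      RowParams.norm_edge3_succ hR, hlenN]
  refine ⟨N, R, A, hR, hRτ, hA, ?_, ?_⟩
  · refine Metric.hausdorffEDist_le_of_mem_edist ?_ ?_
    · rintro _ ⟨i, ⟨hi, hi'⟩, rfl⟩
      obtain ⟨i, rfl⟩ : ∃ l, i = l + 1 := ⟨i - 1, by omega⟩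
      refine ⟨_, ⟨_, hvmem (f i).target, rfl⟩, ?_⟩
      rw [hpos i (by omega), edist_dist]
      exact ENNReal.ofReal_le_ofReal (by linarith [hnear i (by omega)])
    · rintro _ ⟨t, ht, rfl⟩
      obtain ⟨k, hk, hd⟩ := hnet t ht
      obtain ⟨i, hi, rfl⟩ := exists_index_eq (g := fun i => (f i).target) (N := N) (by rw [hf0])
        (fun i hi => (hf i hi).target) k (by rw [hfN]; exact hk)
      refine ⟨A (i + 1), ⟨i + 1, ⟨by omega, by omega⟩, rfl⟩, ?_⟩
      rw [hpos i hi, edist_dist]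
      refine ENNReal.ofReal_le_ofReal ((dist_triangle_right _ _ (Γ (v (f i).target))).trans ?_)
      linarith [hnear i hi]
  -- The index `i + 1` belongs to the state `i`. The two outer vertices, at distance `ε / 2` from
  -- the first and the last inner vertex, share the targets of these.
  · obtain ⟨g, hg0, hg⟩ : ∃ g : ℕ → ℕ, g 0 = 0 ∧ ∀ i, g (i + 1) = (f (min i N)).target :=
      ⟨fun i => i.casesOn 0 fun i => (f (min i N)).target, rfl, fun i => rfl⟩
    have hstep : ∀ i, g (i + 1) = g i ∨ g (i + 1) = g i + 1 := by
      rintro (_ | i)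
      · left; rw [hg, hg0, Nat.zero_min, hf0]
      · rw [hg, hg]
        rcases Nat.lt_or_ge i N with h | h
        · rw [min_eq_left (by omega), min_eq_left h.le]
          exact (hf i h).target
        · left; rw [min_eq_right (by omega), min_eq_right h]
    have hgm : Monotone g := monotone_nat_of_le_succ fun i => by have := hstep i; omega
    refine ⟨fun i => v (g i), hmono.comp hgm, by simp only [hg0, hv0],
      by simp only [hg, min_eq_right (Nat.le_succ N), hfN, hvK], fun i => ?_, ?_⟩
    · simp only
      rcases hstep i with h | h <;> rw [h]
      · rw [sub_self]; exact hε.le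
      · exact (hmesh _).trans (by linarith)
    · rintro (_ | i) hi
      · simp only [hg0, hv0, hA0]
        linarith
      · rcases Nat.lt_or_ge N i with h | h
        · obtain rfl : i = N + 1 := by omega
          have h1 := hnear N le_rfl
          rw [← hpos N le_rfl] at h1
          simp only [hg, min_eq_right (Nat.le_succ N)]
          exact (dist_triangle _ (A (N + 1)) _).trans (by linarith)
        · simp only [hg, min_eq_left h, hpos i h]
          linarith [hnear i h]

end

theorem mainTheorem4 (Γ : ℝ → E3) (a b : ℝ) (hab : a < b) (hΓ : DarbouxIntegrableCurve Γ a b)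
    (ε : ℝ) (hε : 0 < ε) (ρ₄ : ℝ) (hρ₄ : 0 < ρ₄) (hρ₄' : ρ₄ < Real.pi) (m : ℕ) (hm : 1 ≤ m) :
    ∃ (n : ℕ) (V : ℕ × ℕ → E2) (α : ℕ → Fin 4 → ℝ) (W : ℝ → ℕ × ℕ → E3) (A : ℕ → E3),
      1 ≤ n ∧
      -- a creased paper of the parallel repeating type and a folding motion to its final state
      IsParallelRepeating m n V α ∧
      IsFoldingMotion m n V W ∧
      -- `A` is the polygonal line formed by the first row in the final state
      (∀ i, A i = W 1 (1, i)) ∧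
      -- its inner vertices are close to the curve in the Hausdorff distance
      Metric.hausdorffEDist (A '' Set.Icc 1 n) (Γ '' Set.Icc a b) ≤ ENNReal.ofReal ε ∧
      -- the polygonal line follows a partition of the curve
      (∃ u : ℕ → ℝ, Monotone u ∧ u 0 = a ∧ u (n + 1) = b ∧
        (∀ i ≤ n, u (i + 1) - u i ≤ ε) ∧ ∀ i ≤ n + 1, dist (A i) (Γ (u i)) ≤ ε) ∧
      -- the panels clash on the left of the first column; the other folding angles on the rows
      (∀ j, 1 ≤ j → j ≤ m → rowFold (W 1) j 0 = Real.pi) ∧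
      (∀ j i, 1 ≤ j → j ≤ m → 1 ≤ i → i ≤ n → rowFold (W 1) j i = ρ₄) ∧
      -- the kinds of the columns
      StraightLine (α 1) ∧
      (∀ i, 2 ≤ i → i ≤ n → FlatFoldable (α i)) ∧
      -- the equations between the sector angles and the angles of the polygonal line
      (∀ i, 1 ≤ i → i ≤ n → 0 < turnAngle A i ∧ turnAngle A i < Real.pi) ∧
      FirstEquations (α 1) (turnAngle A 1) Real.pi ρ₄ ∧
      (∀ i, 1 ≤ i → i + 1 ≤ n →
        GeneralEquations (α i) (α (i + 1)) (turnAngle A i) (turnAngle A (i + 1))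
          (torsionAngle A i)) := by
  -- The final half folding angle is `τ = ρ₄ / 2`. A line of `N` steps has `N + 1` inner vertices,
  -- so there are `N + 1` columns.
  obtain ⟨N, R, A, hR, hRτ, hA, hH, u, hu, hu0, hu1, hmesh, hnear⟩ :=
    exists_row_near hab hΓ.isBounded hε (half_pos hρ₄) (by linarith)
  have hρ : 2 * R.τ = ρ₄ := by linarith
  obtain ⟨δ, ht⟩ := exists_isThin m (N + 1) hR.isPlanarRow
  have hcol : ∀ i, 1 ≤ i → ∃ k, i = k + 1 := fun i hi => ⟨i - 1, by omega⟩
  refine ⟨N + 1, grid δ (RowParams.points 0 R.edge) R.upper R.lower,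
    rowSector R.edge R.upper R.lower, R.motion δ (Γ a), A, by omega,
    hR.isPlanarRow.isParallelRepeating ht ?_ ?_, hR.isFoldingMotion hm ht _, ?_, hH,
    ⟨u, hu, hu0, hu1, fun i _ => hmesh i, hnear⟩,
    fun j hj hj' => hR.motion_rowFold_zero ht _ hj hj', ?_, hR.straightLine, ?_, ?_, ?_, ?_⟩
  · intro i hi _
    obtain ⟨k, rfl⟩ := hcol i hi
    exact hR.sum_sector k
  · intro i hi _
    obtain ⟨k, rfl⟩ := hcol i hi
    exact hR.not_cross k
  · intro i
    rw [hA, RowParams.motion, grid_one, one_mul]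
  · intro j i hj hj' hi hi'
    obtain ⟨k, rfl⟩ := hcol i hi
    rw [hR.motion_rowFold_succ ht _ zero_le_one le_rfl hj hj' hi', one_mul, hρ]
  · intro i hi _
    obtain ⟨k, rfl⟩ : ∃ k, i = k + 2 := ⟨i - 2, by omega⟩
    exact hR.flatFoldable k
  · intro i hi _
    obtain ⟨k, rfl⟩ := hcol i hi
    rw [hA, RowParams.turnAngle_points]
    exact hR.turnAngle_mem k
  · rw [hA, ← hρ, RowParams.turnAngle_points (i := 0), hR.turnAngle_one]
    exact hR.firstEquations
  · intro i hi _
    obtain ⟨k, rfl⟩ := hcol i hi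
    rw [hA]
    exact hR.generalEquations _ k
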